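/- **Setting.** Let $H$ be an infinite-dimensional separable real Hilbert space and $K:H\to H$ a self-adjoint, positive definite, trace-class operator, $K=\sum_{l\ge1}\theta_l\,v_l\otimes v_l$ with $\theta_1\ge\theta_2\ge\dots>0$ and $(v_l)$ an orthonormal basis of $H$. Let $\mathbb K=\{h\in H:\|h\|_{\mathbb K}^2:=\sum_l\langle h,v_l\rangle^2/\theta_l<\infty\}$ with inner product $\langle g,h\rangle_{\mathbb K}=\sum_l\langle g,v_l\rangle\langle h,v_l\rangle/\theta_l$; on $\mathbb K^q$ put $\|\delta\|_{\mathbb K}=(\sum_j\|\delta_j\|_{\mathbb K}^2)^{1/2}$. Let $\mathbb K^{(m)}=\mathrm{span}(v_1,\dots,v_m)$, $h^{(m)}=\sum_{l\le m}\langle h,v_l\rangle v_l$ and $h^{(m)\perp}=h-h^{(m)}$. For each sample size $n$ there are integers $p$, $1\le p_0<p$ and $m$, deterministic predictors $X_{ij}\in H$ and coefficients $\beta^*_j\in\mathbb K$ ($1\le i\le n$, $1\le j\le p$), all of which may depend on $n$. Statements about a given $n$ are assumed for all large $n$, and asymptotics are for $n\to\infty$; $a\ll b$ means $a=o(b)$.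 Write $\mathcal A=\{1,\dots,p_0\}$. Let $$\Gamma_{jk}^{(m)}h=\frac1n\sum_{i=1}^n\langle h,K(X_{ik}^{(m)})\rangle_{\mathbb K}\,K(X_{ij}^{(m)}),\qquad \Gamma_{YX_j}^{(m)}=\frac1n\sum_{i=1}^nY_iK(X_{ij}^{(m)}),$$ and let $\Gamma^{(m)}_{XX}$, $\Gamma^{(m)}_{X_1}$, $\Gamma^{(m)}_{X_2X_1}$ be the operator matrices $(\Gamma^{(m)}_{jk})$ with $(j,k)$ in $\{1,\dots,p\}^2$, $\mathcal A\times\mathcal A$, $\mathcal A^c\times\mathcal A$. **Assumptions.** 1. (Model) $\sum_iX_{ij}=0$ and $n^{-1}\sum_i\|X_{ij}\|_H^2=1$ for all $j$; $\beta^*_j\neq0$ exactly for $j\in\mathcal A$; and, after truncation to the sieve, $Y_i=\sum_{j\le p_0}\langle\beta_j^{*(m)},X_{ij}^{(m)}\rangle_H+\varepsilon_i$, where for each $n$ the errors $\varepsilon_1,\dots,\varepsilon_n$ are i.i.d. with mean $0$, variance $\sigma^2$ and $P(|\varepsilon_i|>t)\le C_1e^{-C_2t^2}$ for all $t\ge0$,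 with constants $\sigma$ and $C_1,C_2>0$ not depending on $n$. 2. (Sieve bounds) $m\to\infty$, $m=O(n)$, and there are constants $b_1,b_2>0$, $\gamma>1$ with $p_0=o(m^{(\gamma-1)/2})$, $\|\beta^*_j\|_{\mathbb K}\le b_1$ and $\theta_l\langle X_{ij},v_l\rangle^2\le b_2l^{-\gamma}$ for all $j\in\mathcal A$, all $l\ge1$ and all $i\le n$. 3. (Restricted eigenvalue) $\alpha_m>0$, where $\alpha_m$ is the minimum of $\|(\Gamma^{(m)}_{XX})^{1/2}\delta\|_{\mathbb K}/\|\delta\|_{\mathbb K}$ over all $0\ne\delta\in(\mathbb K^{(m)})^p$ such that $\sum_{j\notin J}\|\delta_j\|_{\mathbb K}\le3\sum_{j\in J}\|\delta_j\|_{\mathbb K}$ for some $J\subset\{1,\dots,p\}$ with $|J|\le p_0$. 4. There are a constant $\tau$, a sequence $\tau_m>0$ and a tuning parameter $\lambda>0$, the last two depending on $n$, such that: (a) all eigenvalues of $\Gamma^{(m)}_{X_1}$ lie in $[1/\tau_m,\tau]$; (b) with $b=\min_{j\in\mathcal A}\|\beta_j^*\|_{\mathbb K}$, $b_m=\min\{\|\beta_j^{*(m)}\|_{\mathbb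 K}:\beta_j^{*(m)}\ne0\}$ and $\zeta_m=\min\{\tau_m^{-1},\alpha_m^2\}$, one has $\max_{j\in\mathcal A}\|\beta_j^{*(m)\perp}\|_{\mathbb K}=o(b)$ and $b_m\gg p_0\sqrt{\log p}/(\zeta_m\sqrt n)$; (c) $p_0^{1/2}\log(p)\,\zeta_m^{-1}n^{-1}\ll\lambda\ll b_mp_0^{-1/2}n^{-1/2}$; (d) $\|\Gamma^{(m)}_{X_2X_1}(\Gamma^{(m)}_{X_1})^{-1}\|_{\rm op}<1$, in the operator norm for $\|\cdot\|_{\mathbb K}$. **Estimators.** For $\lambda'>0$ and weights $w_j\in[0,\infty]$ let, on $(\mathbb K^{(m)})^p$, $$L_{\lambda',w}(\beta)=\frac1{2n}\sum_{i=1}^n\Big(Y_i-\sum_{j=1}^p\langle\beta_j,X_{ij}^{(m)}\rangle_H\Big)^2+\lambda'\sum_{j=1}^pw_j\|\beta_j\|_{\mathbb K}$$ (with $\infty\cdot0=0$). Let $\tilde\beta^{(m)}$ be any minimizer with all $w_j=1$ and $\lambda'=\tilde\lambda$, where $2\sqrt{n^{-1}\theta_1M\log p}\le\tilde\lambda=O(\sqrt{\log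 p/n})$, and let $\hat\beta^{(m)}$ be any minimizer with $\lambda'=\lambda$ and $w_j=1/\|\tilde\beta_j^{(m)}\|_{\mathbb K}$ ($=\infty$ if $\tilde\beta_j^{(m)}=0$). Let $\hat{\mathcal A}^{(m)}=\{j:\hat\beta_j^{(m)}\ne0\}$, and let $\hat\beta^{O(m)}=\big((\Gamma^{(m)}_{X_1})^{-1}(\Gamma^{(m)}_{YX_j})_{j\in\mathcal A},\,0\big)$ be the sieve-oracle least squares estimator. **Theorem (functional oracle property).** For all $C_1,C_2>0$ there is a constant $M>0$, depending only on $C_1$ and $C_2$, such that under the above assumptions, as $n\to\infty$: (i) $P(\hat{\mathcal A}^{(m)}=\mathcal A)\to1$; (ii) $\|\hat\beta^{(m)}-\hat\beta^{O(m)}\|_{\mathbb K}=o_P(\tau_m/\sqrt n)$; (iii) if in addition $\max_{j\in\mathcal A}\|\beta_j^{*(m)\perp}\|_{\mathbb K}=o(\tau_m/\sqrt{p_0n})$, then $\|\hat\beta^{(m)}-\beta^*\|_{\mathbb K}=o_P(\tau_m/\sqrt n)$. -/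

import Mathlib

open Filter Topology MeasureTheory ProbabilityTheory Asymptotics
open scoped ENNReal

namespace Sofia

noncomputable section

/-- A self-adjoint, positive definite trace-class operator `K` on an (infinite-dimensional separable)
real Hilbert space `H`, together with an ordered eigensystem `K = ∑ θ_l v_l ⊗ v_l`: the `v l` form an
orthonormal basis of `H` and `θ 0 ≥ θ 1 ≥ ⋯` are the corresponding eigenvalues (indices start at `0`).
For a positive operator, being trace class means that `∑ ⟪K e_l, e_l⟫` converges for orthonormal
bases `e`. -/
structure KernelOperator (H : Type*) [NormedAddCommGroup H] [InnerProductSpace ℝ H]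
    [CompleteSpace H] where
  K : H →L[ℝ] H
  isPositive : K.IsPositive
  posDef : ∀ h : H, h ≠ 0 → 0 < inner ℝ (K h) h
  traceClass : ∀ e : HilbertBasis ℕ ℝ H, Summable fun l => inner ℝ (K (e l)) (e l)
  θ : ℕ → ℝ
  v : HilbertBasis ℕ ℝ H
  θ_antitone : Antitone θ
  eigen : ∀ l, K (v l) = θ l • v l

/-- The deterministic part of a regression problem with `n` observations: numbers of predictors `p`
and of active predictors `p₀`, sieve dimension `m`, design `X` and true coefficients `β`. -/
structure Sample (H : Type*) (n : ℕ) where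
  p : ℕ
  p₀ : ℕ
  m : ℕ
  X : Fin n → Fin p → H
  β : Fin p → H

namespace KernelOperator

variable {H : Type*} [NormedAddCommGroup H] [InnerProductSpace ℝ H] [CompleteSpace H]

theorem θ_pos (S : KernelOperator H) (l : ℕ) : 0 < S.θ l := by
  have hne : S.v l ≠ 0 := S.v.orthonormal.ne_zero l
  have h := S.posDef (S.v l) hne
  rw [S.eigen, real_inner_smul_left, real_inner_self_eq_norm_sq, S.v.orthonormal.1 l] at h
  simpa using h

/-- Membership in the space `𝕂 = {h : ∑ ⟪h, v_l⟫² / θ_l < ∞}`. -/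
def MemK (S : KernelOperator H) (h : H) : Prop :=
  Summable fun l => (inner ℝ h (S.v l)) ^ 2 / S.θ l

/-- The norm of `𝕂`. -/
def kNorm (S : KernelOperator H) (h : H) : ℝ :=
  Real.sqrt (∑' l, (inner ℝ h (S.v l)) ^ 2 / S.θ l)

/-- The inner product of `𝕂`. -/
def kInner (S : KernelOperator H) (g h : H) : ℝ :=
  ∑' l, inner ℝ g (S.v l) * inner ℝ h (S.v l) / S.θ l

/-- The norm `(∑_j ‖δ_j‖_𝕂²)^{1/2}` of a product of copies of `𝕂`. -/
def kNormProd (S : KernelOperator H) {ι : Type*} [Fintype ι] (δ : ι → H) : ℝ :=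
  Real.sqrt (∑ j, S.kNorm (δ j) ^ 2)

/-- The sieve space `𝕂^(m) = span {v_0, …, v_{m-1}}`. -/
def sieve (S : KernelOperator H) (m : ℕ) : Submodule ℝ H :=
  Submodule.span ℝ (S.v '' {l | l < m})

/-- The projection `h ↦ h^(m)` onto the span of the first `m` eigenvectors. -/
def proj (S : KernelOperator H) (m : ℕ) (h : H) : H :=
  ∑ l ∈ Finset.range m, inner ℝ h (S.v l) • S.v l

theorem proj_mem (S : KernelOperator H) (m : ℕ) (h : H) : S.proj m h ∈ S.sieve m :=
  Submodule.sum_mem _ fun l hl => Submodule.smul_mem _ _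
    (Submodule.subset_span ⟨l, Finset.mem_range.1 hl, rfl⟩)

theorem K_proj_mem (S : KernelOperator H) (m : ℕ) (h : H) : S.K (S.proj m h) ∈ S.sieve m := by
  unfold proj
  rw [map_sum]
  refine Submodule.sum_mem _ fun l hl => ?_
  rw [map_smul, S.eigen]
  exact Submodule.smul_mem _ _ (Submodule.smul_mem _ _
    (Submodule.subset_span ⟨l, Finset.mem_range.1 hl, rfl⟩))

theorem kInner_K (S : KernelOperator H) (g x : H) : S.kInner g (S.K x) = inner ℝ g x := by
  unfold kInner
  rw [← S.v.tsum_inner_mul_inner g x]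
  congr 1
  ext l
  have h1 : inner ℝ (S.K x) (S.v l) = S.θ l * inner ℝ x (S.v l) := by
    have := S.isPositive.isSymmetric x (S.v l)
    simp only [ContinuousLinearMap.coe_coe] at this
    rw [this, S.eigen, real_inner_smul_right]
  rw [h1, real_inner_comm x (S.v l)]
  have := (S.θ_pos l).ne'
  field_simp

/-- The finite-dimensional empirical (cross-)covariance operator matrix `(Γ_{jk}^(m))_{j,k}` between the
families of predictors `X` (rows) and `Z` (columns):
`Γ_{jk}^(m) h = n⁻¹ ∑_i ⟪h, K(Z_{ik}^(m))⟫_𝕂 K(X_{ij}^(m))`. -/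
def cov (S : KernelOperator H) (m : ℕ) {n : ℕ} {ι κ : Type*} [Fintype κ]
    (X : Fin n → ι → H) (Z : Fin n → κ → H) : (κ → S.sieve m) →ₗ[ℝ] (ι → S.sieve m) where
  toFun δ j := (n : ℝ)⁻¹ • ∑ i, (∑ k, S.kInner (δ k : H) (S.K (S.proj m (Z i k)))) •
    (⟨S.K (S.proj m (X i j)), S.K_proj_mem m _⟩ : S.sieve m)
  map_add' δ δ' := by
    funext j
    simp only [kInner_K, Pi.add_apply, Submodule.coe_add, inner_add_left,
      Finset.sum_add_distrib, add_smul, smul_add]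
  map_smul' c δ := by
    funext j
    simp only [kInner_K, Pi.smul_apply, Submodule.coe_smul, real_inner_smul_left,
      ← Finset.mul_sum, mul_smul, ← Finset.smul_sum, RingHom.id_apply]
    rw [smul_comm]

/-- The vector `(Γ_{Y X_j}^(m))_j` with `Γ_{Y X_j}^(m) = n⁻¹ ∑_i Y_i K(X_{ij}^(m))`. -/
def crossCov (S : KernelOperator H) (m : ℕ) {n : ℕ} {ι : Type*}
    (Y : Fin n → ℝ) (X : Fin n → ι → H) : ι → S.sieve m :=
  fun j => (n : ℝ)⁻¹ • ∑ i, Y i • (⟨S.K (S.proj m (X i j)), S.K_proj_mem m _⟩ : S.sieve m)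

/-- The operator norm, with respect to the product norms of `𝕂`, of a linear map between finite
products of sieve spaces. -/
def kOpNorm (S : KernelOperator H) {m : ℕ} {ι κ : Type*} [Fintype ι] [Fintype κ]
    (T : (κ → S.sieve m) →ₗ[ℝ] (ι → S.sieve m)) : ℝ :=
  sInf {c : ℝ | 0 ≤ c ∧ ∀ δ : κ → S.sieve m,
    S.kNormProd (fun j => (T δ j : H)) ≤ c * S.kNormProd (fun j => (δ j : H))}

/-- The norm `‖Γ^{1/2} δ‖_𝕂 = ⟪Γ δ, δ⟫_𝕂^{1/2}` for the covariance operator matrix `Γ = Γ_XX^(m)`. -/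
def sqrtCovNorm (S : KernelOperator H) {m n : ℕ} {ι : Type*} [Fintype ι]
    (X : Fin n → ι → H) (δ : ι → S.sieve m) : ℝ :=
  Real.sqrt (∑ j, S.kInner (S.cov m X X δ j : H) (δ j : H))

/-- The penalized least squares objective on the sieve space,
`(2n)⁻¹ ∑_i (Y_i - ∑_j ⟪β_j, X_{ij}^(m)⟫)² + Λ ∑_j w_j ‖β_j‖_𝕂`.
The weights may be infinite; since `∞ * 0 = 0` in `ℝ≥0∞`, an infinite weight forces `β_j = 0`. -/
def objective (S : KernelOperator H) (m : ℕ) {n : ℕ} {ι : Type*} [Fintype ι]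
    (X : Fin n → ι → H) (Y : Fin n → ℝ) (Λ : ℝ) (w : ι → ℝ≥0∞) (β : ι → S.sieve m) : ℝ≥0∞ :=
  ENNReal.ofReal
      ((2 * (n : ℝ))⁻¹ * ∑ i, (Y i - ∑ j, inner ℝ (β j : H) (S.proj m (X i j))) ^ 2) +
    ENNReal.ofReal Λ * ∑ j, w j * ENNReal.ofReal (S.kNorm (β j : H))

/-- `β` minimizes the objective over `(𝕂^(m))^p`. -/
def IsMinimizer (S : KernelOperator H) (m : ℕ) {n : ℕ} {ι : Type*} [Fintype ι]
    (X : Fin n → ι → H) (Y : Fin n → ℝ) (Λ : ℝ) (w : ι → ℝ≥0∞) (β : ι → S.sieve m) : Prop :=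
  ∀ β' : ι → S.sieve m, S.objective m X Y Λ w β ≤ S.objective m X Y Λ w β'

/-- The adaptive weights `1 / ‖β̃_j‖_𝕂`, equal to `∞` when `β̃_j = 0`. -/
def adaptiveWeight (S : KernelOperator H) {m : ℕ} {ι : Type*} (β : ι → S.sieve m) : ι → ℝ≥0∞ :=
  fun j => (ENNReal.ofReal (S.kNorm (β j : H)))⁻¹

end KernelOperator

namespace Sample

variable {H : Type*} {n : ℕ}

/-- The set `𝒜` of the first `p₀` predictors. -/
def active (D : Sample H n) : Finset (Fin D.p) := Finset.univ.filter fun j => j.val < D.p₀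

/-- The design of the active predictors. -/
def X₁ (D : Sample H n) : Fin n → {j // j ∈ D.active} → H := fun i j => D.X i j

/-- The design of the null predictors. -/
def X₂ (D : Sample H n) : Fin n → {j // j ∉ D.active} → H := fun i j => D.X i j

variable [NormedAddCommGroup H] [InnerProductSpace ℝ H] [CompleteSpace H]

/-- The response of the linear model on the sieve,
`Y_i = ∑_{j ∈ 𝒜} ⟪β*_j^(m), X_{ij}^(m)⟫ + ε_i`. -/
def response (D : Sample H n) (S : KernelOperator H) (ε : Fin n → ℝ) : Fin n → ℝ :=
  fun i => ∑ j ∈ D.active, inner ℝ (S.proj D.m (D.β j)) (S.proj D.m (D.X i j)) + ε i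

/-- The operator matrix `Γ_{X₁}^(m)` of the active predictors. -/
def covActive (D : Sample H n) (S : KernelOperator H) :
    Module.End ℝ ({j // j ∈ D.active} → S.sieve D.m) :=
  S.cov D.m D.X₁ D.X₁

/-- The restricted eigenvalue constant
`α_m = min ‖Γ_XX^(m)1/2 δ‖ / ‖δ‖` over nonzero `δ ∈ (𝕂^(m))^p` such that
`∑_{j ∉ J} ‖δ_j‖ ≤ 3 ∑_{j ∈ J} ‖δ_j‖` for some `J` with `|J| ≤ p₀`. -/
def reConst (D : Sample H n) (S : KernelOperator H) : ℝ :=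
  sInf {r : ℝ | ∃ (J : Finset (Fin D.p)) (δ : Fin D.p → S.sieve D.m),
    J.card ≤ D.p₀ ∧ δ ≠ 0 ∧
    ∑ j ∈ Jᶜ, S.kNorm (δ j : H) ≤ 3 * ∑ j ∈ J, S.kNorm (δ j : H) ∧
    r = S.sqrtCovNorm D.X δ / S.kNormProd (fun j => (δ j : H))}

/-- `b = min_{j ∈ 𝒜} ‖β*_j‖_𝕂`. -/
def minSignal (D : Sample H n) (S : KernelOperator H) : ℝ :=
  sInf {r : ℝ | ∃ j ∈ D.active, r = S.kNorm (D.β j)}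

/-- `b_m = min ‖β*_j^(m)‖_𝕂` over the support `𝒜^(m)` of `β*^(m)`. -/
def minSieveSignal (D : Sample H n) (S : KernelOperator H) : ℝ :=
  sInf {r : ℝ | ∃ j, S.proj D.m (D.β j) ≠ 0 ∧ r = S.kNorm (S.proj D.m (D.β j))}

/-- `max_{j ∈ 𝒜} ‖β*_j - β*_j^(m)‖_𝕂`. -/
def maxTail (D : Sample H n) (S : KernelOperator H) : ℝ :=
  ⨆ j : {j // j ∈ D.active}, S.kNorm (D.β j - S.proj D.m (D.β j))

/-- The sieve-oracle least squares estimator `(Γ_{X₁}^(m)⁻¹ Γ_{Y X₁}^(m), 0)`. -/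
def oracle (D : Sample H n) (S : KernelOperator H) (Y : Fin n → ℝ) : Fin D.p → S.sieve D.m :=
  fun j => if h : j ∈ D.active then
    (Ring.inverse (D.covActive S)) (S.crossCov D.m Y D.X₁) ⟨j, h⟩ else 0

end Sample

variable {H : Type*} [NormedAddCommGroup H] [InnerProductSpace ℝ H] [CompleteSpace H]

/-- The design is standardized, and the coefficients lie in `𝕂` and have support `{1, …, p₀}`, where
`1 ≤ p₀ < p`. -/
structure IsModelDesign (S : KernelOperator H) {n : ℕ} (D : Sample H n) : Prop where
  p₀_pos : 0 < D.p₀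
  p₀_lt : D.p₀ < D.p
  centered : ∀ j, ∑ i, D.X i j = 0
  normalized : ∀ j, (n : ℝ)⁻¹ * ∑ i, ‖D.X i j‖ ^ 2 = 1
  memK : ∀ j, S.MemK (D.β j)
  support : ∀ j, D.β j ≠ 0 ↔ j ∈ D.active

/-- The errors are i.i.d., centered, of variance `σ²`, with sub-Gaussian tails. -/
structure IsModelError {Ω : Type*} [MeasurableSpace Ω] (μ : Measure Ω) (σ C₁ C₂ : ℝ) {n : ℕ}
    (ε : Fin n → Ω → ℝ) : Prop where
  aemeasurable : ∀ i, AEMeasurable (ε i) μ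
  indep : iIndepFun ε μ
  identDistrib : ∀ i i', IdentDistrib (ε i) (ε i') μ μ
  mean : ∀ i, ∫ ω, ε i ω ∂μ = 0
  variance : ∀ i, variance (ε i) μ = σ ^ 2
  tail : ∀ i, ∀ t : ℝ, 0 ≤ t → μ {ω | t < |ε i ω|} ≤ ENNReal.ofReal (C₁ * Real.exp (-C₂ * t ^ 2))

/-- Sieve dimension, sparsity, and bounds on the active coefficients and predictors. -/
structure SieveBounds (S : KernelOperator H) (D : ∀ n, Sample H n) (b₁ b₂ γ : ℝ) : Prop where
  b₁_pos : 0 < b₁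
  b₂_pos : 0 < b₂
  one_lt_γ : 1 < γ
  m_tendsto : Tendsto (fun n => (D n).m) atTop atTop
  m_bigO : (fun n => ((D n).m : ℝ)) =O[atTop] fun n => (n : ℝ)
  sparse : (fun n => ((D n).p₀ : ℝ)) =o[atTop] fun n => ((D n).m : ℝ) ^ ((γ - 1) / 2)
  coeff_le : ∀ᶠ n in atTop, ∀ j ∈ (D n).active, S.kNorm ((D n).β j) ≤ b₁
  predictor_le : ∀ᶠ n in atTop, ∀ j ∈ (D n).active, ∀ l i,
    S.θ l * (inner ℝ ((D n).X i j) (S.v l)) ^ 2 ≤ b₂ * ((l : ℝ) + 1) ^ (-γ)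

/-- `ζ_m = min {τ_m⁻¹, α_m²}`. -/
def zeta (S : KernelOperator H) (D : ∀ n, Sample H n) (τm : ℕ → ℝ) (n : ℕ) : ℝ :=
  min (τm n)⁻¹ ((D n).reConst S ^ 2)

/-- Eigenvalue bounds, minimum signal, rate of the tuning parameter `Λ` of the adaptive step, and the
irrepresentable condition. -/
structure AsymptoticConditions (S : KernelOperator H) (D : ∀ n, Sample H n) (τ : ℝ)
    (τm Λ : ℕ → ℝ) : Prop where
  τm_pos : ∀ᶠ n in atTop, 0 < τm n
  eigenvalues : ∀ᶠ n in atTop, ∀ s : ℝ, ((D n).covActive S).HasEigenvalue s →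
    1 / τm n ≤ s ∧ s ≤ τ
  tail_small : (fun n => (D n).maxTail S) =o[atTop] fun n => (D n).minSignal S
  signal : (fun n => (D n).p₀ * Real.sqrt (Real.log (D n).p) / (zeta S D τm n * Real.sqrt n))
    =o[atTop] fun n => (D n).minSieveSignal S
  tuning_pos : ∀ᶠ n in atTop, 0 < Λ n
  tuning_lower : (fun n => Real.sqrt (D n).p₀ * Real.log (D n).p * (zeta S D τm n)⁻¹ * (n : ℝ)⁻¹)
    =o[atTop] Λ
  tuning_upper : Λ =o[atTop]
    fun n => (D n).minSieveSignal S * (Real.sqrt (D n).p₀)⁻¹ * (Real.sqrt n)⁻¹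
  irrepresentable : ∀ᶠ n in atTop,
    S.kOpNorm (S.cov (D n).m (D n).X₂ (D n).X₁ ∘ₗ Ring.inverse ((D n).covActive S)) < 1

/-- Tuning of the lasso step: `2 (n⁻¹ θ_1 M log p)^{1/2} ≤ Λ = O((log p / n)^{1/2})`. -/
structure LassoTuning (S : KernelOperator H) (D : ∀ n, Sample H n) (M : ℝ) (Λ : ℕ → ℝ) : Prop where
  lower : ∀ᶠ n : ℕ in atTop, 2 * Real.sqrt ((n : ℝ)⁻¹ * S.θ 0 * M * Real.log (D n).p) ≤ Λ n
  upper : Λ =O[atTop] fun n : ℕ => Real.sqrt (Real.log (D n).p / n)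

/-- `Z_n = o_P(r_n)` for nonnegative `Z_n` and positive rates `r_n`. -/
def IsLittleOP {Ω : Type*} [MeasurableSpace Ω] (μ : Measure Ω) (Z : ℕ → Ω → ℝ) (r : ℕ → ℝ) : Prop :=
  ∀ η : ℝ, 0 < η → Tendsto (fun n => μ {ω | η * r n ≤ Z n ω}) atTop (𝓝 0)

end

end Sofia

/-! In coordinates for the 𝕂-orthonormal basis `√θ_l v_l` the sieve problem is a finite-dimensional
group lasso: `Y = T b + e` with blocks of size `m`, and the covariance operator is `n⁻¹ TᵀT`
(`coords_cov`). Write `T₁`, `T₂` for the active and null parts of `T`. The argument is deterministic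
on an event of probability close to one, where the pilot error, the noise projected off the range of
`T₁`, and the oracle error have their typical sizes (`IsGoodEvent`).

Pilot error. If the penalty dominates every block of `n⁻¹ Tᵀe`, minimality and the restricted
eigenvalue give an error of order `√p₀ √(log p) / (ζ_m √n)`. By sub-Gaussian concentration and a
union bound this fails with probability at most `3/p`. As `p` may stay bounded, a second bound is
needed: the noise acts only through its projection onto the range of `T`, of dimension at most `p
m`, and `m = O(τ_m)` gives the same rate.

No false positives (`groupLasso_support_subset`). Let `δ` be the null blocks of the adaptive
estimator. Project `T₂ δ` to `T₁ x` in the range of `T₁`, drop `δ` and add `x` to the active blocks.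
The irrepresentable condition gives `‖x‖ ≤ ‖δ‖`. The loss rises by at most the residual noise times
`∑ ‖δ_j‖`, the active penalty by at most `λ (2/b_m) √p₀ ‖δ‖`, while the null penalty saved carries
weights at least the inverse pilot error. The rates make the saving larger unless `δ = 0`.

Closeness. On the active blocks `n⁻¹ T₁ᵀT₁ ≥ τ_m⁻¹`, so the distance to least squares is of order
`τ_m λ √p₀ / b_m = o(τ_m/√n)`. The oracle error is `O_P(√(p₀ m τ_m / n))`. Testing the eigenvalue
bound on the last sieve direction yields `m^γ ≤ b₂ τ_m`, hence `p₀ m = o(τ_m)`, and the oracle error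
is `o_P(τ_m/√n)` as well. Since `b_m ≫ τ_m/√n`, no active block is lost, and Pythagoras in 𝕂 adds
the truncation error for the last claim. -/

namespace Sofia

/-! ### Sub-Gaussian variables from tail bounds. -/

section SubGaussian

open Real
open scoped NNReal

variable {Ω : Type*} [MeasurableSpace Ω] {μ : Measure Ω}

/-- Layer-cake formula: levels `t ≤ 1` contribute at most 1, and at a level `t > 1` the tail bound
at `√(2 log t / C₂)` is `C₁ t⁻²`, which integrates to `C₁`. Halving `C₂` in the exponent is what
produces the integrable power. -/
theorem lintegral_exp_sq_le [IsProbabilityMeasure μ] {X : Ω → ℝ} {C₁ C₂ : ℝ} (hC₁ : 0 < C₁)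
    (hC₂ : 0 < C₂) (hX : AEMeasurable X μ)
    (tail : ∀ t : ℝ, 0 ≤ t → μ {ω | t < |X ω|} ≤ ENNReal.ofReal (C₁ * exp (-C₂ * t ^ 2))) :
    ∫⁻ ω, ENNReal.ofReal (exp (C₂ / 2 * X ω ^ 2)) ∂μ ≤ ENNReal.ofReal (1 + C₁) := by
  rw [lintegral_eq_lintegral_meas_lt μ (ae_of_all _ fun ω => (exp_pos _).le)
    ((hX.pow_const 2).const_mul _).exp]
  rw [← Set.Ioc_union_Ioi_eq_Ioi (zero_le_one (α := ℝ)),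
    lintegral_union measurableSet_Ioi (Set.Ioc_disjoint_Ioi le_rfl),
    ENNReal.ofReal_add zero_le_one hC₁.le]
  refine add_le_add ?_ ?_
  · calc ∫⁻ t in Set.Ioc (0 : ℝ) 1, μ {a | t < exp (C₂ / 2 * X a ^ 2)}
        ≤ ∫⁻ _ in Set.Ioc (0 : ℝ) 1, 1 := lintegral_mono fun _ => prob_le_one
      _ = ENNReal.ofReal 1 := by simp
  · have key : ∀ t ∈ Set.Ioi (1 : ℝ), μ {a | t < exp (C₂ / 2 * X a ^ 2)}
        ≤ ENNReal.ofReal (C₁ * t ^ (-2 : ℝ)) := by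
      intro t ht
      have ht1 : (1 : ℝ) < t := ht
      have ht0 : 0 < t := by linarith
      have hlog : 0 ≤ log t / (C₂ / 2) := by
        have := log_nonneg ht1.le
        positivity
      have hsub : {a | t < exp (C₂ / 2 * X a ^ 2)} ⊆ {a | √(log t / (C₂ / 2)) < |X a|} := by
        intro a ha
        have h1 : log t < C₂ / 2 * X a ^ 2 := (log_lt_iff_lt_exp ht0).2 ha
        refine (sqrt_lt' ?_).2 ?_
        · refine abs_pos.2 fun h0 => ?_
          have := log_pos ht1
          rw [h0] at h1
          simp at h1
          linarith
        · rw [sq_abs, div_lt_iff₀ (by positivity)]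
          linarith
      refine (measure_mono hsub).trans ((tail _ (sqrt_nonneg _)).trans_eq ?_)
      rw [sq_sqrt hlog, rpow_def_of_pos ht0]
      congr 3
      field_simp
    calc ∫⁻ t in Set.Ioi (1 : ℝ), μ {a | t < exp (C₂ / 2 * X a ^ 2)}
        ≤ ∫⁻ t in Set.Ioi (1 : ℝ), ENNReal.ofReal (C₁ * t ^ (-2 : ℝ)) :=
          setLIntegral_mono' measurableSet_Ioi key
      _ = ENNReal.ofReal (∫ t in Set.Ioi (1 : ℝ), C₁ * t ^ (-2 : ℝ)) := by
          rw [ofReal_integral_eq_lintegral_ofReal]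
          · exact (integrableOn_Ioi_rpow_of_lt (by norm_num) one_pos).const_mul _
          · filter_upwards [ae_restrict_mem measurableSet_Ioi] with t ht
            have : (0 : ℝ) < t := lt_trans one_pos ht
            simp only [Pi.zero_apply]
            positivity
      _ = ENNReal.ofReal C₁ := by
          rw [integral_const_mul, integral_Ioi_rpow_of_lt (by norm_num) one_pos]
          norm_num
      _ ≤ _ := le_rfl

theorem integrable_exp_sq [IsProbabilityMeasure μ] {X : Ω → ℝ} {C₁ C₂ : ℝ} (hC₁ : 0 < C₁)
    (hC₂ : 0 < C₂) (hX : AEMeasurable X μ)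
    (tail : ∀ t : ℝ, 0 ≤ t → μ {ω | t < |X ω|} ≤ ENNReal.ofReal (C₁ * exp (-C₂ * t ^ 2))) :
    Integrable (fun ω => exp (C₂ / 2 * X ω ^ 2)) μ ∧
      ∫ ω, exp (C₂ / 2 * X ω ^ 2) ∂μ ≤ 1 + C₁ := by
  have h := lintegral_exp_sq_le hC₁ hC₂ hX tail
  have hm : AEStronglyMeasurable (fun ω => exp (C₂ / 2 * X ω ^ 2)) μ :=
    ((hX.pow_const 2).const_mul _).exp.aestronglyMeasurable
  have hnn : 0 ≤ᵐ[μ] fun ω => exp (C₂ / 2 * X ω ^ 2) := ae_of_all _ fun ω => (exp_pos _).le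
  refine ⟨⟨hm, (hasFiniteIntegral_iff_ofReal hnn).2 (h.trans_lt ENNReal.ofReal_lt_top)⟩, ?_⟩
  rw [integral_eq_lintegral_of_nonneg_ae hnn hm]
  exact ENNReal.toReal_le_of_le_ofReal (by linarith) h

/-- Keeps the linear term exact, so that it integrates to zero for a centered variable. It follows
from `1 + y ≤ exp y` at `y = x` and `y = -x`. -/
theorem exp_le_one_add_add_sq_mul_exp_abs (x : ℝ) : exp x ≤ 1 + x + x ^ 2 * exp |x| := by
  have h1 : exp x - 1 ≤ x * exp x := by
    have := add_one_le_exp (-x)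
    have h2 : exp (-x) * exp x = 1 := by rw [← exp_add]; simp
    nlinarith [exp_pos x]
  rcases le_total 0 x with h | h
  · rw [abs_of_nonneg h]
    nlinarith [mul_le_mul_of_nonneg_left h1 h]
  · have h3 := add_one_le_exp x
    have h4 : (1 : ℝ) ≤ exp |x| := one_le_exp (abs_nonneg _)
    nlinarith [mul_nonneg (sq_nonneg x) (sub_nonneg.2 h4)]

/-- A centered variable with tails `C₁ exp (-C₂ t²)` is sub-Gaussian, with a constant that depends
only on `C₁` and `C₂`. -/
theorem hasSubgaussianMGF_of_tail {C₁ C₂ : ℝ} (hC₁ : 0 < C₁) (hC₂ : 0 < C₂) :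
    ∃ c : ℝ≥0, 0 < c ∧ ∀ {Ω : Type*} [MeasurableSpace Ω] (μ : Measure Ω) [IsProbabilityMeasure μ]
      (X : Ω → ℝ), AEMeasurable X μ → ∫ ω, X ω ∂μ = 0 →
      (∀ t : ℝ, 0 ≤ t → μ {ω | t < |X ω|} ≤ ENNReal.ofReal (C₁ * exp (-C₂ * t ^ 2))) →
      HasSubgaussianMGF X c μ := by
  set a := C₂ / 2 with ha
  have ha0 : 0 < a := by positivity
  set k : ℝ := 1 / a + 2 / a * (1 + C₁) with hk
  have hk0 : 0 < k := by positivity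
  refine ⟨⟨2 * k, by positivity⟩, ?_, ?_⟩
  · change (0 : ℝ) < 2 * k
    positivity
  intro Ω _ μ _ X hX hmean tail
  obtain ⟨hint, hle⟩ := integrable_exp_sq hC₁ hC₂ hX tail
  rw [← ha] at hint hle
  -- Young's inequality, spending so small a share of `a x²` that the factor `x²` of the expansion
  -- can still be absorbed (by `hsq`) within the integrable `exp (a x²)`.
  have hbd : ∀ t x : ℝ, |t * x| ≤ t ^ 2 / a + a * x ^ 2 / 4 := by
    intro t x
    rw [abs_mul, ← sq_abs t, ← sq_abs x]
    have h : 0 ≤ (|t| - a * |x| / 2) ^ 2 / a := by positivity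
    have h' : (|t| - a * |x| / 2) ^ 2 / a = |t| ^ 2 / a - |t| * |x| + a * |x| ^ 2 / 4 := by
      field_simp
      ring
    linarith
  have hmeas : ∀ t : ℝ, AEStronglyMeasurable (fun ω => exp (t * X ω)) μ := fun t =>
    (hX.const_mul t).exp.aestronglyMeasurable
  have hexp : ∀ t : ℝ, Integrable (fun ω => exp (t * X ω)) μ := by
    intro t
    refine (hint.const_mul (exp (t ^ 2 / a))).mono (hmeas t) (ae_of_all _ fun ω => ?_)
    rw [norm_of_nonneg (exp_pos _).le, norm_of_nonneg (by positivity), ← exp_add]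
    refine exp_le_exp.2 ((le_abs_self _).trans ((hbd t _).trans ?_))
    nlinarith [mul_nonneg ha0.le (sq_nonneg (X ω))]
  have hsq : ∀ x : ℝ, x ^ 2 ≤ 2 / a * exp (a * x ^ 2 / 2) := by
    intro x
    have := add_one_le_exp (a * x ^ 2 / 2)
    rw [div_mul_eq_mul_div, le_div_iff₀ ha0]
    nlinarith
  have hXint : Integrable X μ := by
    refine (hint.const_mul (1 / a + 1)).mono hX.aestronglyMeasurable (ae_of_all _ fun ω => ?_)
    rw [norm_of_nonneg (by positivity : (0 : ℝ) ≤ (1 / a + 1) * exp (a * X ω ^ 2)), norm_eq_abs]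
    have h1 := hbd 1 (X ω)
    have h2 := add_one_le_exp (a * X ω ^ 2)
    have h3 : (0 : ℝ) ≤ a * X ω ^ 2 := by positivity
    have h4 : (1 : ℝ) / a ≤ 1 / a * exp (a * X ω ^ 2) :=
      le_mul_of_one_le_right (by positivity) (by linarith)
    rw [one_mul, one_pow] at h1
    linarith
  refine ⟨hexp, fun t => ?_⟩
  have hpt : ∀ x : ℝ, exp (t * x) ≤
      1 + t * x + t ^ 2 * (2 / a) * exp (t ^ 2 / a) * exp (a * x ^ 2) := by
    intro x
    refine (exp_le_one_add_add_sq_mul_exp_abs _).trans ?_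
    have h1 : exp |t * x| ≤ exp (t ^ 2 / a) * exp (a * x ^ 2 / 2) := by
      rw [← exp_add]
      refine exp_le_exp.2 ((hbd t x).trans ?_)
      nlinarith [mul_nonneg ha0.le (sq_nonneg x)]
    have h2 : (t * x) ^ 2 * exp |t * x| ≤
        (t ^ 2 * (2 / a * exp (a * x ^ 2 / 2))) * (exp (t ^ 2 / a) * exp (a * x ^ 2 / 2)) := by
      rw [mul_pow]
      gcongr
      exact hsq x
    have h3 : exp (a * x ^ 2) = exp (a * x ^ 2 / 2) * exp (a * x ^ 2 / 2) := by
      rw [← exp_add]; congr 1; ring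
    rw [h3]
    linarith
  have hI : Integrable (fun ω => 1 + t * X ω +
      t ^ 2 * (2 / a) * exp (t ^ 2 / a) * exp (a * X ω ^ 2)) μ :=
    ((integrable_const _).add (hXint.const_mul t)).add (hint.const_mul _)
  have hval : mgf X μ t ≤ 1 + t ^ 2 * (2 / a) * exp (t ^ 2 / a) * (1 + C₁) := by
    refine (integral_mono (hexp t) hI fun ω => hpt (X ω)).trans ?_
    have hI' : Integrable (fun ω => 1 + t * X ω) μ := (integrable_const _).add (hXint.const_mul t)
    rw [integral_add hI' (hint.const_mul _),
      integral_add (integrable_const _) (hXint.const_mul t), integral_const_mul,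
      integral_const_mul, hmean]
    simp only [integral_const, probReal_univ, smul_eq_mul, mul_one, mul_zero, add_zero]
    gcongr
  refine hval.trans ?_
  -- Replacing 1 by `exp (t²/a)` lets this factor be pulled out; `1 + y ≤ exp y` turns the rest into
  -- an exponential, and the exponents add up to `k t²`.
  have h1 : (1 : ℝ) ≤ exp (t ^ 2 / a) := one_le_exp (by positivity)
  have h2 : t ^ 2 * (2 / a) * (1 + C₁) + 1 ≤ exp (t ^ 2 * (2 / a) * (1 + C₁)) := add_one_le_exp _
  calc 1 + t ^ 2 * (2 / a) * exp (t ^ 2 / a) * (1 + C₁)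
      ≤ exp (t ^ 2 / a) * (t ^ 2 * (2 / a) * (1 + C₁) + 1) := by linarith
    _ ≤ exp (t ^ 2 / a) * exp (t ^ 2 * (2 / a) * (1 + C₁)) := by gcongr
    _ = exp (((⟨2 * k, by positivity⟩ : ℝ≥0) : ℝ) * t ^ 2 / 2) := by
        rw [← exp_add]
        congr 1
        change _ = 2 * k * t ^ 2 / 2
        rw [hk]
        ring

/-- The Chernoff tails `2 exp (-t²/(2c))` enter the layer-cake bound with constants `2` and
`1/(2c)`; hence the threshold `1/(4c)` for `s` and the value `1 + 2`. -/
theorem HasSubgaussianMGF.lintegral_exp_sq_le [IsProbabilityMeasure μ] {X : Ω → ℝ} {c : ℝ≥0}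
    (h : HasSubgaussianMGF X c μ) {s : ℝ} (hc : 0 < c) (hs : s * (4 * c) ≤ 1) :
    ∫⁻ ω, ENNReal.ofReal (exp (s * X ω ^ 2)) ∂μ ≤ 3 := by
  have hc' : (0 : ℝ) < c := hc
  have tail : ∀ t : ℝ, 0 ≤ t →
      μ {ω | t < |X ω|} ≤ ENNReal.ofReal (2 * exp (-(1 / (2 * c)) * t ^ 2)) := by
    intro t ht
    have hsub : {ω | t < |X ω|} ⊆ {ω | t ≤ X ω} ∪ {ω | t ≤ (-X) ω} := by
      intro ω hω
      rcases lt_abs.1 (show t < |X ω| from hω) with h | h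
      · exact Or.inl h.le
      · exact Or.inr h.le
    have h1 := h.measure_ge_le ht
    have h2 := h.neg.measure_ge_le ht
    refine (measure_mono hsub).trans ((measure_union_le _ _).trans ?_)
    rw [two_mul, ENNReal.ofReal_add (exp_pos _).le (exp_pos _).le]
    have e : -t ^ 2 / (2 * (c : ℝ)) = -(1 / (2 * (c : ℝ))) * t ^ 2 := by ring
    rw [e] at h1 h2
    exact add_le_add ((ENNReal.le_ofReal_iff_toReal_le (measure_ne_top _ _) (exp_pos _).le).2 h1)
      ((ENNReal.le_ofReal_iff_toReal_le (measure_ne_top _ _) (exp_pos _).le).2 h2)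
  have key := Sofia.lintegral_exp_sq_le two_pos (by positivity) h.aemeasurable tail
  refine (lintegral_mono fun ω => ENNReal.ofReal_le_ofReal (exp_le_exp.2 ?_)).trans
    (key.trans (by norm_num))
  refine mul_le_mul_of_nonneg_right ?_ (sq_nonneg _)
  rw [div_div, le_div_iff₀ (by positivity)]
  linarith

end SubGaussian

end Sofia

namespace Sofia

/-! ### Linear and quadratic forms of the noise. -/

section Noise

open Real
open scoped NNReal

variable {Ω : Type*} [MeasurableSpace Ω] {μ : Measure Ω} {n : ℕ}

theorem noise_inner_eq_sum (u : EuclideanSpace ℝ (Fin n)) (e : Fin n → ℝ) :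
    inner ℝ u (WithLp.toLp 2 e) = ∑ i, u i * e i := by
  simp [PiLp.inner_apply, mul_comm]

theorem hasSubgaussianMGF_inner [IsProbabilityMeasure μ] {e : Fin n → Ω → ℝ} {c : ℝ≥0}
    (hind : iIndepFun e μ) (hsub : ∀ i, HasSubgaussianMGF (e i) c μ)
    (u : EuclideanSpace ℝ (Fin n)) :
    HasSubgaussianMGF (fun ω => inner ℝ u (WithLp.toLp 2 fun i => e i ω))
      (⟨‖u‖ ^ 2, sq_nonneg _⟩ * c) μ := by
  simp only [noise_inner_eq_sum]
  have h := HasSubgaussianMGF.sum_of_iIndepFun (s := Finset.univ)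
    (hind.comp (fun i x => u i * x) fun i => measurable_const_mul (u i))
    (c := fun i => ⟨(u i) ^ 2, sq_nonneg _⟩ * c) fun i _ => (hsub i).const_mul (u i)
  simp only [Function.comp_apply] at h
  convert h using 1
  apply NNReal.coe_injective
  rw [NNReal.coe_sum]
  change ‖u‖ ^ 2 * (c : ℝ) = ∑ i, (u i) ^ 2 * (c : ℝ)
  rw [EuclideanSpace.norm_sq_eq, Finset.sum_mul]
  simp

theorem aemeasurable_noise_inner {e : Fin n → Ω → ℝ} (he : ∀ i, AEMeasurable (e i) μ)
    (u : EuclideanSpace ℝ (Fin n)) :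
    AEMeasurable (fun ω => inner ℝ u (WithLp.toLp 2 fun i => e i ω)) μ := by
  simp only [noise_inner_eq_sum]
  exact Finset.aemeasurable_fun_sum _ fun i _ => (he i).const_mul _

/-- Concentration of a quadratic form in independent sub-Gaussian variables. -/
theorem measure_le_sum_inner_sq_le [IsProbabilityMeasure μ] {e : Fin n → Ω → ℝ} {c : ℝ≥0}
    (hc : 0 < c) (hind : iIndepFun e μ) (hsub : ∀ i, HasSubgaussianMGF (e i) c μ)
    {κ : Type*} [Fintype κ] (u : κ → EuclideanSpace ℝ (Fin n)) {T s : ℝ}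
    (hu : ∑ l, ‖u l‖ ^ 2 ≤ T) (hs : 0 < s) :
    μ {ω | s ≤ ∑ l, (inner ℝ (u l) (WithLp.toLp 2 fun i => e i ω)) ^ 2} ≤
      ENNReal.ofReal (3 * exp (-(1 / (4 * c)) * s / T)) := by
  have hc' : (0 : ℝ) < c := hc
  set S : κ → Ω → ℝ := fun l ω => inner ℝ (u l) (WithLp.toLp 2 fun i => e i ω) with hS
  set T₀ := ∑ l, ‖u l‖ ^ 2 with hT₀
  have hT₀nn : 0 ≤ T₀ := Finset.sum_nonneg fun l _ => sq_nonneg _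
  have hS0 : ∀ l, ‖u l‖ ^ 2 = 0 → ∀ ω, S l ω = 0 := by
    intro l hl ω
    have : u l = 0 := by simpa using hl
    simp [hS, this]
  rcases hT₀nn.eq_or_lt with h0 | hpos
  · have hz : ∀ l ω, S l ω = 0 := fun l =>
      hS0 l ((Finset.sum_eq_zero_iff_of_nonneg fun l _ => sq_nonneg _).1 h0.symm l
        (Finset.mem_univ l))
    have : {ω | s ≤ ∑ l, S l ω ^ 2} = ∅ := by
      ext ω
      simp [hz, hs]
    rw [this]
    simp
  -- With the weights `w` below, `a / w l = 1 / (4 c ‖u l‖²)` when `u l ≠ 0`: every summand sits at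
  -- the largest exponent for which the exponential moment of its square is known to be at most 3.
  set a : ℝ := 1 / (4 * c * T₀) with ha
  have ha0 : 0 < a := by positivity
  set w : κ → ℝ := fun l => ‖u l‖ ^ 2 / T₀ with hw
  have hw0 : ∀ l, 0 ≤ w l := fun l => by positivity
  have hw1 : ∑ l, w l = 1 := by
    rw [← Finset.sum_div, div_self hpos.ne']
  -- Jensen replaces the exponential of a sum by an average of exponentials, so the dependence
  -- between the inner products `S l` does not matter.
  have hjensen : ∀ ω, exp (a * ∑ l, S l ω ^ 2) ≤ ∑ l, w l * exp (a * (S l ω ^ 2 / w l)) := by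
    intro ω
    have h := convexOn_exp.map_sum_le (t := Finset.univ) (w := w)
      (p := fun l => a * (S l ω ^ 2 / w l)) (fun l _ => hw0 l) hw1 (fun l _ => Set.mem_univ _)
    simp only [smul_eq_mul] at h
    refine le_trans (le_of_eq ?_) h
    congr 1
    rw [Finset.mul_sum]
    refine Finset.sum_congr rfl fun l _ => ?_
    rcases eq_or_ne (w l) 0 with hl | hl
    · have : ‖u l‖ ^ 2 = 0 := by
        rcases div_eq_zero_iff.1 hl with h | h
        · exact h
        · exact absurd h hpos.ne'
      simp [hl, hS0 l this ω]
    · field_simp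
  have hmeas : ∀ l, AEMeasurable (S l) μ := fun l =>
    aemeasurable_noise_inner (fun i => (hsub i).aemeasurable) _
  have hterm : ∀ l, ∫⁻ ω, ENNReal.ofReal (w l * exp (a * (S l ω ^ 2 / w l))) ∂μ ≤
      ENNReal.ofReal (w l) * 3 := by
    intro l
    simp only [ENNReal.ofReal_mul (hw0 l)]
    rw [lintegral_const_mul' _ _ ENNReal.ofReal_ne_top]
    gcongr
    rcases eq_or_ne (u l) 0 with hl | hl
    · have hwl : w l = 0 := by simp [hw, hl]
      simp [hwl]
    have hul : 0 < ‖u l‖ ^ 2 := by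
      have := norm_pos_iff.2 hl
      positivity
    have hpos' : (0 : ℝ≥0) < ⟨‖u l‖ ^ 2, sq_nonneg _⟩ * c := mul_pos hul hc
    have h := HasSubgaussianMGF.lintegral_exp_sq_le (hasSubgaussianMGF_inner hind hsub (u l))
      (s := a / w l) hpos' (by
        change a / w l * (4 * (‖u l‖ ^ 2 * c)) ≤ 1
        rw [ha, hw]
        apply le_of_eq
        field_simp)
    refine le_trans (le_of_eq ?_) h
    refine lintegral_congr fun ω => ?_
    rw [mul_div_left_comm, mul_comm, hS]
  have hexp : ∫⁻ ω, ENNReal.ofReal (exp (a * ∑ l, S l ω ^ 2)) ∂μ ≤ 3 := by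
    calc ∫⁻ ω, ENNReal.ofReal (exp (a * ∑ l, S l ω ^ 2)) ∂μ
        ≤ ∫⁻ ω, ∑ l, ENNReal.ofReal (w l * exp (a * (S l ω ^ 2 / w l))) ∂μ := by
          refine lintegral_mono fun ω => ?_
          rw [← ENNReal.ofReal_sum_of_nonneg fun l _ => mul_nonneg (hw0 l) (exp_pos _).le]
          exact ENNReal.ofReal_le_ofReal (hjensen ω)
      _ = ∑ l, ∫⁻ ω, ENNReal.ofReal (w l * exp (a * (S l ω ^ 2 / w l))) ∂μ := by
          refine lintegral_finsetSum' _ fun l _ => ?_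
          exact (((((hmeas l).pow_const 2).div_const _).const_mul _).exp.const_mul _).ennreal_ofReal
      _ ≤ ∑ l, ENNReal.ofReal (w l) * 3 := Finset.sum_le_sum fun l _ => hterm l
      _ = 3 := by
          rw [← Finset.sum_mul, ← ENNReal.ofReal_sum_of_nonneg fun l _ => hw0 l, hw1]
          simp
  have hsubset : {ω | s ≤ ∑ l, S l ω ^ 2} ⊆
      {ω | ENNReal.ofReal (exp (a * s)) ≤ ENNReal.ofReal (exp (a * ∑ l, S l ω ^ 2))} := by
    intro ω hω
    exact ENNReal.ofReal_le_ofReal (exp_le_exp.2 (mul_le_mul_of_nonneg_left hω ha0.le))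
  have hmarkov := mul_meas_ge_le_lintegral₀ (μ := μ)
    (f := fun ω => ENNReal.ofReal (exp (a * ∑ l, S l ω ^ 2)))
    ((Finset.aemeasurable_fun_sum _ fun l _ => (hmeas l).pow_const 2).const_mul _).exp.ennreal_ofReal
    (ENNReal.ofReal (exp (a * s)))
  have hE : (0 : ℝ) < exp (a * s) := exp_pos _
  have h2 : μ {ω | s ≤ ∑ l, S l ω ^ 2} ≤ 3 / ENNReal.ofReal (exp (a * s)) := by
    rw [ENNReal.le_div_iff_mul_le (Or.inl (by simpa using hE)) (Or.inl ENNReal.ofReal_ne_top),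
      mul_comm]
    exact (mul_le_mul_right (measure_mono hsubset) _).trans (hmarkov.trans hexp)
  refine h2.trans ?_
  rw [← ENNReal.ofReal_ofNat 3, ← ENNReal.ofReal_div_of_pos hE]
  refine ENNReal.ofReal_le_ofReal ?_
  rw [div_eq_mul_inv, ← exp_neg]
  refine mul_le_mul_of_nonneg_left (exp_le_exp.2 ?_) (by norm_num)
  have : s / T ≤ s / T₀ := div_le_div_of_nonneg_left hs.le hpos hu
  rw [ha]
  have h3 : -(1 / (4 * (c : ℝ)) * (s / T₀)) = -(1 / (4 * (c : ℝ) * T₀) * s) := by field_simp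
  have h4 : 0 ≤ 1 / (4 * (c : ℝ)) := by positivity
  rw [← h3, mul_div_assoc, neg_mul]
  nlinarith [mul_le_mul_of_nonneg_left this h4]

theorem integral_noise_mul [IsProbabilityMeasure μ] {σ C₁ C₂ : ℝ} {e : Fin n → Ω → ℝ}
    (h : IsModelError μ σ C₁ C₂ e) (i k : Fin n) :
    ∫ ω, e i ω * e k ω ∂μ = if i = k then σ ^ 2 else 0 := by
  split_ifs with hik
  · subst hik
    have := variance_of_integral_eq_zero (h.aemeasurable i) (h.mean i)
    rw [h.variance] at this
    rw [this]
    simp [pow_two]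
  · have := (h.indep.indepFun hik).integral_mul_eq_mul_integral
      (h.aemeasurable i).aestronglyMeasurable (h.aemeasurable k).aestronglyMeasurable
    simp only [Pi.mul_apply, h.mean] at this
    simpa using this

theorem integral_noise_inner_sq [IsProbabilityMeasure μ] {σ C₁ C₂ : ℝ} {e : Fin n → Ω → ℝ}
    (h : IsModelError μ σ C₁ C₂ e) (hL2 : ∀ i, MemLp (e i) 2 μ)
    (u : EuclideanSpace ℝ (Fin n)) :
    Integrable (fun ω => (inner ℝ u (WithLp.toLp 2 fun i => e i ω)) ^ 2) μ ∧
    ∫ ω, (inner ℝ u (WithLp.toLp 2 fun i => e i ω)) ^ 2 ∂μ = σ ^ 2 * ‖u‖ ^ 2 := by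
  have hexpand : ∀ ω, (inner ℝ u (WithLp.toLp 2 fun i => e i ω)) ^ 2 =
      ∑ i, ∑ k, (u i * u k) * (e i ω * e k ω) := by
    intro ω
    rw [noise_inner_eq_sum, pow_two, Finset.sum_mul_sum]
    exact Finset.sum_congr rfl fun i _ => Finset.sum_congr rfl fun k _ => by ring
  have hint : ∀ i k, Integrable (fun ω => (u i * u k) * (e i ω * e k ω)) μ := fun i k =>
    ((hL2 i).integrable_mul (hL2 k)).const_mul _
  simp only [hexpand]
  refine ⟨integrable_finsetSum _ fun i _ => integrable_finsetSum _ fun k _ => hint i k, ?_⟩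
  rw [integral_finsetSum _ fun i _ => integrable_finsetSum _ fun k _ => hint i k]
  simp_rw [integral_finsetSum _ fun k _ => hint _ k, integral_const_mul,
    integral_noise_mul h]
  rw [EuclideanSpace.norm_sq_eq, Finset.mul_sum]
  refine Finset.sum_congr rfl fun i _ => ?_
  simp [pow_two]
  ring

/-- The projection of the errors onto a subspace of dimension at most `d` has squared norm of
order `σ² d`. -/
theorem measure_le_norm_sq_proj_le [IsProbabilityMeasure μ] {σ C₁ C₂ : ℝ} {e : Fin n → Ω → ℝ}
    (h : IsModelError μ σ C₁ C₂ e) (hL2 : ∀ i, MemLp (e i) 2 μ)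
    (U : Submodule ℝ (EuclideanSpace ℝ (Fin n))) {d : ℕ} (hd : Module.finrank ℝ U ≤ d)
    {s : ℝ} (hs : 0 < s) :
    μ {ω | s ≤ ‖U.starProjection (WithLp.toLp 2 fun i => e i ω)‖ ^ 2} ≤
      ENNReal.ofReal (σ ^ 2 * d / s) := by
  -- In an orthonormal basis of `U` each coefficient of the noise has second moment `σ²`; Markov's
  -- inequality then suffices.
  set b := stdOrthonormalBasis ℝ U with hb
  have hnorm : ∀ x : EuclideanSpace ℝ (Fin n),
      ‖U.starProjection x‖ ^ 2 = ∑ k, (inner ℝ (b k : EuclideanSpace ℝ (Fin n)) x) ^ 2 := by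
    intro x
    rw [Submodule.starProjection_apply, Submodule.norm_coe, ← b.sum_sq_norm_inner_right]
    refine Finset.sum_congr rfl fun k _ => ?_
    rw [Submodule.inner_orthogonalProjectionOnto_eq_of_mem_left, norm_eq_abs, sq_abs]
  simp only [hnorm]
  have hint := fun k => integral_noise_inner_sq h hL2 (b k : EuclideanSpace ℝ (Fin n))
  have hI := integrable_finsetSum Finset.univ fun k _ => (hint k).1
  have hmarkov := mul_meas_ge_le_integral_of_nonneg (μ := μ)
    (ae_of_all _ fun ω => Finset.sum_nonneg fun k _ => sq_nonneg _) hI s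
  rw [integral_finsetSum _ fun k _ => (hint k).1] at hmarkov
  simp only [(hint _).2] at hmarkov
  have hunit : ∀ k, ‖(b k : EuclideanSpace ℝ (Fin n))‖ = 1 := fun k => b.orthonormal.1 k
  simp only [hunit, one_pow, mul_one, Finset.sum_const, Finset.card_univ, Fintype.card_fin,
    nsmul_eq_mul] at hmarkov
  refine (ENNReal.le_ofReal_iff_toReal_le (measure_ne_top _ _) (by positivity)).2 ?_
  rw [le_div_iff₀ hs, mul_comm]
  refine hmarkov.trans ?_
  rw [mul_comm]
  gcongr

end Noise

end Sofia

namespace Sofia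

/-! ### Deterministic inequalities for the group lasso. -/

section GroupLasso

set_option linter.unusedSectionVars false

variable {ι : Type*} [Fintype ι] {G F : Type*} [NormedAddCommGroup G]
  [InnerProductSpace ℝ G] [NormedAddCommGroup F] [InnerProductSpace ℝ F]

/-- The group lasso objective `(2N)⁻¹ ‖Y - T β‖² + Λ ∑_j w_j ‖β_j‖` of a linear map `T`. -/
noncomputable def groupLasso (T : PiLp 2 (fun _ : ι => G) →ₗ[ℝ] F) (Y : F) (N Λ : ℝ) (w : ι → ℝ)
    (β : PiLp 2 fun _ : ι => G) : ℝ :=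
  (2 * N)⁻¹ * ‖Y - T β‖ ^ 2 + Λ * ∑ j, w j * ‖β j‖

theorem sum_norm_le_sqrt_card_mul_norm (A : Finset ι) (δ : PiLp 2 fun _ : ι => G) :
    ∑ j ∈ A, ‖δ j‖ ≤ Real.sqrt A.card * ‖δ‖ := by
  rw [PiLp.norm_eq_of_L2, ← Real.sqrt_mul (by positivity)]
  refine Real.le_sqrt_of_sq_le ((sq_sum_le_card_mul_sum_sq).trans ?_)
  refine mul_le_mul_of_nonneg_left ?_ (by positivity)
  exact Finset.sum_le_sum_of_subset_of_nonneg (Finset.subset_univ _) fun _ _ _ => sq_nonneg _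

theorem norm_le_sum_norm (δ : PiLp 2 fun _ : ι => G) : ‖δ‖ ≤ ∑ j, ‖δ j‖ := by
  rw [PiLp.norm_eq_of_L2]
  refine Real.sqrt_le_iff.2 ⟨by positivity, ?_⟩
  exact Finset.sum_sq_le_sq_sum_of_nonneg fun j _ => norm_nonneg _

theorem norm_apply_le_norm (δ : PiLp 2 fun _ : ι => G) (j : ι) : ‖δ j‖ ≤ ‖δ‖ := by
  rw [PiLp.norm_eq_of_L2]
  exact Real.le_sqrt_of_sq_le
    (Finset.single_le_sum (f := fun j => ‖δ j‖ ^ 2) (fun _ _ => sq_nonneg _) (Finset.mem_univ j))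

variable [DecidableEq ι]

theorem sum_mem_add_sum_notMem (A : Finset ι) (f : ι → ℝ) :
    ∑ j : {j // j ∈ A}, f j + ∑ j : {j // j ∉ A}, f j = ∑ j, f j := by
  convert Fintype.sum_subtype_add_sum_subtype (· ∈ A) f

/-- Comparison of the minimizer with the truth. On `A` the triangle inequality limits the penalty
saved; off `A` the truth vanishes, so the entire penalty of the minimizer counts against it. -/
theorem groupLasso_basic_inequality {T : PiLp 2 (fun _ : ι => G) →ₗ[ℝ] F} {e : F} {N Λ : ℝ}
    (hΛ : 0 ≤ Λ) {A : Finset ι} {b β : PiLp 2 fun _ : ι => G} (hb : ∀ j ∉ A, b j = 0)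
    (hmin : groupLasso T (T b + e) N Λ (fun _ => 1) β ≤
      groupLasso T (T b + e) N Λ (fun _ => 1) b) :
    (2 * N)⁻¹ * ‖T (β - b)‖ ^ 2 ≤ N⁻¹ * inner ℝ e (T (β - b)) +
      Λ * (∑ j ∈ A, ‖(β - b) j‖ - ∑ j ∈ Aᶜ, ‖(β - b) j‖) := by
  unfold groupLasso at hmin
  have h1 : T b + e - T β = e - T (β - b) := by rw [map_sub]; abel
  have h2 : T b + e - T b = e := by abel
  rw [h1, h2, norm_sub_sq_real] at hmin
  simp only [one_mul] at hmin
  have hA : ∑ j ∈ A, ‖b j‖ - ∑ j ∈ A, ‖β j‖ ≤ ∑ j ∈ A, ‖(β - b) j‖ := by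
    rw [← Finset.sum_sub_distrib]
    refine Finset.sum_le_sum fun j _ => ?_
    rw [PiLp.sub_apply, norm_sub_rev]
    exact norm_sub_norm_le _ _
  have hAc : ∑ j ∈ Aᶜ, ‖β j‖ = ∑ j ∈ Aᶜ, ‖(β - b) j‖ := by
    refine Finset.sum_congr rfl fun j hj => ?_
    rw [PiLp.sub_apply, hb j (Finset.mem_compl.1 hj), sub_zero]
  have hbc : ∑ j ∈ Aᶜ, ‖b j‖ = 0 :=
    Finset.sum_eq_zero fun j hj => by rw [hb j (Finset.mem_compl.1 hj), norm_zero]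
  rw [← Finset.sum_add_sum_compl A fun j => ‖β j‖, ← Finset.sum_add_sum_compl A fun j => ‖b j‖,
    hAc, hbc] at hmin
  have h3 := mul_le_mul_of_nonneg_left hA hΛ
  have h4 : (2 * N)⁻¹ * (‖e‖ ^ 2 - 2 * inner ℝ e (T (β - b)) + ‖T (β - b)‖ ^ 2) =
      (2 * N)⁻¹ * ‖e‖ ^ 2 - N⁻¹ * inner ℝ e (T (β - b)) + (2 * N)⁻¹ * ‖T (β - b)‖ ^ 2 := by
    rw [mul_inv]; ring
  rw [h4] at hmin
  linarith

/-- Group lasso error bound when the penalty dominates the errors. -/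
theorem norm_sub_le_of_groupLasso_of_dual_bound {T : PiLp 2 (fun _ : ι => G) →ₗ[ℝ] F} {e : F}
    {N Λ α : ℝ} (hN : 0 < N) (hΛ : 0 < Λ) (hα : 0 < α) {A : Finset ι}
    {b β : PiLp 2 fun _ : ι => G} (hb : ∀ j ∉ A, b j = 0)
    (hmin : groupLasso T (T b + e) N Λ (fun _ => 1) β ≤
      groupLasso T (T b + e) N Λ (fun _ => 1) b)
    (hRE : ∀ δ : PiLp 2 fun _ : ι => G, ∑ j ∈ Aᶜ, ‖δ j‖ ≤ 3 * ∑ j ∈ A, ‖δ j‖ →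
      α ^ 2 * ‖δ‖ ^ 2 ≤ N⁻¹ * ‖T δ‖ ^ 2)
    (hdual : ∀ δ : PiLp 2 fun _ : ι => G, N⁻¹ * inner ℝ e (T δ) ≤ Λ / 2 * ∑ j, ‖δ j‖) :
    ‖β - b‖ ≤ 3 * Λ * Real.sqrt A.card / α ^ 2 := by
  have hbasic := groupLasso_basic_inequality hΛ.le hb hmin
  set δ := β - b with hδ
  have hd := hdual δ
  rw [← Finset.sum_add_sum_compl A fun j => ‖δ j‖] at hd
  set a := ∑ j ∈ A, ‖δ j‖ with ha
  set c := ∑ j ∈ Aᶜ, ‖δ j‖ with hc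
  have h2 : (2 * N)⁻¹ * ‖T δ‖ ^ 2 = (N⁻¹ * ‖T δ‖ ^ 2) / 2 := by rw [mul_inv]; ring
  rw [h2] at hbasic
  have hnn : 0 ≤ N⁻¹ * ‖T δ‖ ^ 2 := by positivity
  -- The noise consumes at most half the penalty, which leaves `Λ (3a - c) / 2` as an upper bound
  -- for a nonnegative quantity.
  have hcone : c ≤ 3 * a := by
    have : 0 ≤ Λ * (3 * a - c) := by nlinarith
    linarith [nonneg_of_mul_nonneg_right this hΛ]
  have hre := hRE δ hcone
  have hcs := sum_norm_le_sqrt_card_mul_norm A δ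
  rw [← ha] at hcs
  have hc0 : 0 ≤ c := Finset.sum_nonneg fun _ _ => norm_nonneg _
  have h3 : α ^ 2 * ‖δ‖ ^ 2 ≤ 3 * Λ * (Real.sqrt A.card * ‖δ‖) := by
    nlinarith [mul_le_mul_of_nonneg_left hcs hΛ.le, mul_nonneg hΛ.le hc0]
  rw [le_div_iff₀ (by positivity)]
  rcases (norm_nonneg δ).eq_or_lt with h | h
  · rw [← h]
    simp only [zero_mul]
    positivity
  · refine le_of_mul_le_mul_right ?_ h
    linarith

/-- Group lasso error bound in terms of the size `g` of the errors along the range of the design. -/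
theorem norm_sub_le_of_groupLasso_of_range_bound {T : PiLp 2 (fun _ : ι => G) →ₗ[ℝ] F} {e : F}
    {N Λ α g : ℝ} (hN : 0 < N) (hΛ : 0 < Λ) (hα : 0 < α) {A : Finset ι}
    {b β : PiLp 2 fun _ : ι => G} (hb : ∀ j ∉ A, b j = 0)
    (hmin : groupLasso T (T b + e) N Λ (fun _ => 1) β ≤
      groupLasso T (T b + e) N Λ (fun _ => 1) b)
    (hRE : ∀ δ : PiLp 2 fun _ : ι => G, ∑ j ∈ Aᶜ, ‖δ j‖ ≤ 3 * ∑ j ∈ A, ‖δ j‖ →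
      α ^ 2 * ‖δ‖ ^ 2 ≤ N⁻¹ * ‖T δ‖ ^ 2)
    (hrange : ∀ δ : PiLp 2 fun _ : ι => G, inner ℝ e (T δ) ≤ g * ‖T δ‖) :
    ‖β - b‖ ≤ 2 * (g ^ 2 / N) / Λ + 4 * Λ * Real.sqrt A.card / α ^ 2 +
      2 * Real.sqrt (g ^ 2 / N) / α := by
  have hbasic := groupLasso_basic_inequality hΛ.le hb hmin
  set δ := β - b with hδ
  have hd := hrange δ
  set a := ∑ j ∈ A, ‖δ j‖ with ha
  set c := ∑ j ∈ Aᶜ, ‖δ j‖ with hc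
  have hc0 : 0 ≤ c := Finset.sum_nonneg fun _ _ => norm_nonneg _
  -- No domination of the noise by `Λ` is available: the noise is absorbed into the quadratic term,
  -- and the cone condition may fail.
  have hmain : N⁻¹ * ‖T δ‖ ^ 2 ≤ 4 * (g ^ 2 / N) + 4 * Λ * (a - c) := by
    have h1 : N⁻¹ * inner ℝ e (T δ) ≤ N⁻¹ * (g ^ 2 + ‖T δ‖ ^ 2 / 4) := by
      refine mul_le_mul_of_nonneg_left ?_ (by positivity)
      nlinarith [sq_nonneg (g - ‖T δ‖ / 2)]
    have h2 : (2 * N)⁻¹ * ‖T δ‖ ^ 2 = (N⁻¹ * ‖T δ‖ ^ 2) / 2 := by rw [mul_inv]; ring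
    have h3 : g ^ 2 / N = N⁻¹ * g ^ 2 := by rw [div_eq_inv_mul]
    rw [h2] at hbasic
    rw [h3]
    linarith
  have hnn : 0 ≤ N⁻¹ * ‖T δ‖ ^ 2 := by positivity
  have hq : 0 ≤ g ^ 2 / N := by positivity
  -- Inside the cone the restricted eigenvalue gives a quadratic inequality for `α ‖δ‖`. Outside, `a
  -- + c ≤ 2 (c - a)`, and `hmain` bounds `c - a` by `g² / (N Λ)` with no eigenvalue needed.
  by_cases hcone : c ≤ 3 * a
  · have hre := hRE δ hcone
    have hcs := sum_norm_le_sqrt_card_mul_norm A δ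
    rw [← ha] at hcs
    set x := α * ‖δ‖ with hx
    set B := 4 * Λ * Real.sqrt A.card / α with hB
    set D := 2 * Real.sqrt (g ^ 2 / N) with hD
    have hx0 : 0 ≤ x := by positivity
    have hB0 : 0 ≤ B := by positivity
    have hD0 : 0 ≤ D := by positivity
    have hDsq : D ^ 2 = 4 * (g ^ 2 / N) := by
      rw [hD, mul_pow, Real.sq_sqrt hq]
      norm_num
    have hBx : B * x = 4 * Λ * (Real.sqrt A.card * ‖δ‖) := by
      rw [hB, hx]
      field_simp
    have hxx : x ^ 2 ≤ D ^ 2 + B * x := by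
      rw [hDsq, hBx, hx, mul_pow]
      nlinarith [mul_le_mul_of_nonneg_left hcs hΛ.le, mul_nonneg hΛ.le hc0]
    have hxle : x ≤ B + D := by
      by_contra hlt
      push Not at hlt
      nlinarith
    have h4 : ‖δ‖ ≤ (B + D) / α := by
      rw [le_div_iff₀ hα, mul_comm]
      exact hxle
    have h5 : (B + D) / α = 4 * Λ * Real.sqrt A.card / α ^ 2 + 2 * Real.sqrt (g ^ 2 / N) / α := by
      rw [hB, hD, add_div, div_div, ← pow_two]
    have h6 : 0 ≤ 2 * (g ^ 2 / N) / Λ := by positivity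
    linarith
  · push Not at hcone
    have h1 := norm_le_sum_norm δ
    rw [← Finset.sum_add_sum_compl A fun j => ‖δ j‖, ← ha, ← hc] at h1
    have h2 : ‖δ‖ ≤ 2 * (g ^ 2 / N) / Λ := by
      rw [le_div_iff₀ hΛ]
      nlinarith
    have h3 : 0 ≤ 4 * Λ * Real.sqrt A.card / α ^ 2 := by positivity
    have h4 : 0 ≤ 2 * Real.sqrt (g ^ 2 / N) / α := by positivity
    linarith

/-- Restriction of a family to a subtype. -/
def restrict (P : ι → Prop) (β : PiLp 2 fun _ : ι => G) : PiLp 2 fun _ : {j // P j} => G :=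
  WithLp.toLp 2 fun j => β j

/-- Extension of a family by zero. -/
def extendZero (A : Finset ι) (x : PiLp 2 fun _ : {j // j ∈ A} => G) : PiLp 2 fun _ : ι => G :=
  WithLp.toLp 2 fun j => if h : j ∈ A then x ⟨j, h⟩ else 0

theorem restrict_mem_extendZero (A : Finset ι) (x : PiLp 2 fun _ : {j // j ∈ A} => G) :
    restrict (· ∈ A) (extendZero A x) = x := by
  ext j
  simp [restrict, extendZero]

theorem restrict_notMem_extendZero (A : Finset ι) (x : PiLp 2 fun _ : {j // j ∈ A} => G) :
    restrict (· ∉ A) (extendZero A x) = 0 := by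
  ext j
  simp [restrict, extendZero, j.2]

theorem extendZero_apply_mem {A : Finset ι} (x : PiLp 2 fun _ : {j // j ∈ A} => G) {j : ι}
    (h : j ∈ A) : extendZero A x j = x ⟨j, h⟩ := by
  simp [extendZero, h]

theorem extendZero_apply_notMem {A : Finset ι} (x : PiLp 2 fun _ : {j // j ∈ A} => G) {j : ι}
    (h : j ∉ A) : extendZero A x j = 0 := by
  simp [extendZero, h]

theorem extendZero_restrict {A : Finset ι} {β : PiLp 2 fun _ : ι => G} (h : ∀ j ∉ A, β j = 0) :
    extendZero A (restrict (· ∈ A) β) = β := by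
  ext j
  by_cases hj : j ∈ A
  · rw [extendZero_apply_mem _ hj]; rfl
  · rw [extendZero_apply_notMem _ hj, h j hj]

theorem sum_mul_norm_extendZero (A : Finset ι) (w : ι → ℝ) (x : PiLp 2 fun _ : {j // j ∈ A} => G) :
    ∑ j, w j * ‖extendZero A x j‖ = ∑ j : {j // j ∈ A}, w j * ‖x j‖ := by
  rw [← sum_mem_add_sum_notMem A]
  have h2 : ∑ j : {j // j ∉ A}, w j * ‖extendZero A x j‖ = 0 :=
    Finset.sum_eq_zero fun j _ => by rw [extendZero_apply_notMem _ j.2]; simp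
  rw [h2, add_zero]
  exact Finset.sum_congr rfl fun j _ => by rw [extendZero_apply_mem _ j.2]

theorem extendZero_sub (A : Finset ι) (x y : PiLp 2 fun _ : {j // j ∈ A} => G) :
    extendZero A (x - y) = extendZero A x - extendZero A y := by
  ext j
  by_cases hj : j ∈ A
  · simp [extendZero, hj]
  · simp [extendZero, hj]

theorem norm_extendZero (A : Finset ι) (x : PiLp 2 fun _ : {j // j ∈ A} => G) :
    ‖extendZero A x‖ = ‖x‖ := by
  rw [PiLp.norm_eq_of_L2, PiLp.norm_eq_of_L2, ← sum_mem_add_sum_notMem A fun j => _,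
    Finset.sum_eq_zero (s := (Finset.univ : Finset {j // j ∉ A})), add_zero]
  · congr 1
    exact Finset.sum_congr rfl fun j _ => by rw [extendZero_apply_mem _ j.2]
  · intro j _
    rw [extendZero_apply_notMem _ j.2]
    simp

theorem sum_mul_norm_sub_le {A : Finset ι} {w : ι → ℝ} {k : ℝ} (hw0 : ∀ j ∈ A, 0 ≤ w j)
    (hw : ∀ j ∈ A, w j ≤ k) (x y : PiLp 2 fun _ : {j // j ∈ A} => G) :
    ∑ j : {j // j ∈ A}, w j * ‖x j‖ - ∑ j : {j // j ∈ A}, w j * ‖y j‖ ≤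
      k * Real.sqrt A.card * ‖x - y‖ := by
  rw [← Finset.sum_sub_distrib]
  rcases A.eq_empty_or_nonempty with rfl | ⟨a, ha⟩
  · simp
  have hk : 0 ≤ k := (hw0 a ha).trans (hw a ha)
  have h := sum_norm_le_sqrt_card_mul_norm Finset.univ (x - y)
  rw [Finset.card_univ, Fintype.card_coe] at h
  calc ∑ j : {j // j ∈ A}, (w j * ‖x j‖ - w j * ‖y j‖)
      ≤ ∑ j : {j // j ∈ A}, k * ‖(x - y) j‖ := by
        refine Finset.sum_le_sum fun j _ => ?_
        rw [← mul_sub, PiLp.sub_apply]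
        exact (mul_le_mul_of_nonneg_left (norm_sub_norm_le _ _) (hw0 j j.2)).trans
          (mul_le_mul_of_nonneg_right (hw j j.2) (norm_nonneg _))
    _ = k * ∑ j, ‖(x - y) j‖ := by rw [Finset.mul_sum]
    _ ≤ _ := by rw [mul_assoc]; exact mul_le_mul_of_nonneg_left h hk

variable [FiniteDimensional ℝ G] [FiniteDimensional ℝ F]

theorem adjoint_comp_self_surjective {V : Type*} [NormedAddCommGroup V] [InnerProductSpace ℝ V]
    [FiniteDimensional ℝ V] {T : V →ₗ[ℝ] F} (hT : Function.Injective T) (y : V) :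
    ∃ x, LinearMap.adjoint T (T x) = y := by
  have hinj : Function.Injective (LinearMap.adjoint T ∘ₗ T) := by
    rw [← LinearMap.ker_eq_bot, LinearMap.ker_eq_bot']
    intro x hx
    have h : inner ℝ (T x) (T x) = (0 : ℝ) := by
      rw [← LinearMap.adjoint_inner_right]
      change inner ℝ x ((LinearMap.adjoint T ∘ₗ T) x) = (0 : ℝ)
      rw [hx, inner_zero_right]
    exact hT (by rw [inner_self_eq_zero.1 h, map_zero])
  exact LinearMap.injective_iff_surjective.1 hinj y

/-- Under the irrepresentable condition the adaptive group lasso has no false positives. -/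
theorem groupLasso_support_subset {A : Finset ι} {T : PiLp 2 (fun _ : ι => G) →ₗ[ℝ] F}
    {T₁ : PiLp 2 (fun _ : {j // j ∈ A} => G) →ₗ[ℝ] F}
    {T₂ : PiLp 2 (fun _ : {j // j ∉ A} => G) →ₗ[ℝ] F}
    (hT : ∀ β, T β = T₁ (restrict (· ∈ A) β) + T₂ (restrict (· ∉ A) β))
    {e : F} {b : PiLp 2 fun _ : {j // j ∈ A} => G} {N Λ k : ℝ} (hN : 0 < N) (hΛ : 0 < Λ)
    {w : ι → ℝ} {β : PiLp 2 fun _ : ι => G} (hinj : Function.Injective T₁)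
    (hirr : ∀ x, ‖LinearMap.adjoint T₂ (T₁ x)‖ ≤ ‖LinearMap.adjoint T₁ (T₁ x)‖)
    (hmin : ∀ x, groupLasso T (T₁ b + e) N Λ w β ≤ groupLasso T (T₁ b + e) N Λ w (extendZero A x))
    (hw0 : ∀ j ∈ A, 0 ≤ w j) (hw : ∀ j ∈ A, w j ≤ k) (hk : 0 ≤ k)
    (hnull : ∀ j : {j // j ∉ A}, β j ≠ 0 →
      N⁻¹ * ‖LinearMap.adjoint T₂ ((LinearMap.range T₁)ᗮ.starProjection e) j‖ +
        Λ * (k * Real.sqrt A.card) < Λ * w j) :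
    ∀ j ∉ A, β j = 0 := by
  set β₁ := restrict (· ∈ A) β with hβ₁
  set δ := restrict (· ∉ A) β with hδ
  set Q := (LinearMap.range T₁)ᗮ.starProjection with hQ
  -- `T₁ x` is the orthogonal projection of the null fit `T₂ δ` onto the range of `T₁`; `ρ` is what
  -- the active predictors cannot reproduce.
  obtain ⟨x, hx⟩ := adjoint_comp_self_surjective hinj (LinearMap.adjoint T₁ (T₂ δ))
  set ρ := T₂ δ - T₁ x with hρ
  have hρ₁ : ∀ y, inner ℝ ρ (T₁ y) = (0 : ℝ) := by
    intro y
    rw [← LinearMap.adjoint_inner_left, hρ, map_sub, hx, sub_self, inner_zero_left]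
  have hρmem : ρ ∈ (LinearMap.range T₁)ᗮ := by
    rw [Submodule.mem_orthogonal']
    rintro _ ⟨y, rfl⟩
    exact hρ₁ y
  have hQρ : Q (T₂ δ) = ρ := by
    have h1 : T₂ δ = ρ + T₁ x := by rw [hρ]; abel
    rw [h1, map_add, hQ, Submodule.starProjection_eq_self_iff.2 hρmem]
    have h2 : (LinearMap.range T₁)ᗮ.starProjection (T₁ x) = 0 := by
      rw [Submodule.starProjection_apply_eq_zero_iff, Submodule.orthogonal_orthogonal]
      exact ⟨x, rfl⟩
    rw [h2, add_zero]
  -- `x = (T₁ᵀT₁)⁻¹ T₁ᵀT₂ δ` is the image of `δ` under the adjoint of `T₂ᵀT₁ (T₁ᵀT₁)⁻¹`, which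
  -- `hirr` makes a contraction.
  have hxδ : ‖x‖ ≤ ‖δ‖ := by
    obtain ⟨y, hy⟩ := adjoint_comp_self_surjective hinj x
    have h1 : ‖x‖ * ‖x‖ = inner ℝ δ (LinearMap.adjoint T₂ (T₁ y)) := by
      rw [← real_inner_self_eq_norm_mul_norm]
      nth_rewrite 2 [← hy]
      rw [LinearMap.adjoint_inner_right, ← LinearMap.adjoint_inner_left, hx,
        LinearMap.adjoint_inner_left, ← LinearMap.adjoint_inner_right]
    have h2 : ‖x‖ * ‖x‖ ≤ ‖δ‖ * ‖x‖ := by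
      rw [h1]
      refine (real_inner_le_norm _ _).trans (mul_le_mul_of_nonneg_left ?_ (norm_nonneg _))
      exact (hirr y).trans_eq (by rw [hy])
    rcases (norm_nonneg x).eq_or_lt with h | h
    · rw [← h]; exact norm_nonneg _
    · exact le_of_mul_le_mul_right h2 h
  -- The competitor drops the null blocks and compensates by `x`, so the residual changes only by
  -- `ρ`.
  have hobj := hmin (β₁ + x)
  unfold groupLasso at hobj
  rw [sum_mul_norm_extendZero, hT (extendZero A _), restrict_mem_extendZero,
    restrict_notMem_extendZero, map_zero, add_zero,
    ← sum_mem_add_sum_notMem A fun j => w j * ‖β j‖] at hobj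
  set r := T₁ b + e - T β with hr
  have hres : T₁ b + e - T₁ (β₁ + x) = r + ρ := by
    rw [hr, hρ, hT β, map_add]; abel
  have hrρ : inner ℝ r ρ = inner ℝ e ρ - ‖ρ‖ ^ 2 := by
    have h1 : r = e - ρ + T₁ (b - β₁ - x) := by
      rw [hr, hρ, hT β, map_sub, map_sub]; abel
    rw [h1, inner_add_left, inner_sub_left, real_inner_comm ρ (T₁ _), hρ₁,
      real_inner_self_eq_norm_sq, add_zero]
  rw [hres, norm_add_sq_real, hrρ] at hobj
  have heρ : inner ℝ e ρ ≤ ∑ j, ‖LinearMap.adjoint T₂ (Q e) j‖ * ‖δ j‖ := by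
    rw [← hQρ, ← Submodule.inner_starProjection_left_eq_right, ← LinearMap.adjoint_inner_left,
      PiLp.inner_apply]
    exact Finset.sum_le_sum fun j _ => real_inner_le_norm _ _
  have hpen := sum_mul_norm_sub_le hw0 hw (β₁ + x) β₁
  rw [add_sub_cancel_left] at hpen
  have hδsum : ‖δ‖ ≤ ∑ j, ‖δ j‖ := norm_le_sum_norm δ
  -- The null penalty saved is at most the noise along `ρ` plus the increase of the active penalty;
  -- the quadratic term `-‖ρ‖²/(2N)` has the favourable sign. By `hnull` this is impossible once a
  -- null block is nonzero.
  have hfin : ∑ j : {j // j ∉ A}, Λ * w j * ‖δ j‖ ≤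
      ∑ j : {j // j ∉ A}, (N⁻¹ * ‖LinearMap.adjoint T₂ (Q e) j‖ +
        Λ * (k * Real.sqrt A.card)) * ‖δ j‖ := by
    have e1 : ∑ j : {j // j ∉ A}, (N⁻¹ * ‖LinearMap.adjoint T₂ (Q e) j‖ +
        Λ * (k * Real.sqrt A.card)) * ‖δ j‖ =
        N⁻¹ * ∑ j, ‖LinearMap.adjoint T₂ (Q e) j‖ * ‖δ j‖ +
          Λ * (k * Real.sqrt A.card) * ∑ j, ‖δ j‖ := by
      rw [Finset.mul_sum, Finset.mul_sum, ← Finset.sum_add_distrib]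
      exact Finset.sum_congr rfl fun j _ => by ring
    have e2 : ∑ j : {j // j ∉ A}, Λ * w j * ‖δ j‖ = Λ * ∑ j : {j // j ∉ A}, w j * ‖β j‖ := by
      rw [Finset.mul_sum]
      exact Finset.sum_congr rfl fun j _ => by rw [mul_assoc]; rfl
    have e3 : ∑ j : {j // j ∈ A}, w j * ‖β j‖ = ∑ j : {j // j ∈ A}, w j * ‖β₁ j‖ := rfl
    rw [e1, e2]
    rw [e3] at hobj
    have h5 := mul_le_mul_of_nonneg_left heρ (inv_nonneg.2 hN.le)
    have h6 := mul_le_mul_of_nonneg_left hpen hΛ.le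
    have h7 : k * Real.sqrt A.card * ‖x‖ ≤ k * Real.sqrt A.card * ∑ j, ‖δ j‖ :=
      mul_le_mul_of_nonneg_left (hxδ.trans hδsum) (by positivity)
    have h8 := mul_le_mul_of_nonneg_left h7 hΛ.le
    have h9 : (2 * N)⁻¹ * (‖r‖ ^ 2 + 2 * (inner ℝ e ρ - ‖ρ‖ ^ 2) + ‖ρ‖ ^ 2) =
        (2 * N)⁻¹ * ‖r‖ ^ 2 + N⁻¹ * inner ℝ e ρ - (2 * N)⁻¹ * ‖ρ‖ ^ 2 := by
      rw [mul_inv]; ring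
    have h10 : 0 ≤ (2 * N)⁻¹ * ‖ρ‖ ^ 2 := by positivity
    rw [h9] at hobj
    linarith
  by_contra hne
  push Not at hne
  obtain ⟨j, hj, hβj⟩ := hne
  refine absurd hfin (not_le.2 (Finset.sum_lt_sum (fun i _ => ?_) ⟨⟨j, hj⟩, Finset.mem_univ _, ?_⟩))
  · by_cases hi : β i = 0
    · have : δ i = 0 := hi
      rw [this]; simp
    · exact mul_le_mul_of_nonneg_right (hnull i hi).le (norm_nonneg _)
  · refine mul_lt_mul_of_pos_right (hnull ⟨j, hj⟩ hβj) ?_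
    exact norm_pos_iff.2 hβj

/-- An adaptive group lasso estimator without false positives is close to least squares. -/
theorem mul_norm_sub_oracle_le {A : Finset ι} {T : PiLp 2 (fun _ : ι => G) →ₗ[ℝ] F}
    {T₁ : PiLp 2 (fun _ : {j // j ∈ A} => G) →ₗ[ℝ] F}
    {T₂ : PiLp 2 (fun _ : {j // j ∉ A} => G) →ₗ[ℝ] F}
    (hT : ∀ β, T β = T₁ (restrict (· ∈ A) β) + T₂ (restrict (· ∉ A) β))
    {Y : F} {N Λ k c : ℝ} (hΛ : 0 < Λ) {w : ι → ℝ}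
    {x o : PiLp 2 fun _ : {j // j ∈ A} => G}
    (hc : ∀ y, c * ‖y‖ ^ 2 ≤ N⁻¹ * ‖T₁ y‖ ^ 2)
    (ho : LinearMap.adjoint T₁ (Y - T₁ o) = 0)
    (hmin : groupLasso T Y N Λ w (extendZero A x) ≤ groupLasso T Y N Λ w (extendZero A o))
    (hw0 : ∀ j ∈ A, 0 ≤ w j) (hw : ∀ j ∈ A, w j ≤ k) (hk : 0 ≤ k) :
    c * ‖x - o‖ ≤ 2 * Λ * (k * Real.sqrt A.card) := by
  unfold groupLasso at hmin
  rw [sum_mul_norm_extendZero, sum_mul_norm_extendZero, hT, hT, restrict_mem_extendZero,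
    restrict_mem_extendZero, restrict_notMem_extendZero, restrict_notMem_extendZero, map_zero,
    add_zero, add_zero] at hmin
  have h1 : Y - T₁ x = (Y - T₁ o) - T₁ (x - o) := by rw [map_sub]; abel
  -- The least squares residual is orthogonal to the range of `T₁`, so the excess loss is purely
  -- quadratic in `x - o`, whereas the penalty can gain only linearly.
  have h2 : inner ℝ (Y - T₁ o) (T₁ (x - o)) = (0 : ℝ) := by
    rw [← LinearMap.adjoint_inner_left, ho, inner_zero_left]
  rw [h1, norm_sub_sq_real, h2] at hmin
  have hpen := sum_mul_norm_sub_le hw0 hw o x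
  rw [norm_sub_rev] at hpen
  have h3 := mul_le_mul_of_nonneg_left hpen hΛ.le
  have h4 : (2 * N)⁻¹ * (‖Y - T₁ o‖ ^ 2 - 2 * 0 + ‖T₁ (x - o)‖ ^ 2) =
      (2 * N)⁻¹ * ‖Y - T₁ o‖ ^ 2 + (N⁻¹ * ‖T₁ (x - o)‖ ^ 2) / 2 := by rw [mul_inv]; ring
  rw [h4] at hmin
  have h5 := hc (x - o)
  have h6 : c * ‖x - o‖ ^ 2 ≤ 2 * Λ * (k * Real.sqrt A.card) * ‖x - o‖ := by linarith
  rcases (norm_nonneg (x - o)).eq_or_lt with h | h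
  · rw [← h, mul_zero]; positivity
  · refine le_of_mul_le_mul_right ?_ h
    linarith

/-- By the normal equations `T₁ (o - b)` is the orthogonal projection of the noise onto the range of
`T₁`. -/
theorem mul_norm_sq_oracle_sub_le {V : Type*} [NormedAddCommGroup V] [InnerProductSpace ℝ V]
    [FiniteDimensional ℝ V] {T₁ : V →ₗ[ℝ] F} {e : F} {b o : V} {N c : ℝ}
    (hc : ∀ y, c * ‖y‖ ^ 2 ≤ N⁻¹ * ‖T₁ y‖ ^ 2)
    (ho : LinearMap.adjoint T₁ (T₁ b + e - T₁ o) = 0) :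
    c * ‖o - b‖ ^ 2 ≤ N⁻¹ * ‖(LinearMap.range T₁).starProjection e‖ ^ 2 := by
  have h : (LinearMap.range T₁).starProjection e = T₁ (o - b) := by
    have hmem : T₁ (o - b) ∈ LinearMap.range T₁ := ⟨_, rfl⟩
    refine Submodule.eq_starProjection_of_mem_orthogonal hmem ?_
    rw [Submodule.mem_orthogonal']
    rintro _ ⟨y, rfl⟩
    have h1 : e - T₁ (o - b) = T₁ b + e - T₁ o := by rw [map_sub]; abel
    rw [h1, ← LinearMap.adjoint_inner_left, ho, inner_zero_left]
  rw [h]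
  exact hc _

end GroupLasso

end Sofia

namespace Sofia

/-! ### Coordinates in the 𝕂-orthonormal basis. -/

namespace KernelOperator

set_option linter.unusedSectionVars false

variable {H : Type*} [NormedAddCommGroup H] [InnerProductSpace ℝ H] [CompleteSpace H]
  (S : KernelOperator H)

theorem inner_v (k l : ℕ) : inner ℝ (S.v k) (S.v l) = if k = l then (1 : ℝ) else 0 :=
  orthonormal_iff_ite.1 S.v.orthonormal k l

theorem inner_K_v (x : H) (l : ℕ) : inner ℝ (S.K x) (S.v l) = S.θ l * inner ℝ x (S.v l) := by
  have := S.isPositive.isSymmetric x (S.v l)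
  simp only [ContinuousLinearMap.coe_coe] at this
  rw [this, S.eigen, real_inner_smul_right]

theorem inner_proj_v (m : ℕ) (h : H) (l : ℕ) :
    inner ℝ (S.proj m h) (S.v l) = if l < m then inner ℝ h (S.v l) else 0 := by
  unfold proj
  rw [sum_inner]
  simp only [real_inner_smul_left, inner_v]
  simp

theorem inner_proj_right (m : ℕ) (h x : H) :
    inner ℝ h (S.proj m x) = ∑ l ∈ Finset.range m, inner ℝ h (S.v l) * inner ℝ x (S.v l) := by
  unfold proj
  rw [inner_sum]
  exact Finset.sum_congr rfl fun l _ => by rw [real_inner_smul_right, mul_comm]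

theorem proj_eq_self {m : ℕ} {h : H} (hh : h ∈ S.sieve m) : S.proj m h = h := by
  induction hh using Submodule.span_induction with
  | mem x hx =>
    obtain ⟨l, hl, rfl⟩ := hx
    unfold proj
    rw [Finset.sum_eq_single l]
    · rw [inner_v, if_pos rfl, one_smul]
    · intro k _ hk
      rw [inner_v, if_neg hk.symm, zero_smul]
    · intro hl'
      exact absurd (Finset.mem_range.2 hl) hl'
  | zero => simp [proj]
  | add x y _ _ hx hy =>
    nth_rewrite 2 [← hx, ← hy]
    simp [proj, inner_add_left, add_smul, Finset.sum_add_distrib]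
  | smul a x _ hx =>
    nth_rewrite 2 [← hx]
    simp [proj, real_inner_smul_left, mul_smul, Finset.smul_sum]

theorem inner_v_eq_zero {m : ℕ} (h : S.sieve m) {l : ℕ} (hl : m ≤ l) :
    inner ℝ (h : H) (S.v l) = 0 := by
  rw [← S.proj_eq_self h.2, inner_proj_v, if_neg (not_lt.2 hl)]

/-- The coordinates of an element of the sieve space in the `𝕂`-orthonormal basis `√θ_l v_l`. -/
noncomputable def coord (m : ℕ) : S.sieve m ≃ₗ[ℝ] EuclideanSpace ℝ (Fin m) where
  toFun h := WithLp.toLp 2 fun l => inner ℝ (h : H) (S.v l) / Real.sqrt (S.θ l)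
  map_add' h g := by
    ext l
    simp [inner_add_left, add_div]
  map_smul' c h := by
    ext l
    simp [real_inner_smul_left, mul_div_assoc]
  invFun a := ⟨∑ l : Fin m, (Real.sqrt (S.θ l) * a l) • S.v l, Submodule.sum_mem _ fun l _ =>
    Submodule.smul_mem _ _ (Submodule.subset_span ⟨l, l.2, rfl⟩)⟩
  left_inv h := by
    ext
    change ∑ l : Fin m, (Real.sqrt (S.θ l) * (inner ℝ (h : H) (S.v l) / Real.sqrt (S.θ l))) • S.v l
      = (h : H)
    nth_rewrite 2 [← S.proj_eq_self h.2]
    rw [proj, ← Fin.sum_univ_eq_sum_range fun l => inner ℝ (h : H) (S.v l) • S.v l]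
    refine Finset.sum_congr rfl fun l _ => ?_
    rw [mul_div_cancel₀ _ (Real.sqrt_pos.2 (S.θ_pos l)).ne']
  right_inv a := by
    ext l
    change inner ℝ (∑ k : Fin m, (Real.sqrt (S.θ k) * a k) • S.v k) (S.v l) / Real.sqrt (S.θ l)
      = a l
    rw [sum_inner]
    simp only [real_inner_smul_left, inner_v]
    rw [Finset.sum_eq_single l]
    · rw [if_pos rfl, mul_one, mul_div_cancel_left₀ _ (Real.sqrt_pos.2 (S.θ_pos l)).ne']
    · intro k _ hk
      rw [if_neg fun h => hk (Fin.ext h), mul_zero]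
    · simp

theorem coord_apply (m : ℕ) (h : S.sieve m) (l : Fin m) :
    S.coord m h l = inner ℝ (h : H) (S.v l) / Real.sqrt (S.θ l) := rfl

/-- The vector of coordinates of `K x^(m)`. -/
noncomputable def feature (m : ℕ) (x : H) : EuclideanSpace ℝ (Fin m) :=
  WithLp.toLp 2 fun l => Real.sqrt (S.θ l) * inner ℝ x (S.v l)

theorem coord_K_proj (m : ℕ) (x : H) :
    S.coord m ⟨S.K (S.proj m x), S.K_proj_mem m x⟩ = S.feature m x := by
  ext l
  rw [coord_apply]
  change inner ℝ (S.K (S.proj m x)) (S.v l) / Real.sqrt (S.θ l)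
    = Real.sqrt (S.θ l) * inner ℝ x (S.v l)
  rw [inner_K_v, inner_proj_v, if_pos l.2, div_eq_iff (Real.sqrt_pos.2 (S.θ_pos l)).ne']
  nth_rewrite 1 [← Real.mul_self_sqrt (S.θ_pos l).le]
  ring

/-- The factors `√θ_l` and `1/√θ_l` cancel. Thus the fit, paired in `H`, and the penalty, normed in
𝕂, are both Euclidean in the same coordinates. -/
theorem inner_coord_feature (m : ℕ) (h : S.sieve m) (x : H) :
    inner ℝ (S.coord m h) (S.feature m x) = inner ℝ (h : H) (S.proj m x) := by
  rw [inner_proj_right,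
    ← Fin.sum_univ_eq_sum_range fun l => inner ℝ (h : H) (S.v l) * inner ℝ x (S.v l),
    PiLp.inner_apply]
  refine Finset.sum_congr rfl fun l _ => ?_
  rw [coord_apply]
  change Real.sqrt (S.θ l) * inner ℝ x (S.v l) * (inner ℝ (h : H) (S.v l) / Real.sqrt (S.θ l)) = _
  have := (Real.sqrt_pos.2 (S.θ_pos l)).ne'
  field_simp

theorem kInner_coe (m : ℕ) (g h : S.sieve m) :
    S.kInner (g : H) (h : H) = inner ℝ (S.coord m g) (S.coord m h) := by
  unfold kInner
  rw [tsum_eq_sum (s := Finset.range m) fun l hl => by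
    rw [S.inner_v_eq_zero g (not_lt.1 fun h => hl (Finset.mem_range.2 h))]; simp,
    ← Fin.sum_univ_eq_sum_range fun l => inner ℝ (g : H) (S.v l) * inner ℝ (h : H) (S.v l) / S.θ l,
    PiLp.inner_apply]
  refine Finset.sum_congr rfl fun l _ => ?_
  rw [coord_apply, coord_apply]
  change _ = inner ℝ (h : H) (S.v l) / Real.sqrt (S.θ l) *
    (inner ℝ (g : H) (S.v l) / Real.sqrt (S.θ l))
  rw [div_mul_div_comm, Real.mul_self_sqrt (S.θ_pos l).le, mul_comm]

theorem kNorm_coe {m : ℕ} (h : S.sieve m) : S.kNorm (h : H) = ‖S.coord m h‖ := by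
  have : ∑' l, (inner ℝ (h : H) (S.v l)) ^ 2 / S.θ l = S.kInner (h : H) (h : H) := by
    unfold kInner
    simp only [pow_two]
  rw [kNorm, this, kInner_coe, real_inner_self_eq_norm_sq, Real.sqrt_sq (norm_nonneg _)]

theorem norm_feature_sq_le (m : ℕ) (x : H) : ‖S.feature m x‖ ^ 2 ≤ S.θ 0 * ‖x‖ ^ 2 := by
  rw [EuclideanSpace.norm_sq_eq]
  have hle : ∀ l : Fin m, ‖S.feature m x l‖ ^ 2 ≤ S.θ 0 * (inner ℝ (S.v l) x) ^ 2 := by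
    intro l
    change ‖Real.sqrt (S.θ l) * inner ℝ x (S.v l)‖ ^ 2 ≤ _
    rw [Real.norm_eq_abs, sq_abs, mul_pow, Real.sq_sqrt (S.θ_pos l).le, real_inner_comm]
    exact mul_le_mul_of_nonneg_right (S.θ_antitone (Nat.zero_le _)) (sq_nonneg _)
  refine (Finset.sum_le_sum fun l _ => hle l).trans ?_
  rw [← Finset.mul_sum, Fin.sum_univ_eq_sum_range fun l => (inner ℝ (S.v l) x) ^ 2]
  refine mul_le_mul_of_nonneg_left ?_ (S.θ_pos 0).le
  have := S.v.orthonormal.sum_inner_products_le (x := x) (s := Finset.range m)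
  simpa using this

variable {κ : Type*} [Fintype κ] {n : ℕ}

/-- Coordinates on a product of copies of the sieve space. -/
noncomputable def coords (m : ℕ) (κ : Type*) :
    (κ → S.sieve m) ≃ₗ[ℝ] PiLp 2 fun _ : κ => EuclideanSpace ℝ (Fin m) :=
  (LinearEquiv.piCongrRight fun _ => S.coord m).trans (WithLp.linearEquiv 2 ℝ _).symm

theorem coords_apply (m : ℕ) (β : κ → S.sieve m) (j : κ) : S.coords m κ β j = S.coord m (β j) :=
  rfl

theorem kNormProd_eq (m : ℕ) (β : κ → S.sieve m) :
    S.kNormProd (fun j => (β j : H)) = ‖S.coords m κ β‖ := by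
  rw [kNormProd, PiLp.norm_eq_of_L2]
  simp only [kNorm_coe, coords_apply]

/-- The linear predictor `δ ↦ (∑_k ⟪δ_k, X_{ik}^(m)⟫)_i` in coordinates. -/
noncomputable def design (m : ℕ) (X : Fin n → κ → H) :
    PiLp 2 (fun _ : κ => EuclideanSpace ℝ (Fin m)) →ₗ[ℝ] EuclideanSpace ℝ (Fin n) where
  toFun δ := WithLp.toLp 2 fun i => ∑ k, inner ℝ (δ k) (S.feature m (X i k))
  map_add' δ δ' := by
    ext i
    simp [inner_add_left, Finset.sum_add_distrib]
  map_smul' c δ := by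
    ext i
    simp [real_inner_smul_left, Finset.mul_sum]

theorem design_apply (m : ℕ) (X : Fin n → κ → H)
    (δ : PiLp 2 (fun _ : κ => EuclideanSpace ℝ (Fin m))) (i : Fin n) :
    S.design m X δ i = ∑ k, inner ℝ (δ k) (S.feature m (X i k)) := rfl

theorem design_coords_apply (m : ℕ) (X : Fin n → κ → H) (β : κ → S.sieve m) (i : Fin n) :
    S.design m X (S.coords m κ β) i = ∑ k, inner ℝ (β k : H) (S.proj m (X i k)) := by
  rw [design_apply]
  simp only [coords_apply, inner_coord_feature]

theorem adjoint_design_apply (m : ℕ) (X : Fin n → κ → H) (e : EuclideanSpace ℝ (Fin n)) (j : κ) :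
    LinearMap.adjoint (S.design m X) e j = ∑ i, e i • S.feature m (X i j) := by
  have h : LinearMap.adjoint (S.design m X) e =
      WithLp.toLp 2 fun j => ∑ i, e i • S.feature m (X i j) := by
    refine ext_inner_right ℝ fun δ => ?_
    rw [LinearMap.adjoint_inner_left, PiLp.inner_apply, PiLp.inner_apply]
    simp only [design_apply, sum_inner, real_inner_smul_left]
    rw [Finset.sum_comm]
    refine Finset.sum_congr rfl fun i _ => ?_
    change (∑ k, inner ℝ (δ k) (S.feature m (X i k))) * e i = _
    rw [mul_comm, Finset.mul_sum]
    exact Finset.sum_congr rfl fun k _ => by rw [real_inner_comm]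
  rw [h]

/-- This identity turns the conditions on eigenvalues, restricted eigenvalues and irrepresentability
into statements about the design maps. -/
theorem coords_cov {ι : Type*} [Fintype ι] (m : ℕ) (X : Fin n → ι → H) (Z : Fin n → κ → H)
    (δ : κ → S.sieve m) :
    S.coords m ι (S.cov m X Z δ) = (n : ℝ)⁻¹ •
      LinearMap.adjoint (S.design m X) (S.design m Z (S.coords m κ δ)) := by
  ext1 j
  rw [PiLp.smul_apply, adjoint_design_apply, coords_apply]
  change S.coord m ((n : ℝ)⁻¹ • ∑ i, (∑ k, S.kInner (δ k : H) (S.K (S.proj m (Z i k)))) •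
    (⟨S.K (S.proj m (X i j)), S.K_proj_mem m _⟩ : S.sieve m)) = _
  simp only [map_smul, map_sum, coord_K_proj, kInner_K, design_coords_apply]

theorem coords_crossCov (m : ℕ) (Y : Fin n → ℝ) (X : Fin n → κ → H) :
    S.coords m κ (S.crossCov m Y X) = (n : ℝ)⁻¹ •
      LinearMap.adjoint (S.design m X) (WithLp.toLp 2 Y) := by
  ext1 j
  rw [PiLp.smul_apply, adjoint_design_apply, coords_apply, crossCov]
  simp only [map_smul, map_sum, coord_K_proj]

theorem sqrtCovNorm_eq (m : ℕ) (X : Fin n → κ → H) (δ : κ → S.sieve m) :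
    S.sqrtCovNorm X δ = Real.sqrt ((n : ℝ)⁻¹ * ‖S.design m X (S.coords m κ δ)‖ ^ 2) := by
  unfold sqrtCovNorm
  congr 1
  simp only [kInner_coe]
  have h := PiLp.inner_apply (𝕜 := ℝ) (S.coords m κ (S.cov m X X δ)) (S.coords m κ δ)
  simp only [coords_apply] at h
  rw [← h, coords_cov, real_inner_smul_left, LinearMap.adjoint_inner_left,
    real_inner_self_eq_norm_sq]

theorem objective_eq (m : ℕ) (X : Fin n → κ → H) (Y : Fin n → ℝ) (Λ : ℝ) (w : κ → ℝ≥0∞)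
    (β : κ → S.sieve m) :
    S.objective m X Y Λ w β = ENNReal.ofReal
      ((2 * (n : ℝ))⁻¹ * ‖WithLp.toLp 2 Y - S.design m X (S.coords m κ β)‖ ^ 2) +
      ENNReal.ofReal Λ * ∑ j, w j * ENNReal.ofReal ‖S.coords m κ β j‖ := by
  unfold objective
  rw [EuclideanSpace.norm_sq_eq]
  simp only [PiLp.sub_apply, design_coords_apply, kNorm_coe, coords_apply,
    Real.norm_eq_abs, sq_abs]

/-- `toReal` sends an infinite weight to 0; this is harmless because the corresponding block of `β`
vanishes and contributes 0 on both sides. -/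
theorem objective_eq_ofReal (m : ℕ) (X : Fin n → κ → H) (Y : Fin n → ℝ) {Λ : ℝ} (hΛ : 0 ≤ Λ)
    {w : κ → ℝ≥0∞} {β : κ → S.sieve m} (hβ : ∀ j, w j = ∞ → β j = 0) :
    S.objective m X Y Λ w β = ENNReal.ofReal (groupLasso (S.design m X) (WithLp.toLp 2 Y) n Λ
      (fun j => (w j).toReal) (S.coords m κ β)) := by
  rw [objective_eq, groupLasso, ENNReal.ofReal_add (by positivity)
    (mul_nonneg hΛ (Finset.sum_nonneg fun j _ => by positivity)), ENNReal.ofReal_mul hΛ,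
    ENNReal.ofReal_sum_of_nonneg fun j _ => by positivity]
  congr 2
  refine Finset.sum_congr rfl fun j _ => ?_
  rw [ENNReal.ofReal_mul ENNReal.toReal_nonneg]
  by_cases hj : w j = ∞
  · have : S.coords m κ β j = 0 := by rw [coords_apply, hβ j hj, map_zero]
    simp [this]
  · rw [ENNReal.ofReal_toReal hj]

theorem groupLasso_nonneg {ι G F : Type*} [Fintype ι] [NormedAddCommGroup G]
    [InnerProductSpace ℝ G] [NormedAddCommGroup F] [InnerProductSpace ℝ F]
    (T : PiLp 2 (fun _ : ι => G) →ₗ[ℝ] F) (Y : F) {N Λ : ℝ} (hN : 0 ≤ N) (hΛ : 0 ≤ Λ) {w : ι → ℝ}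
    (hw : ∀ j, 0 ≤ w j) (β : PiLp 2 fun _ : ι => G) : 0 ≤ groupLasso T Y N Λ w β :=
  add_nonneg (by positivity)
    (mul_nonneg hΛ (Finset.sum_nonneg fun j _ => mul_nonneg (hw j) (norm_nonneg _)))

/-- A minimizer vanishes where the weight is infinite, and minimizes the real-valued objective among
the families with this property. -/
theorem IsMinimizer.groupLasso_le {m : ℕ} {X : Fin n → κ → H} {Y : Fin n → ℝ} {Λ : ℝ} (hΛ : 0 < Λ)
    {w : κ → ℝ≥0∞} {β : κ → S.sieve m} (h : S.IsMinimizer m X Y Λ w β) :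
    (∀ j, w j = ∞ → β j = 0) ∧ ∀ β' : κ → S.sieve m, (∀ j, w j = ∞ → β' j = 0) →
      groupLasso (S.design m X) (WithLp.toLp 2 Y) n Λ (fun j => (w j).toReal) (S.coords m κ β) ≤
      groupLasso (S.design m X) (WithLp.toLp 2 Y) n Λ (fun j => (w j).toReal) (S.coords m κ β') := by
  have h1 : ∀ j, w j = ∞ → β j = 0 := by
    intro j hj
    by_contra hne
    have hc : 0 < ‖S.coords m κ β j‖ := by
      rw [coords_apply, norm_pos_iff]
      exact fun h0 => hne ((S.coord m).map_eq_zero_iff.1 h0)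
    -- The zero family has finite objective, while a nonzero block of infinite weight makes the
    -- objective infinite.
    have h0 := h 0
    rw [S.objective_eq_ofReal m X Y hΛ.le (β := 0) fun _ _ => rfl, objective_eq] at h0
    refine absurd (h0.trans_lt ENNReal.ofReal_lt_top) (not_lt.2 ?_)
    refine le_trans ?_ le_add_self
    have htop : w j * ENNReal.ofReal ‖S.coords m κ β j‖ = ∞ := by
      rw [hj, ENNReal.top_mul (by simpa using hc)]
    have hs : ∑ j, w j * ENNReal.ofReal ‖S.coords m κ β j‖ = ∞ :=
      ENNReal.sum_eq_top.2 ⟨j, Finset.mem_univ _, htop⟩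
    rw [hs, ENNReal.mul_top (by simpa using hΛ)]
  refine ⟨h1, fun β' hβ' => ?_⟩
  have h2 := h β'
  rw [S.objective_eq_ofReal m X Y hΛ.le h1, S.objective_eq_ofReal m X Y hΛ.le hβ'] at h2
  exact (ENNReal.ofReal_le_ofReal_iff (groupLasso_nonneg _ _ (Nat.cast_nonneg n) hΛ.le
    (fun _ => ENNReal.toReal_nonneg) _)).1 h2

theorem exists_norm_le_mul_norm {V W : Type*} [NormedAddCommGroup V] [NormedSpace ℝ V]
    [FiniteDimensional ℝ V] [NormedAddCommGroup W] [NormedSpace ℝ W] (T : V →ₗ[ℝ] W) :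
    ∃ C : ℝ, 0 ≤ C ∧ ∀ x, ‖T x‖ ≤ C * ‖x‖ :=
  ⟨‖LinearMap.toContinuousLinearMap T‖, norm_nonneg _,
    (LinearMap.toContinuousLinearMap T).le_opNorm⟩

/-- The irrepresentable condition in coordinates. -/
theorem norm_adjoint_design_le {ι : Type*} [Fintype ι] {m : ℕ} {X₁ : Fin n → κ → H}
    {X₂ : Fin n → ι → H} (hn : 0 < n) (hu : IsUnit (S.cov m X₁ X₁ : Module.End ℝ (κ → S.sieve m)))
    (h : S.kOpNorm (S.cov m X₂ X₁ ∘ₗ Ring.inverse (S.cov m X₁ X₁ : Module.End ℝ (κ → S.sieve m))) < 1)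
    (x : PiLp 2 fun _ : κ => EuclideanSpace ℝ (Fin m)) :
    ‖LinearMap.adjoint (S.design m X₂) (S.design m X₁ x)‖ ≤
      ‖LinearMap.adjoint (S.design m X₁) (S.design m X₁ x)‖ := by
  set T := S.cov m X₂ X₁ ∘ₗ Ring.inverse (S.cov m X₁ X₁ : Module.End ℝ (κ → S.sieve m)) with hT
  -- The infimum of an empty set of reals is 0, so `kOpNorm < 1` is informative only once some
  -- admissible constant is known to exist.
  have hne : {c : ℝ | 0 ≤ c ∧ ∀ δ : κ → S.sieve m,
      S.kNormProd (fun j => (T δ j : H)) ≤ c * S.kNormProd (fun j => (δ j : H))}.Nonempty := by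
    obtain ⟨C, hC, hle⟩ := exists_norm_le_mul_norm
      ((S.coords m ι).toLinearMap ∘ₗ T ∘ₗ (S.coords m κ).symm.toLinearMap)
    refine ⟨C, hC, fun δ => ?_⟩
    rw [kNormProd_eq, kNormProd_eq]
    simpa using hle (S.coords m κ δ)
  obtain ⟨c, ⟨_, hc⟩, hc1⟩ := exists_lt_of_csInf_lt hne h
  set δ := S.cov m X₁ X₁ ((S.coords m κ).symm x) with hδ
  have hTδ : T δ = S.cov m X₂ X₁ ((S.coords m κ).symm x) := by
    have : Ring.inverse (S.cov m X₁ X₁ : Module.End ℝ (κ → S.sieve m)) δ =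
        (S.coords m κ).symm x := by
      have h2 := Ring.inverse_mul_cancel _ hu
      exact congrArg (fun f : Module.End ℝ (κ → S.sieve m) => f ((S.coords m κ).symm x)) h2
    rw [hT, LinearMap.comp_apply, this]
  have h3 := hc δ
  rw [kNormProd_eq, kNormProd_eq, hTδ, hδ, coords_cov, coords_cov, norm_smul, norm_smul,
    LinearEquiv.apply_symm_apply] at h3
  have hninv : 0 < ‖(n : ℝ)⁻¹‖ := norm_pos_iff.2 (inv_ne_zero (Nat.cast_ne_zero.2 hn.ne'))
  have h4 : ‖(n : ℝ)⁻¹‖ * ‖LinearMap.adjoint (S.design m X₂) (S.design m X₁ x)‖ ≤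
      ‖(n : ℝ)⁻¹‖ * ‖LinearMap.adjoint (S.design m X₁) (S.design m X₁ x)‖ :=
    h3.trans (mul_le_of_le_one_left (by positivity) hc1.le)
  exact le_of_mul_le_mul_left h4 hninv

/-- Lower bounds on the eigenvalues of the covariance operator bound its quadratic form. -/
theorem mul_norm_sq_le_norm_design_sq {m : ℕ} {X : Fin n → κ → H} {c : ℝ}
    (h : ∀ s : ℝ, Module.End.HasEigenvalue (S.cov m X X : Module.End ℝ (κ → S.sieve m)) s → c ≤ s)
    (x : PiLp 2 fun _ : κ => EuclideanSpace ℝ (Fin m)) :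
    c * ‖x‖ ^ 2 ≤ (n : ℝ)⁻¹ * ‖S.design m X x‖ ^ 2 := by
  rcases eq_or_ne x 0 with rfl | hx
  · simp
  have : Nontrivial (PiLp 2 fun _ : κ => EuclideanSpace ℝ (Fin m)) := ⟨x, 0, hx⟩
  set A := (n : ℝ)⁻¹ • (LinearMap.adjoint (S.design m X) ∘ₗ S.design m X) with hA
  have hAx : ∀ y z, inner ℝ (A y) z =
      (n : ℝ)⁻¹ * inner ℝ (S.design m X y) (S.design m X z) := by
    intro y z
    rw [hA, LinearMap.smul_apply, real_inner_smul_left, LinearMap.comp_apply,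
      LinearMap.adjoint_inner_left]
  have hsymm : A.IsSymmetric := by
    intro y z
    rw [hAx, real_inner_comm (A z) y, hAx, real_inner_comm]
  -- The infimum of the Rayleigh quotient is itself an eigenvalue, so the assumed lower bound on
  -- eigenvalues applies to it.
  have hev := hsymm.hasEigenvalue_iInf_of_finiteDimensional
  set s : ℝ := ⨅ x : {x : PiLp 2 (fun _ : κ => EuclideanSpace ℝ (Fin m)) // x ≠ 0},
    RCLike.re (inner ℝ (A x) (x : PiLp 2 (fun _ : κ => EuclideanSpace ℝ (Fin m)))) /
      ‖(x : PiLp 2 (fun _ : κ => EuclideanSpace ℝ (Fin m)))‖ ^ 2 with hs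
  have hcs : c ≤ s := by
    apply h
    obtain ⟨y, hy⟩ := hev.exists_hasEigenvector
    refine Module.End.hasEigenvalue_of_hasEigenvector (x := (S.coords m κ).symm y)
      ⟨Module.End.mem_eigenspace_iff.2 ?_, fun h0 => hy.2 ((LinearEquiv.map_eq_zero_iff _).1 h0)⟩
    apply (S.coords m κ).injective
    rw [coords_cov, map_smul, LinearEquiv.apply_symm_apply]
    exact hy.apply_eq_smul
  have hbdd : BddBelow (Set.range fun x : {x : PiLp 2 (fun _ : κ => EuclideanSpace ℝ (Fin m)) //
      x ≠ 0} => RCLike.re (inner ℝ (A x) (x : PiLp 2 (fun _ : κ => EuclideanSpace ℝ (Fin m)))) /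
      ‖(x : PiLp 2 (fun _ : κ => EuclideanSpace ℝ (Fin m)))‖ ^ 2) := by
    refine ⟨0, ?_⟩
    rintro _ ⟨y, rfl⟩
    simp only [hAx, real_inner_self_eq_norm_sq, RCLike.re_to_real]
    positivity
  have hle := ciInf_le hbdd ⟨x, hx⟩
  have h5 := hcs.trans hle
  simp only [hAx, real_inner_self_eq_norm_sq, RCLike.re_to_real] at h5
  rwa [le_div_iff₀ (by have := norm_pos_iff.2 hx; positivity)] at h5

/-- `Ring.inverse` is 0 at a non-unit, so invertibility is what gives the oracle estimator and the
irrepresentable condition their intended meaning. -/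
theorem isUnit_cov_of_injective {m : ℕ} {X : Fin n → κ → H} (hn : 0 < n)
    (h : Function.Injective (S.design m X)) :
    IsUnit (S.cov m X X : Module.End ℝ (κ → S.sieve m)) := by
  have : FiniteDimensional ℝ (κ → S.sieve m) := (S.coords m κ).symm.finiteDimensional
  rw [LinearMap.isUnit_iff_ker_eq_bot, LinearMap.ker_eq_bot']
  intro δ hδ
  have h1 := S.coords_cov m X X δ
  rw [hδ, map_zero] at h1
  have h2 := (smul_eq_zero.1 h1.symm).resolve_left (inv_ne_zero (Nat.cast_ne_zero.2 hn.ne'))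
  have h3 : inner ℝ (S.design m X (S.coords m κ δ)) (S.design m X (S.coords m κ δ)) = (0 : ℝ) := by
    rw [← LinearMap.adjoint_inner_left, h2, inner_zero_left]
  have h4 : S.coords m κ δ = 0 := h (by rw [inner_self_eq_zero.1 h3, map_zero])
  exact (LinearEquiv.map_eq_zero_iff _).1 h4

/-- The normal equations for the least squares estimator. -/
theorem adjoint_design_sub_eq_zero {m : ℕ} {X : Fin n → κ → H} (hn : 0 < n)
    (hu : IsUnit (S.cov m X X : Module.End ℝ (κ → S.sieve m))) (Y : Fin n → ℝ) :
    LinearMap.adjoint (S.design m X) (WithLp.toLp 2 Y - S.design m X (S.coords m κ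
      (Ring.inverse (S.cov m X X : Module.End ℝ (κ → S.sieve m)) (S.crossCov m Y X)))) = 0 := by
  set δ := Ring.inverse (S.cov m X X : Module.End ℝ (κ → S.sieve m)) (S.crossCov m Y X) with hδ
  have h1 : S.cov m X X δ = S.crossCov m Y X :=
    congrArg (fun f : Module.End ℝ (κ → S.sieve m) => f (S.crossCov m Y X))
      (Ring.mul_inverse_cancel _ hu)
  have h2 := congrArg (S.coords m κ) h1
  rw [coords_cov, coords_crossCov] at h2
  have h3 := smul_right_injective _ (inv_ne_zero (Nat.cast_ne_zero.2 hn.ne' : (n : ℝ) ≠ 0)) h2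
  rw [map_sub, h3, sub_self]

end KernelOperator

end Sofia

namespace Sofia

set_option linter.unusedSectionVars false

/-! ### The design and the noise at a fixed sample size. -/

section FixedSampleSize

variable {H : Type*} [NormedAddCommGroup H] [InnerProductSpace ℝ H] [CompleteSpace H]
  (S : KernelOperator H) {n : ℕ}

/-- The squared norm of a block is a quadratic form in the noise whose vectors have total squared
norm at most `n θ₀`, by Bessel and the normalization of the design; a union bound runs over the
blocks. The pilot step takes `U = ⊤`, the adaptive step the orthogonal complement of the range of
the active design. -/
theorem measure_exists_le_norm_adjoint_design {Ω : Type*} [MeasurableSpace Ω] {μ : Measure Ω}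
    [IsProbabilityMeasure μ] {e : Fin n → Ω → ℝ} {c : NNReal} (hc : 0 < c) (hn : 0 < n)
    (hind : iIndepFun e μ) (hsub : ∀ i, HasSubgaussianMGF (e i) c μ) {κ : Type*} [Fintype κ]
    (m : ℕ) {X : Fin n → κ → H} (hX : ∀ j, (n : ℝ)⁻¹ * ∑ i, ‖X i j‖ ^ 2 = 1)
    (U : Submodule ℝ (EuclideanSpace ℝ (Fin n))) {t : ℝ} (ht : 0 < t) :
    μ {ω | ∃ j, t ≤ (n : ℝ)⁻¹ * ‖LinearMap.adjoint (S.design m X)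
        (U.starProjection (WithLp.toLp 2 fun i => e i ω)) j‖} ≤
      ENNReal.ofReal (Fintype.card κ * (3 * Real.exp (-(1 / (4 * c)) * (n * t ^ 2 / S.θ 0)))) := by
  have hn' : (0 : ℝ) < n := Nat.cast_pos.2 hn
  have hθ := S.θ_pos 0
  have hj : ∀ j, μ {ω | t ≤ (n : ℝ)⁻¹ * ‖LinearMap.adjoint (S.design m X)
        (U.starProjection (WithLp.toLp 2 fun i => e i ω)) j‖} ≤
      ENNReal.ofReal (3 * Real.exp (-(1 / (4 * c)) * (n * t ^ 2 / S.θ 0))) := by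
    intro j
    set f : Fin m → EuclideanSpace ℝ (Fin n) := fun l =>
      WithLp.toLp 2 fun i => S.feature m (X i j) l with hf
    have hnorm : ∀ x : EuclideanSpace ℝ (Fin n),
        ‖LinearMap.adjoint (S.design m X) (U.starProjection x) j‖ ^ 2 =
          ∑ l, (inner ℝ (U.starProjection (f l)) x) ^ 2 := by
      intro x
      rw [KernelOperator.adjoint_design_apply, EuclideanSpace.norm_sq_eq]
      refine Finset.sum_congr rfl fun l _ => ?_
      rw [Submodule.inner_starProjection_left_eq_right, PiLp.inner_apply, Real.norm_eq_abs, sq_abs]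
      congr 1
      simp [hf]
    have hsum : ∑ l, ‖U.starProjection (f l)‖ ^ 2 ≤ n * S.θ 0 := by
      calc ∑ l, ‖U.starProjection (f l)‖ ^ 2 ≤ ∑ l, ‖f l‖ ^ 2 := by
            refine Finset.sum_le_sum fun l _ => ?_
            exact pow_le_pow_left₀ (norm_nonneg _) (U.norm_starProjection_apply_le _) 2
        _ = ∑ i, ‖S.feature m (X i j)‖ ^ 2 := by
            simp only [EuclideanSpace.norm_sq_eq]
            rw [Finset.sum_comm]
        _ ≤ ∑ i, S.θ 0 * ‖X i j‖ ^ 2 := Finset.sum_le_sum fun i _ => S.norm_feature_sq_le m _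
        _ = n * S.θ 0 := by
            have := hX j
            rw [inv_mul_eq_iff_eq_mul₀ hn'.ne', mul_one] at this
            rw [← Finset.mul_sum, this, mul_comm]
    have hs : 0 < (n * t) ^ 2 := by positivity
    refine (measure_mono ?_).trans
      ((measure_le_sum_inner_sq_le hc hind hsub (fun l => U.starProjection (f l)) hsum hs).trans_eq ?_)
    · intro ω hω
      change t ≤ (n : ℝ)⁻¹ * _ at hω
      change (n * t) ^ 2 ≤ _
      rw [← hnorm]
      refine pow_le_pow_left₀ (by positivity) ?_ 2
      rwa [← div_eq_inv_mul, le_div_iff₀ hn', mul_comm] at hω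
    · congr 3
      field_simp
  have hset : {ω | ∃ j, t ≤ (n : ℝ)⁻¹ * ‖LinearMap.adjoint (S.design m X)
        (U.starProjection (WithLp.toLp 2 fun i => e i ω)) j‖} =
      ⋃ j, {ω | t ≤ (n : ℝ)⁻¹ * ‖LinearMap.adjoint (S.design m X)
        (U.starProjection (WithLp.toLp 2 fun i => e i ω)) j‖} := by
    ext ω
    simp
  rw [hset, ENNReal.ofReal_mul (Nat.cast_nonneg _)]
  refine (measure_iUnion_fintype_le μ _).trans ((Finset.sum_le_sum fun j _ => hj j).trans_eq ?_)
  rw [Finset.sum_const, Finset.card_univ, nsmul_eq_mul, ENNReal.ofReal_natCast]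

theorem inner_design_le_sum {κ : Type*} [Fintype κ] {m : ℕ} {X : Fin n → κ → H} {t : ℝ}
    {e : EuclideanSpace ℝ (Fin n)}
    (h : ∀ j, (n : ℝ)⁻¹ * ‖LinearMap.adjoint (S.design m X) e j‖ ≤ t)
    (δ : PiLp 2 fun _ : κ => EuclideanSpace ℝ (Fin m)) :
    (n : ℝ)⁻¹ * inner ℝ e (S.design m X δ) ≤ t * ∑ j, ‖δ j‖ := by
  rw [← LinearMap.adjoint_inner_left, PiLp.inner_apply, Finset.mul_sum, Finset.mul_sum]
  refine Finset.sum_le_sum fun j _ => ?_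
  calc (n : ℝ)⁻¹ * inner ℝ (LinearMap.adjoint (S.design m X) e j) (δ j)
      ≤ (n : ℝ)⁻¹ * (‖LinearMap.adjoint (S.design m X) e j‖ * ‖δ j‖) :=
        mul_le_mul_of_nonneg_left (real_inner_le_norm _ _) (by positivity)
    _ = ((n : ℝ)⁻¹ * ‖LinearMap.adjoint (S.design m X) e j‖) * ‖δ j‖ := by ring
    _ ≤ _ := mul_le_mul_of_nonneg_right (h j) (norm_nonneg _)

theorem finrank_range_design_le {κ : Type*} [Fintype κ] (m : ℕ) (X : Fin n → κ → H) :
    Module.finrank ℝ (LinearMap.range (S.design m X)) ≤ Fintype.card κ * m := by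
  refine (LinearMap.finrank_range_le _).trans_eq ?_
  rw [(WithLp.linearEquiv 2 ℝ (κ → EuclideanSpace ℝ (Fin m))).finrank_eq,
    Module.finrank_pi_fintype]
  simp

variable (D : Sample H n)

/-- The coordinates of the truncated coefficients. -/
noncomputable def Sample.coef : PiLp 2 fun _ : Fin D.p => EuclideanSpace ℝ (Fin D.m) :=
  S.coords D.m (Fin D.p) fun j => ⟨S.proj D.m (D.β j), S.proj_mem D.m _⟩

theorem Sample.coef_apply (j : Fin D.p) :
    D.coef S j = S.coord D.m ⟨S.proj D.m (D.β j), S.proj_mem D.m _⟩ := rfl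

variable {D}

theorem IsModelDesign.card_active (h : IsModelDesign S D) : D.active.card = D.p₀ := by
  have hp := h.p₀_lt
  rw [Sample.active, Fin.card_filter_val_lt, min_eq_right hp.le]

theorem IsModelDesign.coef_eq_zero (h : IsModelDesign S D) {j : Fin D.p} (hj : j ∉ D.active) :
    D.coef S j = 0 := by
  have h0 : D.β j = 0 := by
    by_contra hne
    exact hj ((h.support j).1 hne)
  have h1 : (⟨S.proj D.m (D.β j), S.proj_mem D.m _⟩ : S.sieve D.m) = 0 := by
    ext
    simp [h0, KernelOperator.proj]
  rw [Sample.coef_apply, h1, map_zero]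

variable (D)

theorem Sample.design_eq_add (β : PiLp 2 fun _ : Fin D.p => EuclideanSpace ℝ (Fin D.m)) :
    S.design D.m D.X β = S.design D.m D.X₁ (restrict (· ∈ D.active) β) +
      S.design D.m D.X₂ (restrict (· ∉ D.active) β) := by
  ext i
  rw [PiLp.add_apply]
  simp only [KernelOperator.design_apply]
  exact (sum_mem_add_sum_notMem D.active
    fun j => inner ℝ (β j) (S.feature D.m (D.X i j))).symm

theorem Sample.response_eq (e : Fin n → ℝ) :
    WithLp.toLp 2 (D.response S e) =
      S.design D.m D.X₁ (restrict (· ∈ D.active) (D.coef S)) + WithLp.toLp 2 e := by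
  ext i
  rw [PiLp.add_apply, KernelOperator.design_apply]
  change ∑ j ∈ D.active, inner ℝ (S.proj D.m (D.β j)) (S.proj D.m (D.X i j)) + e i =
    ∑ k : {j // j ∈ D.active}, inner ℝ (D.coef S k) (S.feature D.m (D.X i k)) + e i
  rw [← Finset.sum_coe_sort]
  congr 1
  refine Finset.sum_congr rfl fun j _ => ?_
  rw [Sample.coef_apply, KernelOperator.inner_coord_feature]

variable {D}

theorem IsModelDesign.response_eq (h : IsModelDesign S D) (e : Fin n → ℝ) :
    WithLp.toLp 2 (D.response S e) = S.design D.m D.X (D.coef S) + WithLp.toLp 2 e := by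
  rw [D.response_eq S e, D.design_eq_add S]
  have h0 : restrict (· ∉ D.active) (D.coef S) = 0 := by
    ext1 j
    exact h.coef_eq_zero S j.2
  rw [h0, map_zero, add_zero]

theorem restricted_eigenvalue (hα : 0 < D.reConst S) {J : Finset (Fin D.p)} (hJ : J.card ≤ D.p₀)
    (δ : PiLp 2 fun _ : Fin D.p => EuclideanSpace ℝ (Fin D.m))
    (hcone : ∑ j ∈ Jᶜ, ‖δ j‖ ≤ 3 * ∑ j ∈ J, ‖δ j‖) :
    D.reConst S ^ 2 * ‖δ‖ ^ 2 ≤ (n : ℝ)⁻¹ * ‖S.design D.m D.X δ‖ ^ 2 := by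
  rcases eq_or_ne δ 0 with rfl | hδ
  · simp
  have hpos : 0 < ‖δ‖ := norm_pos_iff.2 hδ
  obtain ⟨β, rfl⟩ := (S.coords D.m (Fin D.p)).surjective δ
  have hβ : β ≠ 0 := fun h0 => hδ (by rw [h0, map_zero])
  have hle : D.reConst S ≤ S.sqrtCovNorm D.X β / S.kNormProd fun j => (β j : H) := by
    refine csInf_le ⟨0, ?_⟩ ⟨J, β, hJ, hβ, ?_, rfl⟩
    · rintro _ ⟨_, _, _, _, _, rfl⟩
      exact div_nonneg (Real.sqrt_nonneg _) (Real.sqrt_nonneg _)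
    · simpa only [KernelOperator.kNorm_coe, KernelOperator.coords_apply] using hcone
  rw [KernelOperator.kNormProd_eq, le_div_iff₀ hpos, KernelOperator.sqrtCovNorm_eq] at hle
  have h2 := pow_le_pow_left₀ (by positivity) hle 2
  rwa [Real.sq_sqrt (by positivity), mul_pow] at h2

/-- The eigenvalue lower bound `τ_m⁻¹` decays at least as fast as `m^(-γ)`. -/
theorem rpow_le_mul_of_eigenvalue_bound {b₂ γ t : ℝ} (hn : 0 < n) (hm : 0 < D.m) (ht : 0 < t)
    (hA : D.active.Nonempty)
    (hX : ∀ j ∈ D.active, ∀ l i,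
      S.θ l * (inner ℝ (D.X i j) (S.v l)) ^ 2 ≤ b₂ * ((l : ℝ) + 1) ^ (-γ))
    (h : ∀ x, t⁻¹ * ‖x‖ ^ 2 ≤ (n : ℝ)⁻¹ * ‖S.design D.m D.X₁ x‖ ^ 2) :
    (D.m : ℝ) ^ γ ≤ b₂ * t := by
  obtain ⟨j, hj⟩ := hA
  have hn' : (0 : ℝ) < n := Nat.cast_pos.2 hn
  have hm' : (0 : ℝ) < D.m := Nat.cast_pos.2 hm
  -- The last sieve direction, where `l + 1 = m`; the unit vector along it in one active block tests
  -- the eigenvalue bound.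
  set l : Fin D.m := ⟨D.m - 1, Nat.sub_lt hm one_pos⟩ with hl
  set x : PiLp 2 fun _ : {j // j ∈ D.active} => EuclideanSpace ℝ (Fin D.m) :=
    WithLp.toLp 2 (Pi.single ⟨j, hj⟩ (EuclideanSpace.single l 1)) with hx
  have hxnorm : ‖x‖ ^ 2 = 1 := by
    rw [PiLp.norm_sq_eq_of_L2, Finset.sum_eq_single ⟨j, hj⟩]
    · simp [hx]
    · intro k _ hk
      simp [hx, hk]
    · simp
  have hval : ∀ i, (S.design D.m D.X₁ x i) ^ 2 ≤ b₂ * (D.m : ℝ) ^ (-γ) := by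
    intro i
    have h1 : S.design D.m D.X₁ x i = Real.sqrt (S.θ l) * inner ℝ (D.X i j) (S.v l) := by
      rw [KernelOperator.design_apply, Finset.sum_eq_single ⟨j, hj⟩]
      · simp [hx, Sample.X₁, KernelOperator.feature, EuclideanSpace.inner_single_left]
      · intro k _ hk
        simp [hx, hk]
      · simp
    rw [h1, mul_pow, Real.sq_sqrt (S.θ_pos _).le]
    refine (hX j hj l i).trans_eq ?_
    rw [hl]
    congr 2
    change ((D.m - 1 : ℕ) : ℝ) + 1 = D.m
    rw [Nat.cast_sub hm]
    simp
  have h2 := h x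
  rw [hxnorm, mul_one, EuclideanSpace.norm_sq_eq] at h2
  have h3 : (n : ℝ)⁻¹ * ∑ i, ‖S.design D.m D.X₁ x i‖ ^ 2 ≤ b₂ * (D.m : ℝ) ^ (-γ) := by
    rw [← div_eq_inv_mul, div_le_iff₀ hn']
    calc ∑ i, ‖S.design D.m D.X₁ x i‖ ^ 2 ≤ ∑ _i : Fin n, b₂ * (D.m : ℝ) ^ (-γ) := by
          refine Finset.sum_le_sum fun i _ => ?_
          rw [Real.norm_eq_abs, sq_abs]
          exact hval i
      _ = _ := by
          rw [Finset.sum_const, Finset.card_univ, Fintype.card_fin, nsmul_eq_mul, mul_comm]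
  have h4 := h2.trans h3
  rw [Real.rpow_neg hm'.le, ← div_eq_mul_inv, inv_le_iff_one_le_mul₀ ht, div_mul_eq_mul_div,
    one_le_div (by positivity)] at h4
  exact h4

end FixedSampleSize

end Sofia

namespace Sofia

set_option linter.unusedSectionVars false

/-! ### The norm of 𝕂 and truncation. -/

namespace KernelOperator

variable {H : Type*} [NormedAddCommGroup H] [InnerProductSpace ℝ H] [CompleteSpace H]
  (S : KernelOperator H)

theorem kNorm_nonneg (h : H) : 0 ≤ S.kNorm h := Real.sqrt_nonneg _

theorem kNorm_sq (h : H) : S.kNorm h ^ 2 = ∑' l, (inner ℝ h (S.v l)) ^ 2 / S.θ l :=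
  Real.sq_sqrt (tsum_nonneg fun l => div_nonneg (sq_nonneg _) (S.θ_pos l).le)

variable {S} in
-- Membership is essential: outside 𝕂 the defining series takes the default value 0.
theorem MemK.eq_zero {h : H} (hh : S.MemK h) (h0 : S.kNorm h = 0) : h = 0 := by
  have h1 := S.kNorm_sq h
  rw [h0, zero_pow two_ne_zero] at h1
  have h2 := (hasSum_zero_iff_of_nonneg fun l =>
    div_nonneg (sq_nonneg _) (S.θ_pos l).le).1 (h1 ▸ hh.hasSum)
  have h3 : ∀ l, inner ℝ h (S.v l) = (0 : ℝ) := by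
    intro l
    have := congrFun h2 l
    simpa [(S.θ_pos l).ne'] using this
  have h4 := S.v.hasSum_repr h
  have h5 : ∀ l, S.v.repr h l = 0 := fun l => by
    rw [S.v.repr_apply_apply, real_inner_comm, h3]
  simp only [h5, zero_smul] at h4
  exact h4.unique hasSum_zero

variable {S} in
/-- Pythagoras for the projection onto the sieve space. -/
theorem MemK.kNorm_sub_sq {m : ℕ} {g : H} (hg : S.MemK g) (h : S.sieve m) :
    S.kNorm ((h : H) - g) ^ 2 =
      ‖S.coord m h - S.coord m ⟨S.proj m g, S.proj_mem m g⟩‖ ^ 2 +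
        S.kNorm (g - S.proj m g) ^ 2 := by
  rw [← map_sub, ← S.kNorm_coe, kNorm_sq, kNorm_sq, kNorm_sq]
  have hfin : Summable fun l => (inner ℝ ((h - ⟨S.proj m g, S.proj_mem m g⟩ : S.sieve m) : H)
      (S.v l)) ^ 2 / S.θ l :=
    summable_of_ne_finset_zero (s := Finset.range m) fun l hl => by
      rw [S.inner_v_eq_zero _ (not_lt.1 fun h => hl (Finset.mem_range.2 h))]
      simp
  have htail : Summable fun l => (inner ℝ (g - S.proj m g) (S.v l)) ^ 2 / S.θ l := by
    refine Summable.of_nonneg_of_le (fun l => div_nonneg (sq_nonneg _) (S.θ_pos l).le)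
      (fun l => ?_) hg
    rw [inner_sub_left, inner_proj_v]
    split_ifs
    · simp only [sub_self]
      rw [zero_pow two_ne_zero, zero_div]
      exact div_nonneg (sq_nonneg _) (S.θ_pos l).le
    · rw [sub_zero]
  rw [← hfin.tsum_add htail]
  refine tsum_congr fun l => ?_
  rw [AddSubgroupClass.coe_sub, inner_sub_left, inner_sub_left, inner_sub_left, inner_proj_v]
  split_ifs with hl
  · simp
  · rw [S.inner_v_eq_zero h (not_lt.1 hl)]
    simp

end KernelOperator

/-! ### Truncated coefficients, oracle and adaptive estimator. -/

section FixedSampleSize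

variable {H : Type*} [NormedAddCommGroup H] [InnerProductSpace ℝ H] [CompleteSpace H]
  {S : KernelOperator H} {n : ℕ} {D : Sample H n}

theorem norm_coef_eq (j : Fin D.p) : ‖D.coef S j‖ = S.kNorm (S.proj D.m (D.β j)) := by
  rw [Sample.coef_apply, ← KernelOperator.kNorm_coe]

theorem kNorm_sub_proj_le_maxTail {j : Fin D.p} (hj : j ∈ D.active) :
    S.kNorm (D.β j - S.proj D.m (D.β j)) ≤ D.maxTail S :=
  le_ciSup (f := fun j : {j // j ∈ D.active} => S.kNorm (D.β j - S.proj D.m (D.β j)))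
    (Set.finite_range _).bddAbove ⟨j, hj⟩

/-- Were an active coefficient truncated to zero, its tail would be the whole coefficient, of norm
at least `b` yet at most `b/2`. So truncation preserves the support, and `b_m` bounds every active
block from below. -/
theorem IsModelDesign.proj_ne_zero (h : IsModelDesign S D)
    (htail : D.maxTail S ≤ 2⁻¹ * D.minSignal S) {j : Fin D.p} (hj : j ∈ D.active) :
    S.proj D.m (D.β j) ≠ 0 := by
  intro h0
  have h1 := kNorm_sub_proj_le_maxTail (S := S) hj
  have h2 : D.minSignal S ≤ S.kNorm (D.β j) := by
    refine csInf_le ⟨0, ?_⟩ ⟨j, hj, rfl⟩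
    rintro _ ⟨_, _, rfl⟩
    exact S.kNorm_nonneg _
  rw [h0, sub_zero] at h1
  have h3 : S.kNorm (D.β j) = 0 := by
    have := S.kNorm_nonneg (D.β j)
    linarith
  exact (h.support j).2 hj ((h.memK j).eq_zero h3)

theorem minSieveSignal_le {j : Fin D.p} (h : S.proj D.m (D.β j) ≠ 0) :
    D.minSieveSignal S ≤ ‖D.coef S j‖ := by
  rw [norm_coef_eq]
  refine csInf_le ⟨0, ?_⟩ ⟨j, h, rfl⟩
  rintro _ ⟨_, _, rfl⟩
  exact S.kNorm_nonneg _

theorem minSieveSignal_nonneg : 0 ≤ D.minSieveSignal S := by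
  refine Real.sInf_nonneg ?_
  rintro _ ⟨_, _, rfl⟩
  exact S.kNorm_nonneg _

theorem IsModelDesign.kNormProd_sub_sq_le (h : IsModelDesign S D) (β : Fin D.p → S.sieve D.m) :
    S.kNormProd (fun j => (β j : H) - D.β j) ^ 2 ≤
      ‖S.coords D.m (Fin D.p) β - D.coef S‖ ^ 2 + D.p₀ * D.maxTail S ^ 2 := by
  rw [KernelOperator.kNormProd, Real.sq_sqrt (Finset.sum_nonneg fun _ _ => sq_nonneg _)]
  simp only [fun j => (h.memK j).kNorm_sub_sq (β j)]
  rw [Finset.sum_add_distrib, PiLp.norm_sq_eq_of_L2]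
  refine add_le_add le_rfl ?_
  rw [← Finset.sum_subset (Finset.subset_univ D.active)]
  · calc ∑ j ∈ D.active, S.kNorm (D.β j - S.proj D.m (D.β j)) ^ 2
        ≤ ∑ _j ∈ D.active, D.maxTail S ^ 2 := Finset.sum_le_sum fun j hj =>
          pow_le_pow_left₀ (S.kNorm_nonneg _) (kNorm_sub_proj_le_maxTail hj) 2
      _ = D.p₀ * D.maxTail S ^ 2 := by rw [Finset.sum_const, h.card_active S, nsmul_eq_mul]
  · intro j _ hj
    have h0 : D.β j = 0 := by
      by_contra hne
      exact hj ((h.support j).1 hne)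
    simp [h0, KernelOperator.proj, KernelOperator.kNorm]

theorem IsModelDesign.lasso_inequality (h : IsModelDesign S D) {e : Fin n → ℝ} {Λ : ℝ}
    (hΛ : 0 < Λ) {β : Fin D.p → S.sieve D.m}
    (hmin : S.IsMinimizer D.m D.X (D.response S e) Λ (fun _ => 1) β) :
    groupLasso (S.design D.m D.X) (S.design D.m D.X (D.coef S) + WithLp.toLp 2 e) n Λ (fun _ => 1)
        (S.coords D.m (Fin D.p) β) ≤
      groupLasso (S.design D.m D.X) (S.design D.m D.X (D.coef S) + WithLp.toLp 2 e) n Λ (fun _ => 1)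
        (D.coef S) := by
  have h1 := (KernelOperator.IsMinimizer.groupLasso_le S hΛ hmin).2
    (fun j => ⟨S.proj D.m (D.β j), S.proj_mem D.m _⟩) (fun j hj => by simp at hj)
  rw [h.response_eq] at h1
  simp only [ENNReal.toReal_one] at h1
  exact h1

theorem coords_oracle (Y : Fin n → ℝ) :
    S.coords D.m (Fin D.p) (D.oracle S Y) = extendZero D.active
      (S.coords D.m {j // j ∈ D.active} (Ring.inverse (D.covActive S) (S.crossCov D.m Y D.X₁))) := by
  ext1 j
  rw [KernelOperator.coords_apply]
  by_cases hj : j ∈ D.active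
  · rw [extendZero_apply_mem _ hj, Sample.oracle, dif_pos hj]
    rfl
  · rw [extendZero_apply_notMem _ hj, Sample.oracle, dif_neg hj, map_zero]

theorem injective_of_mul_norm_sq_le {V W : Type*} [NormedAddCommGroup V] [NormedSpace ℝ V]
    [NormedAddCommGroup W] [NormedSpace ℝ W] {T : V →ₗ[ℝ] W} {c N : ℝ} (hc : 0 < c)
    (h : ∀ x, c * ‖x‖ ^ 2 ≤ N * ‖T x‖ ^ 2) : Function.Injective T := by
  rw [← LinearMap.ker_eq_bot, LinearMap.ker_eq_bot']
  intro x hx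
  have h1 := h x
  rw [hx, norm_zero, zero_pow two_ne_zero, mul_zero] at h1
  have h2 : ‖x‖ ^ 2 ≤ 0 := nonpos_of_mul_nonpos_right h1 hc
  simpa using le_antisymm h2 (sq_nonneg _)

/-- The error of the oracle estimator is controlled by the projection of the errors onto the range of
the active design. -/
theorem IsModelDesign.mul_norm_oracle_sub_sq_le (h : IsModelDesign S D) (hn : 0 < n) {c : ℝ}
    (hc : 0 < c) (hRE : ∀ x, c * ‖x‖ ^ 2 ≤ (n : ℝ)⁻¹ * ‖S.design D.m D.X₁ x‖ ^ 2)
    (e : Fin n → ℝ) :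
    c * ‖S.coords D.m (Fin D.p) (D.oracle S (D.response S e)) - D.coef S‖ ^ 2 ≤ (n : ℝ)⁻¹ *
      ‖(LinearMap.range (S.design D.m D.X₁)).starProjection (WithLp.toLp 2 e)‖ ^ 2 := by
  have hinj := injective_of_mul_norm_sq_le hc hRE
  have hu := S.isUnit_cov_of_injective hn hinj
  have ho := S.adjoint_design_sub_eq_zero hn hu (D.response S e)
  rw [D.response_eq] at ho
  have h1 := mul_norm_sq_oracle_sub_le hRE ho
  rwa [coords_oracle, ← extendZero_restrict (β := D.coef S) fun j hj => h.coef_eq_zero S hj,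
    ← extendZero_sub, norm_extendZero]

/-- Selection and closeness to the oracle for the adaptive estimator, when the pilot estimator has
error at most `r`. -/
theorem IsModelDesign.adaptive_estimator (h : IsModelDesign S D) (hn : 0 < n) {c : ℝ}
    (hc : 0 < c) (hRE : ∀ x, c * ‖x‖ ^ 2 ≤ (n : ℝ)⁻¹ * ‖S.design D.m D.X₁ x‖ ^ 2)
    (hirr : S.kOpNorm (S.cov D.m D.X₂ D.X₁ ∘ₗ Ring.inverse (D.covActive S)) < 1)
    {e : Fin n → ℝ} {Λ bm r t : ℝ} (hΛ : 0 < Λ) (hbm : 0 < bm)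
    {βp βa : Fin D.p → S.sieve D.m}
    (hmin : S.IsMinimizer D.m D.X (D.response S e) Λ (S.adaptiveWeight βp) βa)
    (hcoef : ∀ j ∈ D.active, bm ≤ ‖D.coef S j‖)
    (hpilot : ‖S.coords D.m (Fin D.p) βp - D.coef S‖ ≤ r) (hr : r ≤ bm / 2)
    (hnoise : ∀ j, (n : ℝ)⁻¹ * ‖LinearMap.adjoint (S.design D.m D.X₂)
      ((LinearMap.range (S.design D.m D.X₁))ᗮ.starProjection (WithLp.toLp 2 e)) j‖ ≤ t)
    (hrt : r * (t + Λ * (2 / bm * Real.sqrt D.p₀)) < Λ) :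
    (∀ j ∉ D.active, βa j = 0) ∧
      c * ‖S.coords D.m (Fin D.p) βa - S.coords D.m (Fin D.p) (D.oracle S (D.response S e))‖ ≤
        2 * Λ * (2 / bm * Real.sqrt D.p₀) := by
  have hinj := injective_of_mul_norm_sq_le hc hRE
  have hu := S.isUnit_cov_of_injective hn hinj
  have hn' : (0 : ℝ) < n := Nat.cast_pos.2 hn
  obtain ⟨hzero, hle⟩ := KernelOperator.IsMinimizer.groupLasso_le S hΛ hmin
  have hr0 : 0 ≤ r := (norm_nonneg _).trans hpilot
  set w : Fin D.p → ℝ := fun j => (S.adaptiveWeight βp j).toReal with hw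
  -- At a vanishing pilot block both sides are 0, as `toReal` of `∞` and as inverse of 0.
  have hwj : ∀ j, w j = ‖S.coords D.m (Fin D.p) βp j‖⁻¹ := by
    intro j
    change ((ENNReal.ofReal (S.kNorm (βp j : H)))⁻¹).toReal = _
    rw [ENNReal.toReal_inv, ENNReal.toReal_ofReal (S.kNorm_nonneg _),
      KernelOperator.kNorm_coe, KernelOperator.coords_apply]
  have htop : ∀ j, S.adaptiveWeight βp j = ∞ ↔ S.coords D.m (Fin D.p) βp j = 0 := by
    intro j
    change (ENNReal.ofReal (S.kNorm (βp j : H)))⁻¹ = ∞ ↔ _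
    rw [ENNReal.inv_eq_top, ENNReal.ofReal_eq_zero, KernelOperator.kNorm_coe,
      KernelOperator.coords_apply, norm_le_zero_iff]
  have hdiff : ∀ j, ‖S.coords D.m (Fin D.p) βp j - D.coef S j‖ ≤ r := fun j =>
    (norm_apply_le_norm (S.coords D.m (Fin D.p) βp - D.coef S) j).trans hpilot
  -- A pilot error of at most half the signal keeps the active weights below `2 / bm`, and in
  -- particular finite, so every extension by zero is an admissible competitor.
  have hlow : ∀ j ∈ D.active, bm / 2 ≤ ‖S.coords D.m (Fin D.p) βp j‖ := by
    intro j hj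
    have h1 := hcoef j hj
    have h2 := hdiff j
    have h3 := norm_sub_norm_le (D.coef S j) (S.coords D.m (Fin D.p) βp j)
    rw [norm_sub_rev] at h3
    linarith
  have hw0 : ∀ j ∈ D.active, 0 ≤ w j := fun j _ => ENNReal.toReal_nonneg
  have hwle : ∀ j ∈ D.active, w j ≤ 2 / bm := by
    intro j hj
    rw [hwj, ← inv_div]
    exact inv_anti₀ (by positivity) (hlow j hj)
  have hk : 0 ≤ 2 / bm := by positivity
  have hmin' : ∀ x, groupLasso (S.design D.m D.X)
      (S.design D.m D.X₁ (restrict (· ∈ D.active) (D.coef S)) + WithLp.toLp 2 e) n Λ w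
        (S.coords D.m (Fin D.p) βa) ≤
      groupLasso (S.design D.m D.X)
      (S.design D.m D.X₁ (restrict (· ∈ D.active) (D.coef S)) + WithLp.toLp 2 e) n Λ w
        (extendZero D.active x) := by
    intro x
    have h1 := hle ((S.coords D.m (Fin D.p)).symm (extendZero D.active x)) (fun j hj => by
      have hjA : j ∉ D.active := by
        intro hjA
        have h2 := hlow j hjA
        rw [(htop j).1 hj, norm_zero] at h2
        linarith
      apply (S.coord D.m).injective
      rw [← KernelOperator.coords_apply, LinearEquiv.apply_symm_apply,
        extendZero_apply_notMem _ hjA, map_zero])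
    rwa [LinearEquiv.apply_symm_apply, D.response_eq] at h1
  have hsupp : ∀ j ∉ D.active, S.coords D.m (Fin D.p) βa j = 0 := by
    refine groupLasso_support_subset (D.design_eq_add S) hn' hΛ hinj
      (S.norm_adjoint_design_le hn hu hirr) hmin' hw0 hwle hk ?_
    intro j hj
    rw [h.card_active S]
    -- A null block with zero pilot has infinite weight and vanishes already; otherwise its pilot
    -- norm is at most `r`, so its weight is at least `1/r`.
    have hpj : S.coords D.m (Fin D.p) βp j ≠ 0 := by
      intro h0
      apply hj
      rw [KernelOperator.coords_apply, hzero j ((htop j).2 h0), map_zero]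
    have hpos := norm_pos_iff.2 hpj
    have hle_r : ‖S.coords D.m (Fin D.p) βp j‖ ≤ r := by
      have := hdiff j
      rwa [h.coef_eq_zero S j.2, sub_zero] at this
    refine lt_of_le_of_lt (add_le_add (hnoise j) le_rfl) ?_
    rw [hwj, ← div_eq_mul_inv, lt_div_iff₀ hpos, mul_comm]
    have ht0 : 0 ≤ t := le_trans (by positivity) (hnoise j)
    exact (mul_le_mul_of_nonneg_right hle_r (by positivity)).trans_lt hrt
  refine ⟨fun j hj => (S.coord D.m).map_eq_zero_iff.1 (hsupp j hj), ?_⟩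
  have ho := S.adjoint_design_sub_eq_zero hn hu (D.response S e)
  have hx := extendZero_restrict hsupp
  have hmin2 := hmin' (S.coords D.m {j // j ∈ D.active}
    (Ring.inverse (D.covActive S) (S.crossCov D.m (D.response S e) D.X₁)))
  rw [← hx, ← D.response_eq] at hmin2
  have h1 := mul_norm_sub_oracle_le (D.design_eq_add S) hΛ hRE ho hmin2 hw0 hwle hk
  rw [h.card_active S] at h1
  rwa [← hx, coords_oracle, ← extendZero_sub, norm_extendZero]

end FixedSampleSize

end Sofia

namespace Sofia

/-! ### Probability bounds at a fixed sample size. -/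

section FixedSampleSizeProbability

variable {H : Type*} [NormedAddCommGroup H] [InnerProductSpace ℝ H] [CompleteSpace H]
  {S : KernelOperator H} {n : ℕ} {D : Sample H n}
  {Ω : Type*} [MeasurableSpace Ω] {μ : Measure Ω} [IsProbabilityMeasure μ]
  {e : Fin n → Ω → ℝ} {c : NNReal} {βp : Ω → Fin D.p → S.sieve D.m}

/-- Error bound for the lasso that fails with probability at most `3 / p`. -/
theorem IsModelDesign.measure_lasso_error_le (h : IsModelDesign S D) (hn : 0 < n) (hc : 0 < c)
    (hind : iIndepFun e μ) (hsub : ∀ i, HasSubgaussianMGF (e i) c μ) (hα : 0 < D.reConst S)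
    {Λ : ℝ} (hΛ : 0 < Λ)
    (hlow : 2 * Real.sqrt ((n : ℝ)⁻¹ * S.θ 0 * (8 * c) * Real.log D.p) ≤ Λ)
    (hmin : ∀ᵐ ω ∂μ, S.IsMinimizer D.m D.X (D.response S fun i => e i ω) Λ (fun _ => 1) (βp ω)) :
    μ {ω | 3 * Λ * Real.sqrt D.p₀ / D.reConst S ^ 2 <
      ‖S.coords D.m (Fin D.p) (βp ω) - D.coef S‖} ≤ ENNReal.ofReal (3 / D.p) := by
  have hn' : (0 : ℝ) < n := Nat.cast_pos.2 hn
  have hp : (0 : ℝ) < D.p := Nat.cast_pos.2 (lt_of_le_of_lt (Nat.zero_le _) h.p₀_lt)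
  have hc' : (0 : ℝ) < c := hc
  have hlog : 0 ≤ Real.log D.p := Real.log_natCast_nonneg _
  have hθ := S.θ_pos 0
  refine (measure_mono_ae ?_).trans ((measure_exists_le_norm_adjoint_design S hc hn hind hsub D.m
    h.normalized ⊤ (half_pos hΛ)).trans (ENNReal.ofReal_le_ofReal ?_))
  · filter_upwards [hmin] with ω hω hbad
    change ∃ j, _
    change 3 * Λ * Real.sqrt D.p₀ / D.reConst S ^ 2 < _ at hbad
    by_contra hgood
    push Not at hgood
    refine absurd hbad (not_lt.2 ?_)
    rw [← h.card_active S]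
    refine norm_sub_le_of_groupLasso_of_dual_bound hn' hΛ hα
      (fun j hj => h.coef_eq_zero S hj) (h.lasso_inequality hΛ hω)
      (restricted_eigenvalue S hα (h.card_active S).le)
      (inner_design_le_sum S fun j => ?_)
    have := (hgood j).le
    rwa [Submodule.starProjection_top] at this
  · rw [Fintype.card_fin]
    have h1 : (n : ℝ)⁻¹ * S.θ 0 * (8 * c) * Real.log D.p ≤ (Λ / 2) ^ 2 := by
      rw [← Real.sqrt_le_left (by positivity)]
      linarith
    -- The constant `8 c` yields the exponent `2 log p`: one factor `p` pays for the union bound,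
    -- the other leaves `3/p`.
    have h2 : 2 * Real.log D.p ≤ 1 / (4 * c) * (n * (Λ / 2) ^ 2 / S.θ 0) := by
      have h3 : 2 * Real.log D.p =
          1 / (4 * c) * (n * ((n : ℝ)⁻¹ * S.θ 0 * (8 * c) * Real.log D.p) / S.θ 0) := by
        field_simp
        ring
      rw [h3]
      gcongr
    have h4 : Real.exp (-(1 / (4 * (c : ℝ))) * (n * (Λ / 2) ^ 2 / S.θ 0)) ≤
        ((D.p : ℝ) ^ 2)⁻¹ := by
      calc Real.exp (-(1 / (4 * (c : ℝ))) * (n * (Λ / 2) ^ 2 / S.θ 0))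
          ≤ Real.exp (-(2 * Real.log D.p)) := Real.exp_le_exp.2 (by linarith)
        _ = ((D.p : ℝ) ^ 2)⁻¹ := by
          rw [Real.exp_neg, two_mul, Real.exp_add, Real.exp_log hp, pow_two]
    calc (D.p : ℝ) * (3 * Real.exp (-(1 / (4 * (c : ℝ))) * (n * (Λ / 2) ^ 2 / S.θ 0)))
        ≤ D.p * (3 * ((D.p : ℝ) ^ 2)⁻¹) := by gcongr
      _ = 3 / D.p := by field_simp

/-- Error bound for the lasso with few predictors. -/
theorem IsModelDesign.measure_lasso_error_le_of_rank (h : IsModelDesign S D) (hn : 0 < n)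
    {σ C₁ C₂ : ℝ} (he : IsModelError μ σ C₁ C₂ e) (hL2 : ∀ i, MemLp (e i) 2 μ)
    (hα : 0 < D.reConst S) {Λ s : ℝ} (hΛ : 0 < Λ) (hs : 0 < s)
    (hmin : ∀ᵐ ω ∂μ, S.IsMinimizer D.m D.X (D.response S fun i => e i ω) Λ (fun _ => 1) (βp ω)) :
    μ {ω | 2 * (s / n) / Λ + 4 * Λ * Real.sqrt D.p₀ / D.reConst S ^ 2 +
      2 * Real.sqrt (s / n) / D.reConst S < ‖S.coords D.m (Fin D.p) (βp ω) - D.coef S‖} ≤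
      ENNReal.ofReal (σ ^ 2 * (D.p * D.m) / s) := by
  have hn' : (0 : ℝ) < n := Nat.cast_pos.2 hn
  have hrank := finrank_range_design_le S D.m D.X
  rw [Fintype.card_fin] at hrank
  have hm := measure_le_norm_sq_proj_le he hL2 (LinearMap.range (S.design D.m D.X)) hrank hs
  rw [Nat.cast_mul] at hm
  refine (measure_mono_ae ?_).trans hm
  filter_upwards [hmin] with ω hω hbad
  change _ < _ at hbad
  change s ≤ _
  by_contra hlt
  push Not at hlt
  refine absurd hbad (not_lt.2 ?_)
  -- Against vectors in the range of the design only the projection of the noise counts.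
  have hkey := norm_sub_le_of_groupLasso_of_range_bound (g := ‖(LinearMap.range
    (S.design D.m D.X)).starProjection (WithLp.toLp 2 fun i => e i ω)‖) hn' hΛ hα
    (fun j hj => h.coef_eq_zero S hj) (h.lasso_inequality hΛ hω)
    (restricted_eigenvalue S hα (h.card_active S).le) (fun δ => by
      have h1 : (LinearMap.range (S.design D.m D.X)).starProjection (S.design D.m D.X δ) =
        S.design D.m D.X δ := Submodule.starProjection_eq_self_iff.2 ⟨δ, rfl⟩
      nth_rewrite 1 [← h1]
      rw [← Submodule.inner_starProjection_left_eq_right]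
      exact real_inner_le_norm _ _)
  refine hkey.trans ?_
  rw [h.card_active S]
  gcongr

end FixedSampleSizeProbability

/-- Conditions on a sample that hold for all large sample sizes; `t` is the reciprocal of the
eigenvalue lower bound. -/
structure IsRegularSample {H : Type*} [NormedAddCommGroup H] [InnerProductSpace ℝ H]
    [CompleteSpace H] (S : KernelOperator H) {n : ℕ} (D : Sample H n) (t b₂ γ : ℝ) : Prop where
  design : IsModelDesign S D
  n_pos : 0 < n
  m_pos : 0 < D.m
  t_pos : 0 < t
  reConst_pos : 0 < D.reConst S
  norm_le : ∀ x, t⁻¹ * ‖x‖ ^ 2 ≤ (n : ℝ)⁻¹ * ‖S.design D.m D.X₁ x‖ ^ 2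
  rpow_le : (D.m : ℝ) ^ γ ≤ b₂ * t
  signal_le : ∀ j ∈ D.active, D.minSieveSignal S ≤ ‖D.coef S j‖
  irrepresentable : S.kOpNorm (S.cov D.m D.X₂ D.X₁ ∘ₗ Ring.inverse (D.covActive S)) < 1

section Regular

variable {H : Type*} [NormedAddCommGroup H] [InnerProductSpace ℝ H] [CompleteSpace H]
  {S : KernelOperator H} {n : ℕ} {D : Sample H n} {t b₂ γ : ℝ}
  {Ω : Type*} [MeasurableSpace Ω] {μ : Measure Ω} [IsProbabilityMeasure μ]
  {e : Fin n → Ω → ℝ} {c : NNReal}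

theorem IsModelDesign.two_le_p (h : IsModelDesign S D) : (2 : ℝ) ≤ D.p := by
  have h1 := h.p₀_pos
  have h2 := h.p₀_lt
  exact_mod_cast (by omega : 2 ≤ D.p)

theorem IsModelDesign.log_two_le (h : IsModelDesign S D) : Real.log 2 ≤ Real.log D.p :=
  Real.log_le_log two_pos h.two_le_p

theorem IsModelDesign.one_le_p₀ (h : IsModelDesign S D) : (1 : ℝ) ≤ D.p₀ := by
  exact_mod_cast h.p₀_pos

theorem IsRegularSample.m_le (h : IsRegularSample S D t b₂ γ) (hγ : 1 ≤ γ) :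
    (D.m : ℝ) ≤ b₂ * t := by
  have h1 : (1 : ℝ) ≤ D.m := by exact_mod_cast h.m_pos
  refine le_trans ?_ h.rpow_le
  calc (D.m : ℝ) = (D.m : ℝ) ^ (1 : ℝ) := (Real.rpow_one _).symm
    _ ≤ _ := Real.rpow_le_rpow_of_exponent_le h1 hγ

theorem IsRegularSample.measure_oracle_error_le (h : IsRegularSample S D t b₂ γ)
    {σ C₁ C₂ C ε : ℝ} (he : IsModelError μ σ C₁ C₂ e) (hL2 : ∀ i, MemLp (e i) 2 μ) (hε : 0 < ε)
    (hC : 0 < C) (hCσ : σ ^ 2 / ε ≤ C ^ 2) :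
    μ {ω | C * Real.sqrt (D.p₀ * D.m * t / n) < ‖S.coords D.m (Fin D.p)
      (D.oracle S (D.response S fun i => e i ω)) - D.coef S‖} ≤ ENNReal.ofReal ε := by
  have hn : (0 : ℝ) < n := Nat.cast_pos.2 h.n_pos
  have hm : (0 : ℝ) < D.m := Nat.cast_pos.2 h.m_pos
  have hp₀ : (0 : ℝ) < D.p₀ := Nat.cast_pos.2 h.design.p₀_pos
  have ht := h.t_pos
  have hrank := finrank_range_design_le S D.m D.X₁
  rw [Fintype.card_coe, h.design.card_active S] at hrank
  have hs : 0 < C ^ 2 * (D.p₀ * D.m) := by positivity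
  refine (measure_mono ?_).trans ((measure_le_norm_sq_proj_le he hL2
    (LinearMap.range (S.design D.m D.X₁)) hrank hs).trans (ENNReal.ofReal_le_ofReal ?_))
  · intro ω hω
    rw [Set.mem_ofPred_eq] at hω ⊢
    have h1 := h.design.mul_norm_oracle_sub_sq_le h.n_pos (inv_pos.2 ht) h.norm_le fun i => e i ω
    have h2 := pow_lt_pow_left₀ hω (by positivity) two_ne_zero
    rw [mul_pow, Real.sq_sqrt (by positivity)] at h2
    rw [inv_mul_le_iff₀ ht] at h1
    have h3 := h2.trans_le h1
    have h4 : C ^ 2 * (D.p₀ * D.m * t / n) = t * ((n : ℝ)⁻¹ * (C ^ 2 * (D.p₀ * D.m))) := by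
      field_simp
    rw [h4] at h3
    exact (lt_of_mul_lt_mul_left (lt_of_mul_lt_mul_left h3 ht.le) (by positivity)).le
  · rw [Nat.cast_mul, mul_div_mul_right _ _ (by positivity : ((D.p₀ : ℝ) * D.m) ≠ 0),
      div_le_iff₀ (by positivity), mul_comm, ← div_le_iff₀ hε]
    exact hCσ

/-- Since `p` need not grow, the failure probability is made small through the constant: the surplus
`k` in the exponent gives `p⁻ᵏ ≤ 2⁻ᵏ`. -/
theorem IsModelDesign.measure_residual_noise_le (h : IsModelDesign S D) (hn : 0 < n) (hc : 0 < c)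
    (hind : iIndepFun e μ) (hsub : ∀ i, HasSubgaussianMGF (e i) c μ) {C k : ℝ} (hC : 0 < C)
    (hk : 0 ≤ k) (hCk : 4 * c * S.θ 0 * (1 + k) ≤ C ^ 2)
    (U : Submodule ℝ (EuclideanSpace ℝ (Fin n))) :
    μ {ω | ∃ j, C * Real.sqrt (Real.log D.p / n) ≤ (n : ℝ)⁻¹ * ‖LinearMap.adjoint
      (S.design D.m D.X₂) (U.starProjection (WithLp.toLp 2 fun i => e i ω)) j‖} ≤
      ENNReal.ofReal (3 * Real.exp (-(k * Real.log 2))) := by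
  have hn' : (0 : ℝ) < n := Nat.cast_pos.2 hn
  have hp : (0 : ℝ) < D.p := by linarith [h.two_le_p]
  have hc' : (0 : ℝ) < c := hc
  have hθ := S.θ_pos 0
  have hlog2 := Real.log_pos one_lt_two
  have hlog : 0 < Real.log D.p := hlog2.trans_le h.log_two_le
  refine (measure_exists_le_norm_adjoint_design S hc hn hind hsub D.m
    (X := D.X₂) (t := C * Real.sqrt (Real.log D.p / n)) (fun j => h.normalized j) U
    (by positivity)).trans (ENNReal.ofReal_le_ofReal ?_)
  have hcard : (Fintype.card {j // j ∉ D.active} : ℝ) ≤ D.p := by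
    have := Fintype.card_subtype_le fun j => j ∉ D.active
    rw [Fintype.card_fin] at this
    exact_mod_cast this
  have h1 : (1 + k) * Real.log D.p ≤
      1 / (4 * c) * (n * (C * Real.sqrt (Real.log D.p / n)) ^ 2 / S.θ 0) := by
    rw [mul_pow, Real.sq_sqrt (by positivity)]
    have h2 : 1 / (4 * (c : ℝ)) * (n * (C ^ 2 * (Real.log D.p / n)) / S.θ 0) =
        C ^ 2 / (4 * c * S.θ 0) * Real.log D.p := by field_simp
    rw [h2]
    refine mul_le_mul_of_nonneg_right ?_ hlog.le
    rw [le_div_iff₀ (by positivity)]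
    linarith
  have h3 : Real.exp (-(1 / (4 * (c : ℝ))) *
      (n * (C * Real.sqrt (Real.log D.p / n)) ^ 2 / S.θ 0)) ≤
      (D.p : ℝ)⁻¹ * Real.exp (-(k * Real.log 2)) := by
    calc _ ≤ Real.exp (-Real.log D.p + -(k * Real.log 2)) := by
          refine Real.exp_le_exp.2 ?_
          have := mul_le_mul_of_nonneg_left h.log_two_le hk
          linarith
      _ = _ := by rw [Real.exp_add, Real.exp_neg, Real.exp_log hp]
  calc _ ≤ D.p * (3 * ((D.p : ℝ)⁻¹ * Real.exp (-(k * Real.log 2)))) := by gcongr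
    _ = 3 * Real.exp (-(k * Real.log 2)) := by field_simp

end Regular

end Sofia

namespace Sofia

/-! ### Rate of the pilot estimator and the good event. -/

section Asymptotics

variable {H : Type*} [NormedAddCommGroup H] [InnerProductSpace ℝ H] [CompleteSpace H]
  {S : KernelOperator H} {D : ∀ n, Sample H n} {b₁ b₂ γ τ M : ℝ} {τm Λ Λp : ℕ → ℝ}
  {Ω : Type*} [MeasurableSpace Ω] {μ : Measure Ω} [IsProbabilityMeasure μ]
  {e : ∀ n, Fin n → Ω → ℝ} {σ C₁ C₂ : ℝ} {c : NNReal}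

theorem eventually_isRegularSample (hdesign : ∀ᶠ n in atTop, IsModelDesign S (D n))
    (hsieve : SieveBounds S D b₁ b₂ γ) (hα : ∀ᶠ n in atTop, 0 < (D n).reConst S)
    (hasym : AsymptoticConditions S D τ τm Λ) :
    ∀ᶠ n in atTop, IsRegularSample S (D n) (τm n) b₂ γ := by
  filter_upwards [hdesign, hα, hasym.τm_pos, hasym.eigenvalues, hasym.irrepresentable,
    hsieve.predictor_le, hsieve.m_tendsto.eventually_gt_atTop 0, eventually_gt_atTop 0,
    hasym.tail_small.bound (by norm_num : (0 : ℝ) < 2⁻¹)]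
    with n hd hα hτ heig hirr hpred hm hn htail
  have hle := S.mul_norm_sq_le_norm_design_sq (X := (D n).X₁) (c := (τm n)⁻¹)
    fun s hs => by
      rw [← one_div]
      exact (heig s hs).1
  have hA : (D n).active.Nonempty := by
    rw [← Finset.card_pos, hd.card_active S]
    exact hd.p₀_pos
  have hsig : 0 ≤ (D n).minSignal S := by
    refine Real.sInf_nonneg ?_
    rintro _ ⟨_, _, rfl⟩
    exact S.kNorm_nonneg _
  rw [Real.norm_of_nonneg hsig] at htail
  exact ⟨hd, hn, hm, hτ, hα, hle, rpow_le_mul_of_eigenvalue_bound S hn hm hτ hA hpred hle,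
    fun j hj => minSieveSignal_le (hd.proj_ne_zero ((le_abs_self _).trans htail) hj), hirr⟩

theorem IsRegularSample.zeta_pos {n : ℕ} (h : IsRegularSample S (D n) (τm n) b₂ γ) :
    0 < zeta S D τm n :=
  lt_min (inv_pos.2 h.t_pos) (pow_pos h.reConst_pos 2)

theorem IsRegularSample.le_inv_zeta {n : ℕ} (h : IsRegularSample S (D n) (τm n) b₂ γ) :
    τm n ≤ (zeta S D τm n)⁻¹ :=
  (le_inv_comm₀ h.t_pos h.zeta_pos).2 (min_le_left _ _)

/-- The rate of the pilot estimator. -/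
noncomputable def pilotRate (S : KernelOperator H) (D : ∀ n, Sample H n) (τm : ℕ → ℝ) (n : ℕ) : ℝ :=
  Real.sqrt (D n).p₀ * Real.sqrt (Real.log (D n).p) * (zeta S D τm n)⁻¹ * (Real.sqrt n)⁻¹

/-- Here `q = √p₀`, `l = √(log p)`, `z = ζ_m`, `N = √n`, `a = α_m`, and `L` is the lasso tuning. The
terms caused by the noise need `m ≤ B / ζ_m`, and `l` is bounded away from 0 because `p ≥ 2`. -/
theorem few_predictors_rate_le {q l z N a L K k G B m l₀ : ℝ} (hz : 0 < z) (hN : 0 < N)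
    (ha : 0 < a) (hk : 0 < k) (hG : 0 < G) (hB : 0 < B) (hl₀ : 0 < l₀) (hza : z ≤ a ^ 2)
    (hlow : k * (l / N) ≤ L) (hup : L ≤ K * (l / N)) (hm : m ≤ B * z⁻¹) (hl : l₀ ≤ l)
    (hq : 1 ≤ q) :
    2 * (G * m / N ^ 2) / L + 4 * L * q / a ^ 2 + 2 * Real.sqrt (G * m / N ^ 2) / a ≤
      (2 * G * B / (k * l₀ ^ 2) + 4 * K + 2 * Real.sqrt (G * B) / l₀) * (q * l * z⁻¹ * N⁻¹) := by
  have hl' : 0 < l := hl₀.trans_le hl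
  have hL : 0 < L := lt_of_lt_of_le (by positivity) hlow
  have hK : 0 < K := by
    by_contra h
    push Not at h
    have : K * (l / N) ≤ 0 := mul_nonpos_of_nonpos_of_nonneg h (by positivity)
    linarith
  have h1 : 2 * (G * m / N ^ 2) / L ≤ 2 * G * B / (k * l₀ ^ 2) * (q * l * z⁻¹ * N⁻¹) := by
    calc 2 * (G * m / N ^ 2) / L ≤ 2 * (G * (B * z⁻¹) / N ^ 2) / (k * (l / N)) := by gcongr
      _ = 2 * G * B / (k * l ^ 2) * (1 * l * z⁻¹ * N⁻¹) := by field_simp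
      _ ≤ 2 * G * B / (k * l₀ ^ 2) * (q * l * z⁻¹ * N⁻¹) := by gcongr
  have h2 : 4 * L * q / a ^ 2 ≤ 4 * K * (q * l * z⁻¹ * N⁻¹) := by
    calc 4 * L * q / a ^ 2 ≤ 4 * (K * (l / N)) * q / z := by gcongr
      _ = 4 * K * (q * l * z⁻¹ * N⁻¹) := by field_simp
  have h3 : 2 * Real.sqrt (G * m / N ^ 2) / a ≤
      2 * Real.sqrt (G * B) / l₀ * (q * l * z⁻¹ * N⁻¹) := by
    have hza' : Real.sqrt z ≤ a := Real.sqrt_le_iff.2 ⟨ha.le, hza⟩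
    have hs : Real.sqrt (G * m / N ^ 2) ≤ Real.sqrt (G * B) / Real.sqrt z / N := by
      refine Real.sqrt_le_iff.2 ⟨by positivity, ?_⟩
      rw [div_pow, div_pow, Real.sq_sqrt (by positivity), Real.sq_sqrt hz.le]
      calc G * m / N ^ 2 ≤ G * (B * z⁻¹) / N ^ 2 := by gcongr
        _ = G * B / z / N ^ 2 := by field_simp
    calc 2 * Real.sqrt (G * m / N ^ 2) / a
        ≤ 2 * (Real.sqrt (G * B) / Real.sqrt z / N) / Real.sqrt z := by gcongr
      _ = 2 * Real.sqrt (G * B) * (Real.sqrt z * Real.sqrt z)⁻¹ * N⁻¹ := by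
          have := (Real.sqrt_pos.2 hz).ne'
          field_simp
      _ = 2 * Real.sqrt (G * B) / l₀ * (1 * l₀ * z⁻¹ * N⁻¹) := by
          rw [Real.mul_self_sqrt hz.le]
          field_simp
      _ ≤ 2 * Real.sqrt (G * B) / l₀ * (q * l * z⁻¹ * N⁻¹) := by gcongr
  linarith

/-- The lasso attains the rate `pilotRate` up to a constant, with probability close to one. -/
theorem exists_eventually_measure_lasso_error_le (hc : 0 < c) (hb₂ : 0 < b₂) (hγ : 1 ≤ γ)
    (hreg : ∀ᶠ n in atTop, IsRegularSample S (D n) (τm n) b₂ γ)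
    (herr : ∀ᶠ n in atTop, IsModelError μ σ C₁ C₂ (e n))
    (hsub : ∀ᶠ n in atTop, ∀ i, HasSubgaussianMGF (e n i) c μ)
    (hL2 : ∀ᶠ n in atTop, ∀ i, MemLp (e n i) 2 μ)
    (htune : LassoTuning S D (8 * c) Λp) {βp : ∀ n, Ω → Fin (D n).p → S.sieve (D n).m}
    (hmin : ∀ᶠ n in atTop, ∀ᵐ ω ∂μ, S.IsMinimizer (D n).m (D n).X
      ((D n).response S fun i => e n i ω) (Λp n) (fun _ => 1) (βp n ω)) {ε : ℝ} (hε : 0 < ε) :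
    ∃ C : ℝ, 0 < C ∧ ∀ᶠ n in atTop, μ {ω | C * pilotRate S D τm n <
      ‖S.coords (D n).m (Fin (D n).p) (βp n ω) - (D n).coef S‖} ≤ ENNReal.ofReal ε := by
  obtain ⟨K, hK, hKb⟩ := htune.upper.exists_pos
  have hc' : (0 : ℝ) < c := hc
  have hθ := S.θ_pos 0
  set k : ℝ := 2 * Real.sqrt (S.θ 0 * (8 * c)) with hk
  have hk0 : 0 < k := by positivity
  set l₀ : ℝ := Real.sqrt (Real.log 2) with hl₀
  have hlog2 := Real.log_pos one_lt_two
  have hl₀0 : 0 < l₀ := Real.sqrt_pos.2 hlog2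
  -- Beyond `P` the failure probability `3/p` is at most `ε`; below it, noise level `G m` with `G ≥
  -- σ² P / ε` makes the rank bound at most `ε`. The added 1 keeps `G` positive when `σ = 0`.
  set P : ℝ := 3 / ε with hP
  have hP0 : 0 < P := by positivity
  set G : ℝ := σ ^ 2 * P / ε + 1 with hG
  have hG0 : 0 < G := by positivity
  refine ⟨2 * G * b₂ / (k * l₀ ^ 2) + 4 * K + 2 * Real.sqrt (G * b₂) / l₀, by positivity, ?_⟩
  filter_upwards [hreg, herr, hsub, hL2, htune.lower, hKb.bound, hmin]
    with n hr he hs hl2 hlow hup hmin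
  have hn : (0 : ℝ) < n := Nat.cast_pos.2 hr.n_pos
  have hm : (0 : ℝ) < (D n).m := Nat.cast_pos.2 hr.m_pos
  have hN : 0 < Real.sqrt n := Real.sqrt_pos.2 hn
  have hz := hr.zeta_pos
  have hza : zeta S D τm n ≤ (D n).reConst S ^ 2 := min_le_right _ _
  have hp := hr.design.two_le_p
  have hlog : Real.log 2 ≤ Real.log (D n).p := hr.design.log_two_le
  set l : ℝ := Real.sqrt (Real.log (D n).p) with hl
  have hll : l₀ ≤ l := Real.sqrt_le_sqrt hlog
  have hl0 : 0 < l := hl₀0.trans_le hll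
  have hlow' : k * (l / Real.sqrt n) ≤ Λp n := by
    refine le_trans (le_of_eq ?_) hlow
    rw [hk, hl, mul_assoc, ← Real.sqrt_div' _ hn.le, ← Real.sqrt_mul (by positivity)]
    congr 2
    field_simp
  have hΛ : 0 < Λp n := lt_of_lt_of_le (by positivity) hlow'
  have hup' : Λp n ≤ K * (l / Real.sqrt n) := by
    rw [Real.norm_of_nonneg hΛ.le, Real.norm_of_nonneg (Real.sqrt_nonneg _),
      Real.sqrt_div' _ hn.le] at hup
    exact hup
  have hq : 1 ≤ Real.sqrt (D n).p₀ := Real.one_le_sqrt.2 hr.design.one_le_p₀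
  rcases le_total P (D n).p with hPp | hPp
  · refine (measure_mono ?_).trans ((hr.design.measure_lasso_error_le hr.n_pos hc he.indep hs
      hr.reConst_pos hΛ hlow hmin).trans (ENNReal.ofReal_le_ofReal ?_))
    · intro ω hω
      rw [Set.mem_ofPred_eq] at hω ⊢
      refine lt_of_le_of_lt ?_ hω
      calc 3 * Λp n * Real.sqrt (D n).p₀ / (D n).reConst S ^ 2
          ≤ 3 * (K * (l / Real.sqrt n)) * Real.sqrt (D n).p₀ / zeta S D τm n := by gcongr
        _ = 3 * K * pilotRate S D τm n := by
          rw [pilotRate, ← hl]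
          field_simp
        _ ≤ _ := by
          refine mul_le_mul_of_nonneg_right ?_ (by rw [pilotRate]; positivity)
          have h1 : 0 ≤ 2 * G * b₂ / (k * l₀ ^ 2) := by positivity
          have h2 : 0 ≤ 2 * Real.sqrt (G * b₂) / l₀ := by positivity
          linarith
    · rw [div_le_iff₀ (by linarith)]
      rwa [hP, div_le_iff₀ hε, mul_comm] at hPp
  · have hGm : 0 < G * (D n).m := by positivity
    refine (measure_mono ?_).trans ((hr.design.measure_lasso_error_le_of_rank hr.n_pos he hl2
      hr.reConst_pos hΛ hGm hmin).trans (ENNReal.ofReal_le_ofReal ?_))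
    · intro ω hω
      rw [Set.mem_ofPred_eq] at hω ⊢
      refine lt_of_le_of_lt ?_ hω
      have hm' : ((D n).m : ℝ) ≤ b₂ * (zeta S D τm n)⁻¹ :=
        (hr.m_le hγ).trans (mul_le_mul_of_nonneg_left hr.le_inv_zeta hb₂.le)
      have h1 := few_predictors_rate_le hz hN hr.reConst_pos hk0 hG0 hb₂ hl₀0 hza hlow' hup' hm'
        hll hq
      rwa [Real.sq_sqrt hn.le] at h1
    · rw [div_le_iff₀ hGm, ← mul_assoc, ← mul_assoc]
      refine mul_le_mul_of_nonneg_right ?_ hm.le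
      have h1 : ε * G = σ ^ 2 * P + ε := by
        rw [hG]
        field_simp
      rw [h1]
      nlinarith [mul_le_mul_of_nonneg_left hPp (sq_nonneg σ)]

/-- The event on which the pilot estimator, the residual noise and the oracle estimator are all of
their typical size, up to the constant `C`. -/
structure IsGoodEvent (S : KernelOperator H) (D : ∀ n, Sample H n) (τm : ℕ → ℝ) (C : ℝ) (n : ℕ)
    (β : Fin (D n).p → S.sieve (D n).m) (e : Fin n → ℝ) : Prop where
  pilot : ‖S.coords (D n).m (Fin (D n).p) β - (D n).coef S‖ ≤ C * pilotRate S D τm n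
  noise : ∀ j, (n : ℝ)⁻¹ * ‖LinearMap.adjoint (S.design (D n).m (D n).X₂)
    ((LinearMap.range (S.design (D n).m (D n).X₁))ᗮ.starProjection (WithLp.toLp 2 e)) j‖ ≤
      C * Real.sqrt (Real.log (D n).p / n)
  oracle : ‖S.coords (D n).m (Fin (D n).p) ((D n).oracle S ((D n).response S e)) - (D n).coef S‖ ≤
    C * Real.sqrt ((D n).p₀ * (D n).m * τm n / n)

theorem exists_eventually_measure_not_isGoodEvent_le (hc : 0 < c) (hb₂ : 0 < b₂) (hγ : 1 ≤ γ)
    (hreg : ∀ᶠ n in atTop, IsRegularSample S (D n) (τm n) b₂ γ)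
    (herr : ∀ᶠ n in atTop, IsModelError μ σ C₁ C₂ (e n))
    (hsub : ∀ᶠ n in atTop, ∀ i, HasSubgaussianMGF (e n i) c μ)
    (hL2 : ∀ᶠ n in atTop, ∀ i, MemLp (e n i) 2 μ)
    (htune : LassoTuning S D (8 * c) Λp) {βp : ∀ n, Ω → Fin (D n).p → S.sieve (D n).m}
    (hmin : ∀ᶠ n in atTop, ∀ᵐ ω ∂μ, S.IsMinimizer (D n).m (D n).X
      ((D n).response S fun i => e n i ω) (Λp n) (fun _ => 1) (βp n ω)) {ε : ℝ} (hε : 0 < ε) :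
    ∃ C : ℝ, 0 < C ∧ ∀ᶠ n in atTop,
      μ {ω | ¬ IsGoodEvent S D τm C n (βp n ω) fun i => e n i ω} ≤ ENNReal.ofReal ε := by
  have hε3 : 0 < ε / 3 := by positivity
  obtain ⟨A, hA, hpilot⟩ := exists_eventually_measure_lasso_error_le hc hb₂ hγ hreg herr hsub hL2
    htune hmin hε3
  have hc' : (0 : ℝ) < c := hc
  have hθ := S.θ_pos 0
  have hlog2 := Real.log_pos one_lt_two
  -- Chosen so that `3 · 2⁻ᵏ ≤ ε / 3`.
  set k : ℝ := |Real.log (ε / 9)| / Real.log 2 with hk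
  have hk0 : 0 ≤ k := by positivity
  have hkε : 3 * Real.exp (-(k * Real.log 2)) ≤ ε / 3 := by
    have h1 : Real.exp (-(k * Real.log 2)) ≤ ε / 9 := by
      rw [hk, div_mul_cancel₀ _ hlog2.ne']
      refine (Real.le_log_iff_exp_le (by positivity)).1 ?_
      linarith [neg_abs_le (Real.log (ε / 9))]
    linarith
  set B : ℝ := Real.sqrt (4 * c * S.θ 0 * (1 + k)) with hB
  set E : ℝ := Real.sqrt (σ ^ 2 / (ε / 3)) with hE
  have hB0 : 0 ≤ B := Real.sqrt_nonneg _
  have hE0 : 0 ≤ E := Real.sqrt_nonneg _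
  set C : ℝ := A + B + E with hC
  have hC0 : 0 < C := by positivity
  have hCB : 4 * c * S.θ 0 * (1 + k) ≤ C ^ 2 := by
    rw [← Real.sq_sqrt (by positivity : 0 ≤ 4 * c * S.θ 0 * (1 + k))]
    exact pow_le_pow_left₀ hB0 (by linarith) 2
  have hCE : σ ^ 2 / (ε / 3) ≤ C ^ 2 := by
    rw [← Real.sq_sqrt (by positivity : 0 ≤ σ ^ 2 / (ε / 3))]
    exact pow_le_pow_left₀ hE0 (by linarith) 2
  refine ⟨C, hC0, ?_⟩
  filter_upwards [hreg, herr, hsub, hL2, hpilot] with n hr he hs hl2 hpilot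
  have h2 := hr.design.measure_residual_noise_le hr.n_pos hc he.indep hs hC0 hk0 hCB
    (LinearMap.range (S.design (D n).m (D n).X₁))ᗮ
  have h3 := hr.measure_oracle_error_le he hl2 hε3 hC0 hCE
  have hsubset : {ω | ¬ IsGoodEvent S D τm C n (βp n ω) fun i => e n i ω} ⊆
      {ω | A * pilotRate S D τm n <
        ‖S.coords (D n).m (Fin (D n).p) (βp n ω) - (D n).coef S‖} ∪
      ({ω | ∃ j, C * Real.sqrt (Real.log (D n).p / n) ≤ (n : ℝ)⁻¹ * ‖LinearMap.adjoint
        (S.design (D n).m (D n).X₂) ((LinearMap.range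
          (S.design (D n).m (D n).X₁))ᗮ.starProjection (WithLp.toLp 2 fun i => e n i ω)) j‖} ∪
      {ω | C * Real.sqrt ((D n).p₀ * (D n).m * τm n / n) < ‖S.coords (D n).m (Fin (D n).p)
        ((D n).oracle S ((D n).response S fun i => e n i ω)) - (D n).coef S‖}) := by
    intro ω hω
    by_contra hcon
    simp only [Set.mem_union, not_or] at hcon
    obtain ⟨g1, g2, g3⟩ := hcon
    refine hω ⟨(not_lt.1 g1).trans ?_, fun j => ?_, not_lt.1 g3⟩
    · refine mul_le_mul_of_nonneg_right (by linarith) ?_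
      have := hr.zeta_pos
      rw [pilotRate]
      positivity
    · by_contra hlt
      exact g2 ⟨j, (not_le.1 hlt).le⟩
  refine (measure_mono hsubset).trans ((measure_union_le _ _).trans
    ((add_le_add hpilot ((measure_union_le _ _).trans (add_le_add
      (h2.trans (ENNReal.ofReal_le_ofReal hkε)) h3))).trans_eq ?_))
  rw [← ENNReal.ofReal_add hε3.le hε3.le, ← ENNReal.ofReal_add hε3.le (by positivity)]
  congr 1
  ring

end Asymptotics

end Sofia

namespace Sofia

/-! ### Selection and closeness to the oracle for large samples. -/

section Conclusions

variable {H : Type*} [NormedAddCommGroup H] [InnerProductSpace ℝ H] [CompleteSpace H]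
  {S : KernelOperator H} {D : ∀ n, Sample H n} {b₁ b₂ γ τ : ℝ} {τm Λ : ℕ → ℝ}

/-- The dimension of the active sieve model is negligible with respect to `τ_m`. -/
theorem eventually_dim_le (hsieve : SieveBounds S D b₁ b₂ γ)
    (hreg : ∀ᶠ n in atTop, IsRegularSample S (D n) (τm n) b₂ γ) {η : ℝ} (hη : 0 < η) :
    ∀ᶠ n in atTop, ((D n).p₀ : ℝ) * (D n).m ≤ η * τm n := by
  have hb := hsieve.b₂_pos
  have hγ := hsieve.one_lt_γ
  filter_upwards [hreg, hsieve.sparse.bound (div_pos hη hb)] with n hr hs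
  have hm : (1 : ℝ) ≤ (D n).m := by exact_mod_cast hr.m_pos
  have hm0 : (0 : ℝ) < (D n).m := by linarith
  rw [Real.norm_of_nonneg (Nat.cast_nonneg _), Real.norm_of_nonneg (by positivity)] at hs
  calc ((D n).p₀ : ℝ) * (D n).m
      ≤ (η / b₂ * ((D n).m : ℝ) ^ ((γ - 1) / 2)) * (D n).m := by gcongr
    _ = η / b₂ * ((D n).m : ℝ) ^ ((γ - 1) / 2 + 1) := by
        rw [Real.rpow_add_one hm0.ne', mul_assoc]
    -- The exponent is `(γ + 1) / 2 ≤ γ`, because `γ > 1`.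
    _ ≤ η / b₂ * ((D n).m : ℝ) ^ γ := by
        refine mul_le_mul_of_nonneg_left ?_ (by positivity)
        exact Real.rpow_le_rpow_of_exponent_le hm (by linarith)
    _ ≤ η / b₂ * (b₂ * τm n) := mul_le_mul_of_nonneg_left hr.rpow_le (by positivity)
    _ = η * τm n := by field_simp

theorem eventually_minSieveSignal_ge
    (hreg : ∀ᶠ n in atTop, IsRegularSample S (D n) (τm n) b₂ γ)
    (hasym : AsymptoticConditions S D τ τm Λ) {k : ℝ} (hk : 0 < k) :
    ∀ᶠ n in atTop, k * (Real.sqrt (D n).p₀ * pilotRate S D τm n) ≤ (D n).minSieveSignal S := by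
  filter_upwards [hreg, hasym.signal.bound (inv_pos.2 hk)] with n hr hs
  have hz := hr.zeta_pos
  rw [Real.norm_of_nonneg minSieveSignal_nonneg, Real.norm_of_nonneg (by positivity)] at hs
  have h1 : Real.sqrt (D n).p₀ * pilotRate S D τm n =
      (D n).p₀ * Real.sqrt (Real.log (D n).p) / (zeta S D τm n * Real.sqrt n) := by
    have h2 : ((D n).p₀ : ℝ) = Real.sqrt (D n).p₀ * Real.sqrt (D n).p₀ :=
      (Real.mul_self_sqrt (Nat.cast_nonneg _)).symm
    rw [pilotRate]
    nth_rewrite 3 [h2]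
    rw [div_eq_mul_inv, mul_inv]
    ring
  rw [h1]
  calc _ ≤ k * (k⁻¹ * (D n).minSieveSignal S) := mul_le_mul_of_nonneg_left hs hk.le
    _ = _ := by field_simp

/-- On the good event, and for large sample sizes, the adaptive estimator selects the active set and
is close to the oracle estimator, which is itself close to the truncated coefficients. -/
theorem eventually_adaptive_estimator (hsieve : SieveBounds S D b₁ b₂ γ)
    (hreg : ∀ᶠ n in atTop, IsRegularSample S (D n) (τm n) b₂ γ)
    (hasym : AsymptoticConditions S D τ τm Λ) {C η : ℝ} (hC : 0 < C) (hη : 0 < η) (hη1 : η ≤ 1) :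
    ∀ᶠ n in atTop, ∀ (βp βa : Fin (D n).p → S.sieve (D n).m) (e : Fin n → ℝ),
      IsGoodEvent S D τm C n βp e →
      S.IsMinimizer (D n).m (D n).X ((D n).response S e) (Λ n) (S.adaptiveWeight βp) βa →
      {j | βa j ≠ 0} = ((D n).active : Set (Fin (D n).p)) ∧
      ‖S.coords (D n).m (Fin (D n).p) βa -
        S.coords (D n).m (Fin (D n).p) ((D n).oracle S ((D n).response S e))‖ ≤
          η * (τm n / Real.sqrt n) ∧
      ‖S.coords (D n).m (Fin (D n).p) ((D n).oracle S ((D n).response S e)) - (D n).coef S‖ ≤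
          η * (τm n / Real.sqrt n) := by
  set l₀ : ℝ := Real.sqrt (Real.log 2) with hl₀
  have hlog2 := Real.log_pos one_lt_two
  have hl₀0 : 0 < l₀ := Real.sqrt_pos.2 hlog2
  filter_upwards [hreg, hasym.tuning_pos, eventually_minSieveSignal_ge hreg hasym
    (by positivity : 0 < 6 * C), eventually_minSieveSignal_ge hreg hasym
    (by positivity : 0 < 4 / l₀), hasym.tuning_lower.bound (by positivity : 0 < (3 * C ^ 2)⁻¹),
    hasym.tuning_upper.bound (by positivity : 0 < η / 4),
    eventually_dim_le hsieve hreg (by positivity : 0 < (η / C) ^ 2)]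
    with n hr hΛ hsig1 hsig2 hlow hup hdim βp βa e hgood hmin
  have hn : (0 : ℝ) < n := Nat.cast_pos.2 hr.n_pos
  have hN : 0 < Real.sqrt n := Real.sqrt_pos.2 hn
  have hz := hr.zeta_pos
  have ht := hr.t_pos
  have hlog : Real.log 2 ≤ Real.log (D n).p := hr.design.log_two_le
  have hlog0 : 0 < Real.log (D n).p := hlog2.trans_le hlog
  have hl0 : 0 < Real.sqrt (Real.log (D n).p) := Real.sqrt_pos.2 hlog0
  have hll : l₀ ≤ Real.sqrt (Real.log (D n).p) := Real.sqrt_le_sqrt hlog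
  have hq : 1 ≤ Real.sqrt (D n).p₀ := Real.one_le_sqrt.2 hr.design.one_le_p₀
  have hq0 : 0 < Real.sqrt (D n).p₀ := by linarith
  set ρ := pilotRate S D τm n with hρ
  set bm := (D n).minSieveSignal S with hbm
  set q := Real.sqrt (D n).p₀ with hqdef
  have hρ0 : 0 < ρ := by
    rw [hρ, pilotRate]
    positivity
  have hbm0 : 0 < bm := lt_of_lt_of_le (by positivity) hsig1
  have hρq : ρ ≤ q * ρ := le_mul_of_one_le_left hρ0.le hq
  have hr1 : C * ρ ≤ bm / 2 := by
    have := mul_le_mul_of_nonneg_left hρq hC.le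
    linarith
  rw [Real.norm_of_nonneg hΛ.le, Real.norm_of_nonneg (by positivity)] at hup
  rw [Real.norm_of_nonneg hΛ.le, Real.norm_of_nonneg (by positivity)] at hlow
  -- Pilot rate times noise rate is exactly the lower rate imposed on the tuning parameter.
  have hnoise : C * ρ * (C * Real.sqrt (Real.log (D n).p / n)) ≤ Λ n / 3 := by
    have h1 : ρ * Real.sqrt (Real.log (D n).p / n) =
        q * Real.log (D n).p * (zeta S D τm n)⁻¹ * (n : ℝ)⁻¹ := by
      rw [hρ, pilotRate, ← hqdef, Real.sqrt_div' _ hn.le]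
      have h2 : Real.sqrt (Real.log (D n).p) * Real.sqrt (Real.log (D n).p) = Real.log (D n).p :=
        Real.mul_self_sqrt hlog0.le
      have h3 : (Real.sqrt n)⁻¹ * (Real.sqrt n)⁻¹ = (n : ℝ)⁻¹ := by
        rw [← mul_inv, Real.mul_self_sqrt hn.le]
      rw [← h3]
      linear_combination (q * (zeta S D τm n)⁻¹ * (Real.sqrt n)⁻¹ * (Real.sqrt n)⁻¹) * h2
    calc C * ρ * (C * Real.sqrt (Real.log (D n).p / n))
        = C ^ 2 * (ρ * Real.sqrt (Real.log (D n).p / n)) := by ring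
      _ ≤ C ^ 2 * ((3 * C ^ 2)⁻¹ * Λ n) := by
          rw [h1]
          exact mul_le_mul_of_nonneg_left hlow (by positivity)
      _ = Λ n / 3 := by field_simp
  -- The extra factor `√p₀` in the signal condition, relative to the pilot rate, pays for the active
  -- penalty.
  have hpen : C * ρ * (Λ n * (2 / bm * q)) ≤ Λ n / 3 := by
    calc C * ρ * (Λ n * (2 / bm * q)) = Λ n / 3 * ((6 * C * (q * ρ)) / bm) := by
          field_simp
          norm_num
      _ ≤ Λ n / 3 * 1 := by
          refine mul_le_mul_of_nonneg_left ?_ (by positivity)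
          rwa [div_le_one hbm0]
      _ = _ := mul_one _
  have hrt : C * ρ * (C * Real.sqrt (Real.log (D n).p / n) + Λ n * (2 / bm * q)) < Λ n := by
    rw [mul_add]
    linarith
  obtain ⟨hzero, hclose⟩ := hr.design.adaptive_estimator hr.n_pos (inv_pos.2 ht) hr.norm_le
    hr.irrepresentable hΛ hbm0 hmin hr.signal_le hgood.pilot hr1 hgood.noise hrt
  have hclose' : ‖S.coords (D n).m (Fin (D n).p) βa -
      S.coords (D n).m (Fin (D n).p) ((D n).oracle S ((D n).response S e))‖ ≤
      η * (τm n / Real.sqrt n) := by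
    rw [inv_mul_le_iff₀ ht] at hclose
    refine hclose.trans ?_
    calc τm n * (2 * Λ n * (2 / bm * q))
        ≤ τm n * (2 * (η / 4 * (bm * q⁻¹ * (Real.sqrt n)⁻¹)) * (2 / bm * q)) := by gcongr
      _ = η * (τm n / Real.sqrt n) := by
          field_simp
          norm_num
  have horacle : ‖S.coords (D n).m (Fin (D n).p) ((D n).oracle S ((D n).response S e)) -
      (D n).coef S‖ ≤ η * (τm n / Real.sqrt n) := by
    refine hgood.oracle.trans ?_
    have h1 : Real.sqrt ((D n).p₀ * (D n).m * τm n / n) ≤ η / C * (τm n / Real.sqrt n) := by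
      refine Real.sqrt_le_iff.2 ⟨by positivity, ?_⟩
      rw [mul_pow, div_pow (τm n), Real.sq_sqrt hn.le]
      calc ((D n).p₀ : ℝ) * (D n).m * τm n / n ≤ (η / C) ^ 2 * τm n * τm n / n := by gcongr
        _ = _ := by ring
    calc C * Real.sqrt ((D n).p₀ * (D n).m * τm n / n)
        ≤ C * (η / C * (τm n / Real.sqrt n)) := mul_le_mul_of_nonneg_left h1 hC.le
      _ = η * (τm n / Real.sqrt n) := by field_simp
  refine ⟨?_, hclose', horacle⟩
  -- The adaptive estimator lies within `2 τ_m/√n` of the truth, so a lost active block would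
  -- contradict this bound. It holds since `τ_m ≤ ζ_m⁻¹` and `√(log p) ≥ l₀`.
  have hrate : 4 * (τm n / Real.sqrt n) ≤ bm := by
    refine le_trans ?_ hsig2
    calc 4 * (τm n / Real.sqrt n) ≤ 4 * ((zeta S D τm n)⁻¹ / Real.sqrt n) := by
          have := hr.le_inv_zeta
          gcongr
      _ = 4 / l₀ * (1 * (1 * l₀ * (zeta S D τm n)⁻¹ * (Real.sqrt n)⁻¹)) := by field_simp
      _ ≤ 4 / l₀ * (q * ρ) := by
          rw [hρ, pilotRate]
          gcongr
  ext j
  constructor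
  · intro hj
    by_contra hjA
    exact hj (hzero j hjA)
  · intro hj h0
    have hjA : j ∈ (D n).active := hj
    have h1 := hr.signal_le j hjA
    have h2 : ‖S.coords (D n).m (Fin (D n).p) βa - (D n).coef S‖ ≤
        2 * (τm n / Real.sqrt n) := by
      have h3 := norm_sub_le_norm_sub_add_norm_sub (S.coords (D n).m (Fin (D n).p) βa)
        (S.coords (D n).m (Fin (D n).p) ((D n).oracle S ((D n).response S e))) ((D n).coef S)
      have h4 : η * (τm n / Real.sqrt n) ≤ τm n / Real.sqrt n :=
        mul_le_of_le_one_left (by positivity) hη1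
      linarith
    have h5 := norm_apply_le_norm (S.coords (D n).m (Fin (D n).p) βa - (D n).coef S) j
    rw [PiLp.sub_apply, KernelOperator.coords_apply, h0, map_zero, zero_sub, norm_neg] at h5
    have h6 : 0 < τm n / Real.sqrt n := by positivity
    linarith

theorem tendsto_zero_of_forall_eventually_le_ofReal {f : ℕ → ℝ≥0∞}
    (h : ∀ ε : ℝ, 0 < ε → ∀ᶠ n in atTop, f n ≤ ENNReal.ofReal ε) : Tendsto f atTop (𝓝 0) := by
  refine ENNReal.tendsto_nhds_zero.2 fun ε hε => ?_
  rcases eq_or_ne ε ∞ with rfl | htop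
  · exact Eventually.of_forall fun _ => le_top
  · filter_upwards [h ε.toReal (ENNReal.toReal_pos hε.ne' htop)] with n hn
    rwa [ENNReal.ofReal_toReal htop] at hn

/-- Only subadditivity is used: the estimators are arbitrary minimizers, so these events need not be
measurable. -/
theorem tendsto_measure_one_of_compl {Ω : Type*} [MeasurableSpace Ω] {μ : Measure Ω}
    [IsProbabilityMeasure μ] {s : ℕ → Set Ω} (h : Tendsto (fun n => μ (s n)ᶜ) atTop (𝓝 0)) :
    Tendsto (fun n => μ (s n)) atTop (𝓝 1) := by
  have h1 : Tendsto (fun n => 1 - μ (s n)ᶜ) atTop (𝓝 (1 - 0)) :=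
    ENNReal.Tendsto.sub tendsto_const_nhds h (Or.inl ENNReal.one_ne_top)
  rw [tsub_zero] at h1
  refine tendsto_of_tendsto_of_tendsto_of_le_of_le h1 tendsto_const_nhds (fun n => ?_)
    fun n => prob_le_one
  refine tsub_le_iff_right.2 ?_
  rw [← measure_univ (μ := μ), ← Set.union_compl_self (s n)]
  exact measure_union_le _ _

end Conclusions

end Sofia

theorem theorem2 (C₁ C₂ : ℝ) (hC₁ : 0 < C₁) (hC₂ : 0 < C₂) :
    ∃ M : ℝ, 0 < M ∧
      ∀ (H : Type*) [NormedAddCommGroup H] [InnerProductSpace ℝ H] [CompleteSpace H]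
        (S : Sofia.KernelOperator H) (D : ∀ n, Sofia.Sample H n)
        (Ω : Type*) [MeasurableSpace Ω] (μ : Measure Ω) [IsProbabilityMeasure μ]
        (ε : ∀ n, Fin n → Ω → ℝ) (σ b₁ b₂ γ τ : ℝ) (τm Λlasso Λ : ℕ → ℝ)
        (βlasso βhat : ∀ n, Ω → Fin (D n).p → S.sieve (D n).m),
        (∀ᶠ n in atTop, Sofia.IsModelDesign S (D n)) →
        (∀ᶠ n in atTop, Sofia.IsModelError μ σ C₁ C₂ (ε n)) →
        Sofia.SieveBounds S D b₁ b₂ γ →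
        (∀ᶠ n in atTop, 0 < (D n).reConst S) →
        Sofia.AsymptoticConditions S D τ τm Λ →
        Sofia.LassoTuning S D M Λlasso →
        (∀ᶠ n in atTop, ∀ᵐ ω ∂μ, S.IsMinimizer (D n).m (D n).X
          ((D n).response S fun i => ε n i ω) (Λlasso n) (fun _ => 1) (βlasso n ω)) →
        (∀ᶠ n in atTop, ∀ᵐ ω ∂μ, S.IsMinimizer (D n).m (D n).X
          ((D n).response S fun i => ε n i ω) (Λ n) (S.adaptiveWeight (βlasso n ω)) (βhat n ω)) →
        (Tendsto (fun n => μ {ω | {j | βhat n ω j ≠ 0} = ((D n).active : Set (Fin (D n).p))})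
            atTop (𝓝 1) ∧
          Tendsto (fun n => μ {ω | {j | βhat n ω j ≠ 0} ≠ ((D n).active : Set (Fin (D n).p))})
            atTop (𝓝 0)) ∧
        Sofia.IsLittleOP μ
          (fun n ω => S.kNormProd fun j => (βhat n ω j : H) -
            ((D n).oracle S ((D n).response S fun i => ε n i ω) j : H))
          (fun n => τm n / Real.sqrt n) ∧
        ((fun n => (D n).maxTail S) =o[atTop]
            (fun n => τm n / Real.sqrt ((D n).p₀ * n)) →
          Sofia.IsLittleOP μ
            (fun n ω => S.kNormProd fun j => (βhat n ω j : H) - (D n).β j)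
            (fun n => τm n / Real.sqrt n)) := by
  obtain ⟨c, hc, hsubG⟩ := Sofia.hasSubgaussianMGF_of_tail hC₁ hC₂
  -- The sub-Gaussian constant `c` comes from `C₁` and `C₂` alone, hence so does `M`.
  refine ⟨8 * c, mul_pos (by norm_num) hc, ?_⟩
  intro H _ _ _ S D Ω _ μ _ ε σ b₁ b₂ γ τ τm Λlasso Λ βlasso βhat hdesign herr hsieve hα hasym
    htune hlasso hadapt
  have hreg := Sofia.eventually_isRegularSample hdesign hsieve hα hasym
  have hsub : ∀ᶠ n in atTop, ∀ i, HasSubgaussianMGF (ε n i) c μ := by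
    filter_upwards [herr] with n hn i
    exact hsubG μ (ε n i) (hn.aemeasurable i) (hn.mean i) (hn.tail i)
  have hL2 : ∀ᶠ n in atTop, ∀ i, MemLp (ε n i) 2 μ := by
    filter_upwards [hsub] with n hn i
    exact (hn i).memLp 2
  -- All claims reduce to sets that eventually miss the good event, for each fixed `C`; the constant
  -- is chosen only after the tolerated probability.
  have hbad : ∀ (s : ∀ n, Set Ω), (∀ C : ℝ, 0 < C → ∀ᶠ n in atTop, ∀ ω,
      Sofia.IsGoodEvent S D τm C n (βlasso n ω) (fun i => ε n i ω) →
      S.IsMinimizer (D n).m (D n).X ((D n).response S fun i => ε n i ω) (Λ n)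
        (S.adaptiveWeight (βlasso n ω)) (βhat n ω) → ω ∉ s n) →
      Tendsto (fun n => μ (s n)) atTop (𝓝 0) := by
    intro s hs
    refine Sofia.tendsto_zero_of_forall_eventually_le_ofReal fun δ hδ => ?_
    obtain ⟨C, hC, hgood⟩ := Sofia.exists_eventually_measure_not_isGoodEvent_le hc hsieve.b₂_pos
      hsieve.one_lt_γ.le hreg herr hsub hL2 htune hlasso hδ
    filter_upwards [hgood, hs C hC, hadapt] with n hgood hs hadapt
    refine (measure_mono_ae ?_).trans hgood
    filter_upwards [hadapt] with ω hω hωs hωg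
    exact hs ω hωg hω hωs
  have hsel : Tendsto (fun n => μ {ω | {j | βhat n ω j ≠ 0} ≠
      ((D n).active : Set (Fin (D n).p))}) atTop (𝓝 0) := by
    refine hbad _ fun C hC => ?_
    filter_upwards [Sofia.eventually_adaptive_estimator hsieve hreg hasym hC one_pos le_rfl]
      with n hn ω hg hm hω
    exact hω (hn _ _ _ hg hm).1
  refine ⟨⟨Sofia.tendsto_measure_one_of_compl hsel, hsel⟩, fun η hη => ?_, fun htail η hη => ?_⟩
  · refine hbad _ fun C hC => ?_
    filter_upwards [hreg, Sofia.eventually_adaptive_estimator hsieve hreg hasym hC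
      (by positivity : 0 < min (η / 2) 1) (min_le_right _ _)] with n hr hn ω hg hm hω
    have h1 := (hn _ _ _ hg hm).2.1
    have hN : 0 < Real.sqrt n := Real.sqrt_pos.2 (Nat.cast_pos.2 hr.n_pos)
    have h2 : 0 < τm n / Real.sqrt n := div_pos hr.t_pos hN
    have h3 : min (η / 2) 1 * (τm n / Real.sqrt n) ≤ η / 2 * (τm n / Real.sqrt n) :=
      mul_le_mul_of_nonneg_right (min_le_left _ _) h2.le
    have h4 : η * (τm n / Real.sqrt n) ≤ S.kNormProd fun j => (βhat n ω j : H) -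
      ((D n).oracle S ((D n).response S fun i => ε n i ω) j : H) := hω
    have h5 := S.kNormProd_eq (D n).m
      (βhat n ω - (D n).oracle S ((D n).response S fun i => ε n i ω))
    rw [map_sub] at h5
    simp only [Pi.sub_apply, AddSubgroupClass.coe_sub] at h5
    rw [h5] at h4
    nlinarith [mul_pos hη h2]
  · refine hbad _ fun C hC => ?_
    -- With thirds, the sieve error contributes at most `4 (η r / 3)²` and the tail at most `(η r /
    -- 3)²`; the sum `5/9 (η r)²` stays below `(η r)²`.
    have hη3 : 0 < min (η / 3) 1 := by positivity
    filter_upwards [hreg, Sofia.eventually_adaptive_estimator hsieve hreg hasym hC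
      hη3 (min_le_right _ _), htail.bound hη3] with n hr hn htail ω hg hm hω
    obtain ⟨-, h1, h2⟩ := hn _ _ _ hg hm
    have hn' : (0 : ℝ) < n := Nat.cast_pos.2 hr.n_pos
    have hp₀ : (0 : ℝ) < (D n).p₀ := Nat.cast_pos.2 hr.design.p₀_pos
    have ht := hr.t_pos
    set r := τm n / Real.sqrt n with hrdef
    have hr0 : 0 < r := by positivity
    set k := min (η / 3) 1 with hk
    have hkη : k ≤ η / 3 := min_le_left _ _
    have h3 : ‖S.coords (D n).m (Fin (D n).p) (βhat n ω) - (D n).coef S‖ ≤ 2 * (k * r) := by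
      have := norm_sub_le_norm_sub_add_norm_sub (S.coords (D n).m (Fin (D n).p) (βhat n ω))
        (S.coords (D n).m (Fin (D n).p) ((D n).oracle S ((D n).response S fun i => ε n i ω)))
        ((D n).coef S)
      linarith
    have h4 : (D n).p₀ * (D n).maxTail S ^ 2 ≤ (k * r) ^ 2 := by
      rw [Real.norm_eq_abs, Real.norm_of_nonneg (by positivity)] at htail
      have h5 := pow_le_pow_left₀ (abs_nonneg _) htail 2
      rw [sq_abs, mul_pow, div_pow, Real.sq_sqrt (by positivity)] at h5
      calc (D n).p₀ * (D n).maxTail S ^ 2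
          ≤ (D n).p₀ * (k ^ 2 * (τm n ^ 2 / ((D n).p₀ * n))) :=
            mul_le_mul_of_nonneg_left h5 hp₀.le
        _ = (k * r) ^ 2 := by
            rw [hrdef, mul_pow, div_pow, Real.sq_sqrt hn'.le]
            field_simp
    have h6 := hr.design.kNormProd_sub_sq_le (βhat n ω)
    have h7 : η * r ≤ S.kNormProd fun j => (βhat n ω j : H) - (D n).β j := hω
    have h8 := pow_le_pow_left₀ (by positivity) h7 2
    have h9 := pow_le_pow_left₀ (norm_nonneg _) h3 2
    have h10 : (k * r) ^ 2 ≤ (η * r) ^ 2 / 9 := by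
      have h11 : k * r ≤ η / 3 * r := mul_le_mul_of_nonneg_right hkη hr0.le
      calc (k * r) ^ 2 ≤ (η / 3 * r) ^ 2 := pow_le_pow_left₀ (by positivity) h11 2
        _ = _ := by ring
    have h12 : 0 < (η * r) ^ 2 := by positivity
    nlinarith
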